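/- \textbf{Setting.} Let $X$ be an infinite, connected, locally finite simple graph. For a set $C$ of vertices let $\theta C$ be the set of vertices outside $C$ adjacent to a vertex of $C$, and $\overline C=C\cup\theta C$. Let $F$ be a set of vertices; the connected components of $X\setminus F$ are called cells, and $X_F$ is the graph on $F$ in which two distinct vertices are adjacent iff both lie in $\theta C$ for some cell $C$. Assume that $X$ is symmetrically self-similar with respect to $F$: (F1) no two vertices of $F$ are adjacent; (F2) $|\overline C\cap\overline D|\le1$ for different cells $C,D$; (F3) $X\cong X_F$; (S1) all cells are finite, and for any cells $C,D$ there is an isomorphism $\hat C\to\hat D$ of the subgraphs spanned by $\overline C,\overline D$ which maps $\theta C$ onto $\theta D$; (S3) for each cell $C$ the automorphisms of $\hat C$ preserving $\theta C$ act transitively on the ordered pairs of distinct elements of $\theta C$. Let $P$ be the transition operator of the simple random walk on $X$, acting on $\ell^2(X)=\{f:\sum_x \deg(x)|f(x)|^2<\infty\}$, let $p^{(n)}(x,y)$ be its $n$-step transition probabilities, and let $G(x,y|z)=\sum_{n\ge0}p^{(n)}(x,y)z^n$, $|z|<1$, be the Green functions. Let $\operatorname{spec}^{-1}P=\{1/\lambda:\lambda\in\operatorname{spec}P\}\subset\overline{\mathbb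 C}$ with $1/0=\infty$. Fix a cell $C$ and $v\ne w$ in $\theta C$. For $B\subset\theta C$ let $Q_B$ be the transition matrix of the simple random walk on $\hat C$ absorbed in $B$ (rows indexed by $B$ are zero), and let $Q_B^*(z)=(I-zQ_B)^{-1}$, a matrix of rational functions. Put $d=(|\theta C|-1)\,(Q^*_{\theta C\setminus\{v\}})_{v,w}$ and $f=(Q^*_{\theta C\setminus\{v\}})_{v,v}$, and let $h(x,y)=(Q^*_{\theta C})_{x,y}$ for $x\in C$, $y\in\overline C$. Regard $d$ as a map $\overline{\mathbb C}\to\overline{\mathbb C}$, and let $\mathcal D=\bigcup_{n\ge0}d^{-n}(E)$, where $E\subset\overline{\mathbb C}$ is the set of all poles of $f$ and of the functions $h(x,y)$. Let $A_0=\{z\in\overline{\mathbb C}:d^n(z)\to0\}$, and let $A_0^*$ be the connected component of $A_0$ containing $0$. Let $\mathcal S$ be the set of singularities of the Green functions in $A_0^*$: the points $z\in A_0^*$ for which some Green function $G(x,y|\cdot)$ has no analytic continuation from the unit disc to any connected open set $W\subset A_0^*$ that contains the unit disc and $z$. (Analytic means holomorphic with values in $\mathbb C$, at $\infty$ in the coordinate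 $1/z$.) \textbf{Theorem.} The set $A_0^*\setminus\mathcal S$ is open and contains the unit disc, and every Green function has a unique analytic continuation from the unit disc to $A_0^*\setminus\mathcal S$. Moreover $A_0^*\setminus\mathcal D\subset A_0^*\setminus\mathcal S$, and \[\operatorname{spec}^{-1}P\setminus\{\infty\}\ \subset\ \overline{\mathbb C}\setminus(A_0^*\setminus\mathcal S)\ \subset\ \overline{\mathbb C}\setminus(A_0^*\setminus\overline{\mathcal D}).\] The point $\infty$ can lie both in $\operatorname{spec}^{-1}P$ and in $A_0^*\setminus\mathcal S$ only if the continuation of some Green function to $A_0^*\setminus\mathcal S$ does not vanish at $\infty$. -/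

import Mathlib

open Set Filter Topology
open scoped OnePoint

namespace SelfSim

noncomputable section

/-! ### Self-similar graphs -/

/-- The vertex boundary of `C`: the vertices outside `C` adjacent to a vertex of `C`. -/
def bdry {V : Type*} (G : SimpleGraph V) (C : Set V) : Set V :=
  {x | x ∉ C ∧ ∃ y ∈ C, G.Adj y x}

/-- The closure `C ∪ ∂C` of a set of vertices. -/
def clos {V : Type*} (G : SimpleGraph V) (C : Set V) : Set V := C ∪ bdry G C

/-- The cells: the (vertex sets of the) connected components of `V ∖ F`. -/
def cells {V : Type*} (G : SimpleGraph V) (F : Set V) : Set (Set V) :=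
  {C | ∃ c : (G.induce Fᶜ).ConnectedComponent, C = Subtype.val '' c.supp}

/-- The reduced graph on `F`: two vertices are joined when they lie on the boundary of a common
cell. -/
def reduced {V : Type*} (G : SimpleGraph V) (F : Set V) : SimpleGraph F where
  Adj x y := x ≠ y ∧ ∃ C ∈ cells G F, (x : V) ∈ bdry G C ∧ (y : V) ∈ bdry G C
  symm := ⟨fun _ _ h => ⟨h.1.symm, h.2.imp fun _ hC => ⟨hC.1, hC.2.2, hC.2.1⟩⟩⟩
  loopless := ⟨fun _ h => h.1 rfl⟩

/-- Self-similarity of `G` with respect to `F`. -/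
structure IsSelfSimilar {V : Type*} (G : SimpleGraph V) (F : Set V) : Prop where
  not_adj : ∀ x ∈ F, ∀ y ∈ F, ¬ G.Adj x y
  inter_subsingleton : ∀ C ∈ cells G F, ∀ D ∈ cells G F, C ≠ D →
    (clos G C ∩ clos G D).Subsingleton
  iso : Nonempty (G ≃g reduced G F)

/-- The boundary of `C` as a set of vertices of the graph spanned by the closure of `C`. -/
def bdryIn {V : Type*} (G : SimpleGraph V) (C : Set V) : Set (clos G C) :=
  {x | (x : V) ∈ bdry G C}

/-- (Doubly) symmetric self-similarity: all cells are finite, the graphs spanned by the closures of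
any two cells are isomorphic by an isomorphism respecting the boundaries, and the automorphisms of
the graph spanned by the closure of a cell `C` which preserve the boundary of `C` act doubly
transitively on it. -/
structure IsSymSelfSimilar {V : Type*} (G : SimpleGraph V) (F : Set V) : Prop
    extends IsSelfSimilar G F where
  finite_cells : ∀ C ∈ cells G F, C.Finite
  cell_iso : ∀ C ∈ cells G F, ∀ D ∈ cells G F,
    ∃ α : G.induce (clos G C) ≃g G.induce (clos G D), α '' bdryIn G C = bdryIn G D
  double_trans : ∀ C ∈ cells G F, ∀ x ∈ bdryIn G C, ∀ y ∈ bdryIn G C,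
    ∀ x' ∈ bdryIn G C, ∀ y' ∈ bdryIn G C, x ≠ y → x' ≠ y' →
    ∃ γ : G.induce (clos G C) ≃g G.induce (clos G C),
      γ '' bdryIn G C = bdryIn G C ∧ γ x = x' ∧ γ y = y'

/-! ### Simple random walk, Green functions, and the transition operator -/

/-- The `n`-step transition probabilities of the simple random walk. -/
def stepProb {V : Type*} (G : SimpleGraph V) [G.LocallyFinite] : ℕ → V → V → ℝ
  | 0, x, y => open Classical in if x = y then 1 else 0
  | n + 1, x, y => (∑ u ∈ G.neighborFinset x, stepProb G n u y) / G.degree x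

/-- The Green function `G(x, y | z) = ∑ p⁽ⁿ⁾(x, y) zⁿ`, used for `|z| < 1`. -/
def green {V : Type*} (G : SimpleGraph V) [G.LocallyFinite] (x y : V) (z : ℂ) : ℂ :=
  ∑' n : ℕ, (stepProb G n x y : ℂ) * z ^ n

/-- The functions `f` with `∑ deg x * |f x| ^ 2 < ∞`, as a linear subspace of `V → ℂ`. -/
def degL2Sub {V : Type*} (G : SimpleGraph V) [G.LocallyFinite] : Submodule ℂ (V → ℂ) where
  carrier := {f | Summable fun x => (G.degree x : ℝ) * ‖f x‖ ^ 2}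
  zero_mem' := by simp
  add_mem' := by
    intro f g hf hg
    refine Summable.of_nonneg_of_le (fun x => by positivity) (fun x => ?_)
      ((hf.mul_left 2).add (hg.mul_left 2))
    have h1 : ‖f x + g x‖ ^ 2 ≤ 2 * ‖f x‖ ^ 2 + 2 * ‖g x‖ ^ 2 := by
      have := norm_add_le (f x) (g x)
      have h0 := norm_nonneg (f x + g x)
      nlinarith [sq_nonneg (‖f x‖ - ‖g x‖)]
    have h2 : (0 : ℝ) ≤ G.degree x := by positivity
    have := mul_le_mul_of_nonneg_left h1 h2
    simp only [Pi.add_apply]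
    linarith
  smul_mem' := by
    intro c f hf
    refine (hf.mul_left (‖c‖ ^ 2)).congr (fun x => ?_)
    simp only [Pi.smul_apply, smul_eq_mul, norm_mul]
    ring

/-- The Hilbert space `ℓ²(X)` with weights `deg x`. -/
def DegL2 {V : Type*} (G : SimpleGraph V) [G.LocallyFinite] : Type _ := degL2Sub G

instance {V : Type*} (G : SimpleGraph V) [G.LocallyFinite] : AddCommGroup (DegL2 G) :=
  inferInstanceAs (AddCommGroup (degL2Sub G))

instance {V : Type*} (G : SimpleGraph V) [G.LocallyFinite] : Module ℂ (DegL2 G) :=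
  inferInstanceAs (Module ℂ (degL2Sub G))

/-- The map `f ↦ (√(deg x) * f x)` into the unweighted `ℓ²`. -/
def toUnweighted {V : Type*} (G : SimpleGraph V) [G.LocallyFinite] :
    DegL2 G →ₗ[ℂ] lp (fun _ : V => ℂ) 2 where
  toFun f := ⟨fun x => (Real.sqrt (G.degree x) : ℂ) * f.1 x, by
    refine memℓp_gen ?_
    refine (show Summable fun x => (G.degree x : ℝ) * ‖f.1 x‖ ^ 2 from f.2).congr (fun x => ?_)
    have h : (0 : ℝ) ≤ G.degree x := by positivity
    simp only [ENNReal.toReal_ofNat, Real.rpow_two, norm_mul, mul_pow, Complex.norm_real,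
      Real.norm_eq_abs, sq_abs, Real.sq_sqrt h]⟩
  map_add' f g := by
    ext x
    exact mul_add _ _ _
  map_smul' c f := by
    ext x
    exact mul_left_comm _ _ _

/-- The norm of `DegL2 G` is `(∑ deg x * |f x| ^ 2) ^ (1/2)`, see `DegL2.norm_sq`. (It is a norm
when `G` has no isolated vertices, in particular when `G` is connected and infinite.) -/
instance {V : Type*} (G : SimpleGraph V) [G.LocallyFinite] : SeminormedAddCommGroup (DegL2 G) :=
  SeminormedAddCommGroup.induced _ _ (toUnweighted G)

instance {V : Type*} (G : SimpleGraph V) [G.LocallyFinite] : NormedSpace ℂ (DegL2 G) :=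
  NormedSpace.induced ℂ (DegL2 G) (lp (fun _ : V => ℂ) 2) (toUnweighted G)

theorem DegL2.norm_sq {V : Type*} (G : SimpleGraph V) [G.LocallyFinite] (f : DegL2 G) :
    ‖f‖ ^ 2 = ∑' x, (G.degree x : ℝ) * ‖f.1 x‖ ^ 2 := by
  have h := lp.norm_rpow_eq_tsum (p := 2) (by norm_num) (toUnweighted G f)
  simp only [ENNReal.toReal_ofNat, Real.rpow_two] at h
  refine (show ‖f‖ ^ 2 = ‖toUnweighted G f‖ ^ 2 from rfl).trans (h.trans (tsum_congr fun x => ?_))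
  have h0 : (0 : ℝ) ≤ G.degree x := by positivity
  have : (toUnweighted G f) x = (Real.sqrt (G.degree x) : ℂ) * f.1 x := rfl
  rw [this, norm_mul, mul_pow, Complex.norm_real, Real.norm_eq_abs, sq_abs, Real.sq_sqrt h0]

/-- The averaging operator of the simple random walk on all functions. -/
def walk {V : Type*} (G : SimpleGraph V) [G.LocallyFinite] (f : V → ℂ) (x : V) : ℂ :=
  (∑ y ∈ G.neighborFinset x, f y) / G.degree x

theorem walk_bound {V : Type*} (G : SimpleGraph V) [G.LocallyFinite] (f : V → ℂ)
    (hf : Summable fun x => (G.degree x : ℝ) * ‖f x‖ ^ 2) :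
    (Summable fun x => (G.degree x : ℝ) * ‖walk G f x‖ ^ 2) ∧
      ∑' x, (G.degree x : ℝ) * ‖walk G f x‖ ^ 2 ≤ ∑' x, (G.degree x : ℝ) * ‖f x‖ ^ 2 := by
  classical
  let a : V → V → ℝ := fun y x => if G.Adj y x then ‖f y‖ ^ 2 else 0
  have ha : ∀ y x, 0 ≤ a y x := fun y x => by dsimp only [a]; split_ifs <;> positivity
  have hrow : ∀ y, HasSum (a y) ((G.degree y : ℝ) * ‖f y‖ ^ 2) := by
    intro y
    have h := hasSum_sum_of_ne_finset_zero (L := .unconditional V) (f := a y) (s := G.neighborFinset y) (fun x hx => by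
      have : ¬ G.Adj y x := by simpa using hx
      simp [a, this])
    have h2 : ∑ x ∈ G.neighborFinset y, a y x = (G.degree y : ℝ) * ‖f y‖ ^ 2 := by
      rw [Finset.sum_congr rfl (g := fun _ => ‖f y‖ ^ 2) (fun x hx => by
        have : G.Adj y x := by simpa using hx
        simp [a, this])]
      simp
    rwa [h2] at h
  have hcol : ∀ x, HasSum (fun y => a y x) (∑ y ∈ G.neighborFinset x, ‖f y‖ ^ 2) := by
    intro x
    have h := hasSum_sum_of_ne_finset_zero (L := .unconditional V) (f := fun y => a y x) (s := G.neighborFinset x)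
      (fun y hy => by
        have : ¬ G.Adj y x := fun h => hy (by simpa using h.symm)
        simp [a, this])
    rwa [Finset.sum_congr rfl (g := fun y => ‖f y‖ ^ 2) (fun y hy => by
        have : G.Adj y x := ((G.mem_neighborFinset x y).1 hy).symm
        simp [a, this])] at h
  have hsum : Summable (Function.uncurry a) :=
    (summable_prod_of_nonneg (fun p => ha p.1 p.2)).2
      ⟨fun y => (hrow y).summable, hf.congr fun y => ((hrow y).tsum_eq).symm⟩
  have hswap : Summable fun p : V × V => a p.2 p.1 := hsum.prod_symm
  have hs : Summable fun x => ∑ y ∈ G.neighborFinset x, ‖f y‖ ^ 2 :=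
    (((summable_prod_of_nonneg (fun p : V × V => ha p.2 p.1)).1 hswap).2).congr
      fun x => ((hcol x).tsum_eq)
  have hle : ∀ x, (G.degree x : ℝ) * ‖walk G f x‖ ^ 2 ≤ ∑ y ∈ G.neighborFinset x, ‖f y‖ ^ 2 := by
    intro x
    rcases Nat.eq_zero_or_pos (G.degree x) with h0 | h0
    · rw [h0]
      simpa using Finset.sum_nonneg fun y _ => by positivity
    have hd : (0 : ℝ) < G.degree x := by exact_mod_cast h0
    have h1 : ‖∑ y ∈ G.neighborFinset x, f y‖ ≤ ∑ y ∈ G.neighborFinset x, ‖f y‖ := norm_sum_le _ _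
    have h2 := sq_sum_le_card_mul_sum_sq (s := G.neighborFinset x) (f := fun y => ‖f y‖)
    rw [SimpleGraph.card_neighborFinset_eq_degree] at h2
    have h3 : ‖∑ y ∈ G.neighborFinset x, f y‖ ^ 2 ≤
        G.degree x * ∑ y ∈ G.neighborFinset x, ‖f y‖ ^ 2 :=
      (pow_le_pow_left₀ (norm_nonneg _) h1 2).trans h2
    rw [walk, norm_div, Complex.norm_natCast, div_pow, mul_div_assoc', div_le_iff₀ (by positivity)]
    nlinarith
  have hw := Summable.of_nonneg_of_le (fun x => by positivity) hle hs
  refine ⟨hw, (hw.tsum_le_tsum hle hs).trans (le_of_eq ?_)⟩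
  calc ∑' x, ∑ y ∈ G.neighborFinset x, ‖f y‖ ^ 2 = ∑' x, ∑' y, a y x :=
        tsum_congr fun x => ((hcol x).tsum_eq).symm
    _ = ∑' y, ∑' x, a y x := hsum.tsum_comm
    _ = _ := tsum_congr fun y => (hrow y).tsum_eq

/-- The transition operator `P` on `ℓ²(X)`, a bounded operator. -/
def transOp {V : Type*} (G : SimpleGraph V) [G.LocallyFinite] : DegL2 G →L[ℂ] DegL2 G :=
  LinearMap.mkContinuous
    { toFun := fun f => (⟨walk G f.1, (walk_bound G f.1 f.2).1⟩ : degL2Sub G)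
      map_add' := fun f g => Subtype.ext <| funext fun x =>
        show walk G (f.1 + g.1) x = walk G f.1 x + walk G g.1 x by
          simp only [walk, Pi.add_apply, Finset.sum_add_distrib, add_div]
      map_smul' := fun c f => Subtype.ext <| funext fun x =>
        show walk G (c • f.1) x = c * walk G f.1 x by
          simp only [walk, Pi.smul_apply, smul_eq_mul, ← Finset.mul_sum, mul_div_assoc] }
    1 (fun f => by
      rw [one_mul]
      refine (sq_le_sq₀ (norm_nonneg _) (norm_nonneg _)).1 ?_
      rw [DegL2.norm_sq, DegL2.norm_sq]
      exact (walk_bound G f.1 f.2).2)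

/-! ### The Riemann sphere -/

/-- The map `w ↦ 1 / w` from `ℂ` to the Riemann sphere, with `1 / 0 = ∞`. -/
def recip (w : ℂ) : OnePoint ℂ := open Classical in if w = 0 then ∞ else ((w⁻¹ : ℂ) : OnePoint ℂ)

/-- Analyticity of a complex-valued function at a point of the Riemann sphere; at `∞` in the
coordinate `w = 1 / z`. -/
def AnalyticAtSphere (g : OnePoint ℂ → ℂ) (z : OnePoint ℂ) : Prop :=
  z.elim (AnalyticAt ℂ (fun w : ℂ => g (recip w)) 0)
    (fun a => AnalyticAt ℂ (fun w : ℂ => g (w : OnePoint ℂ)) a)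

/-- The map of the Riemann sphere to itself given by a rational function (whose numerator and
denominator are coprime). -/
def ratMap (r : RatFunc ℂ) (z : OnePoint ℂ) : OnePoint ℂ :=
  open Classical in
  z.elim
    (if r.denom.natDegree < r.num.natDegree then ∞
      else ((r.num.coeff r.denom.natDegree / r.denom.leadingCoeff : ℂ) : OnePoint ℂ))
    (fun a => if r.denom.eval a = 0 then ∞
      else ((r.num.eval a / r.denom.eval a : ℂ) : OnePoint ℂ))

/-- The poles of a rational function, on the Riemann sphere. -/
def poles (r : RatFunc ℂ) : Set (OnePoint ℂ) := {z | ratMap r z = ∞}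

/-! ### Transition function, return function, inner transition functions -/

/-- Transition matrix of the simple random walk on the graph spanned by the closure of `C`, with
absorbing set `B`. -/
def absMatrix {V : Type*} (G : SimpleGraph V) (C B : Set V) :
    Matrix (clos G C) (clos G C) ℂ := fun x y =>
  open Classical in
  if G.Adj x y ∧ (x : V) ∉ B then (((G.induce (clos G C)).neighborSet x).ncard : ℂ)⁻¹ else 0

/-- The matrix `(I - z Q_B)⁻¹` of rational functions of `z`, for a set `C` with finite closure (and
`0` otherwise). -/
def starMatrix {V : Type*} (G : SimpleGraph V) (C B : Set V) :
    Matrix (clos G C) (clos G C) (RatFunc ℂ) :=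
  open Classical in
  if _ : Finite (clos G C) then
    letI : Fintype (clos G C) := Fintype.ofFinite _
    letI : DecidableEq (clos G C) := Classical.decEq _
    (1 - (RatFunc.X : RatFunc ℂ) • (absMatrix G C B).map (RatFunc.C (K := ℂ)))⁻¹
  else 0

/-- The transition function `d`, for a cell `C` and boundary vertices `v ≠ w`. -/
def transitionFn {V : Type*} (G : SimpleGraph V) (C : Set V) (v w : clos G C) : RatFunc ℂ :=
  starMatrix G C (bdry G C \ {(v : V)}) v w * RatFunc.C (((bdry G C).ncard : ℂ) - 1)

/-- The return function `f`, for a cell `C` and a boundary vertex `v`. -/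
def returnFn {V : Type*} (G : SimpleGraph V) (C : Set V) (v : clos G C) : RatFunc ℂ :=
  starMatrix G C (bdry G C \ {(v : V)}) v v

/-- The poles of the inner transition functions `h(x, y)`, `x ∈ C`, `y ∈ C ∪ ∂C`. -/
def innerPoles {V : Type*} (G : SimpleGraph V) (C : Set V) : Set (OnePoint ℂ) :=
  {z | ∃ x y : clos G C, (x : V) ∈ C ∧ z ∈ poles (starMatrix G C (bdry G C) x y)}

/-- The discrete exceptional set `𝒟`: all iterated `d`-preimages of the poles of the return function
and of the inner transition functions. -/
def exceptionalSet {V : Type*} (G : SimpleGraph V) (C : Set V) (v w : clos G C) :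
    Set (OnePoint ℂ) :=
  ⋃ n : ℕ, (ratMap (transitionFn G C v w))^[n] ⁻¹' (poles (returnFn G C v) ∪ innerPoles G C)

/-- The basin of attraction of `0` under the iteration of a rational function. -/
def basin (d : RatFunc ℂ) : Set (OnePoint ℂ) :=
  {z | Tendsto (fun n : ℕ => (ratMap d)^[n] z) atTop (𝓝 ((0 : ℂ) : OnePoint ℂ))}

/-- The immediate basin of attraction of `0`. -/
def immediateBasin (d : RatFunc ℂ) : Set (OnePoint ℂ) :=
  connectedComponentIn (basin d) ((0 : ℂ) : OnePoint ℂ)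

/-! ### Analytic continuation and spectrum -/

/-- `g` is an analytic continuation of the Green function `G(x, y | ·)` from the open unit disc
to `Ω`. -/
def IsContinuation {V : Type*} (G : SimpleGraph V) [G.LocallyFinite] (x y : V)
    (Ω : Set (OnePoint ℂ)) (g : OnePoint ℂ → ℂ) : Prop :=
  (∀ z : ℂ, ‖z‖ < 1 → (z : OnePoint ℂ) ∈ Ω) ∧ (∀ z ∈ Ω, AnalyticAtSphere g z) ∧
    ∀ z : ℂ, ‖z‖ < 1 → g (z : OnePoint ℂ) = green G x y z

/-- The singularities in `A` of all Green functions: the points of `A` to which some Green function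
cannot be continued analytically inside `A`, that is, along no connected open set between the unit
disc and `A` which contains the point. -/
def singularities {V : Type*} (G : SimpleGraph V) [G.LocallyFinite] (A : Set (OnePoint ℂ)) :
    Set (OnePoint ℂ) :=
  {z ∈ A | ∃ x y : V, ¬ ∃ (W : Set (OnePoint ℂ)) (g : OnePoint ℂ → ℂ),
    IsOpen W ∧ IsConnected W ∧ W ⊆ A ∧ z ∈ W ∧ IsContinuation G x y W g}

/-- The reciprocal spectrum `{1 / λ | λ ∈ spec P}`, with `1 / 0 = ∞`. -/
def recipSpec {V : Type*} (G : SimpleGraph V) [G.LocallyFinite] : Set (OnePoint ℂ) :=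
  recip '' spectrum ℂ (transOp G)

end

end SelfSim

/-!
Write `P` for the transition operator, `d` for the transition function, `f` for the return function
and `E` for the set of poles of `f` and of the inner transition functions.

**Renormalization.** Off `F` the operator `1 - zP` splits into the finite matrices belonging to the
cells. These are conjugate to each other by permutations, so if `z` is no pole of the inner
transition functions, a single polynomial in the walk absorbed in `F` inverts all of them, and the
inverse preserves `ℓ²` (`exists_inverse_offWalk`). Double transitivity on the boundaries of the
cells, together with the fact that adjacent vertices of the reduced graph share exactly one cell,
shows that the Schur complement on `F` is a multiple of `1 - d(z)P` on the isomorphic reduced graph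
(`walk_extension`, `exists_schur`). Hence `1 - zP` is invertible if `1 - d(z)P` is and `z ∉ E`
(`solvable_of_solvable_transition`), and `G(ψ x, ψ y | z) = f(z) G(x, y | d(z))` for an isomorphism
`ψ` onto the reduced graph (`walkRes_functional_equation`).

**The basin.** In the unit disc `|d(z)| ≤ |z|²` (`norm_transitionFn_le`), so the disc lies in the
basin of `0`, and every orbit in the basin enters it. For `z` in the disc `1 - zP` is invertible,
because `P` has norm at most `1`. Following the orbit backwards, `1 - zP` is invertible at every
finite point of the basin outside the exceptional set `𝒟` (`solvable_of_notMem_exceptionalSet`).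
Since `d` is not constant and `E` is finite and misses the disc, `𝒟` is discrete in the basin
(`IsContracting.eventually_notMem_preimages`), so `A \ 𝒟` is open and connected, where `A` is the
immediate basin. The matrix coefficients of the resolvent continue the Green functions to `A \ 𝒟`
(`isContinuation_resFn`). If `∞` lies there, analyticity at `∞` needs an argument of its own, as
`1 - zP` makes no sense: coefficients between vertices of `F` extend by the functional equation,
because `d(∞)` is finite, and the others are obtained from them through the finitely many vertices
on the boundary of a cell and through the reversibility of the walk (`removableAt_infty_resFn`).

**Singularities.** Let `𝒮` be the set of singularities of the Green functions in `A`. A continuation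
of a Green function near a point of `A \ 𝒮` agrees with the resolvent off `𝒟` by the identity
theorem. So at points of `𝒟 \ 𝒮` the resolvent coefficients have removable singularities, and
filling them in gives the continuation to `A \ 𝒮` (`isContinuation_puncturedLim`).

**Spectrum.** If `1 / c ∈ A \ 𝒮`, then a punctured neighbourhood of `c` lies in the resolvent set.
The contour integral of the resolvent around `c` vanishes, since all its matrix coefficients are
integrals of analytic functions; for `c = 0` this requires that the continuations vanish at `∞`.
Then Cauchy's formula provides the inverse of `c - P`
(`notMem_spectrum_of_circleIntegral_resolvent`, `notMem_spectrum_of_extension`).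
-/

namespace SelfSim

/-! ### Charts of the Riemann sphere -/

theorem recip_zero : recip 0 = ∞ := by simp [recip]

theorem recip_of_ne {w : ℂ} (hw : w ≠ 0) : recip w = ((w⁻¹ : ℂ) : OnePoint ℂ) := by
  simp [recip, hw]

/-- The inversion `z ↦ 1 / z` of the Riemann sphere. -/
noncomputable def sphereInv (z : OnePoint ℂ) : OnePoint ℂ := z.elim ((0 : ℂ) : OnePoint ℂ) recip

theorem sphereInv_infty : sphereInv ∞ = ((0 : ℂ) : OnePoint ℂ) := rfl

theorem sphereInv_coe (w : ℂ) : sphereInv (w : OnePoint ℂ) = recip w := rfl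

theorem sphereInv_recip (w : ℂ) : sphereInv (recip w) = (w : OnePoint ℂ) := by
  by_cases hw : w = 0
  · rw [hw, recip_zero, sphereInv_infty]
  · rw [recip_of_ne hw, sphereInv_coe, recip_of_ne (inv_ne_zero hw), inv_inv]

theorem sphereInv_involutive : Function.Involutive sphereInv := by
  intro z
  induction z using OnePoint.rec with
  | infty => rw [sphereInv_infty, sphereInv_coe, recip_zero]
  | coe w => rw [sphereInv_coe, sphereInv_recip]

theorem continuous_sphereInv : Continuous sphereInv := by
  rw [continuous_iff_continuousAt]
  intro z
  induction z using OnePoint.rec with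
  | infty =>
    rw [OnePoint.continuousAt_infty']
    rw [sphereInv_infty, coclosedCompact_eq_cocompact, ← Metric.cobounded_eq_cocompact]
    have h : Tendsto (fun w : ℂ => ((w⁻¹ : ℂ) : OnePoint ℂ)) (Bornology.cobounded ℂ)
        (𝓝 ((0 : ℂ) : OnePoint ℂ)) :=
      (OnePoint.continuous_coe.tendsto 0).comp tendsto_inv₀_cobounded
    refine h.congr' ?_
    filter_upwards [Bornology.eventually_ne_cobounded (0 : ℂ)] with w hw
    exact (recip_of_ne hw).symm
  | coe w =>
    rw [OnePoint.continuousAt_coe]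
    by_cases hw : w = 0
    · subst hw
      rw [continuousAt_iff_punctured_nhds]
      have h : Tendsto (fun w : ℂ => ((w⁻¹ : ℂ) : OnePoint ℂ)) (𝓝[≠] 0) (𝓝 ∞) := by
        have h1 := (OnePoint.tendsto_coe_infty (X := ℂ))
        rw [coclosedCompact_eq_cocompact, ← Metric.cobounded_eq_cocompact] at h1
        exact h1.comp tendsto_inv₀_nhdsNE_zero
      have h0 : (sphereInv ∘ ((↑) : ℂ → OnePoint ℂ)) 0 = ∞ := recip_zero
      rw [h0]
      refine h.congr' ?_
      filter_upwards [self_mem_nhdsWithin] with w hw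
      exact (recip_of_ne hw).symm
    · have h : ContinuousAt (fun w : ℂ => ((w⁻¹ : ℂ) : OnePoint ℂ)) w :=
        OnePoint.continuous_coe.continuousAt.comp (continuousAt_inv₀ hw)
      refine h.congr ?_
      filter_upwards [isOpen_ne.mem_nhds hw] with w hw
      exact (recip_of_ne hw).symm

/-- A chart of the Riemann sphere which is compatible with `AnalyticAtSphere`. -/
structure IsChart (φ : ℂ → OnePoint ℂ) : Prop where
  emb : IsOpenEmbedding φ
  analytic_iff : ∀ (g : OnePoint ℂ → ℂ) (w : ℂ),
    AnalyticAtSphere g (φ w) ↔ AnalyticAt ℂ (fun t => g (φ t)) w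

theorem isChart_coe : IsChart ((↑) : ℂ → OnePoint ℂ) :=
  ⟨OnePoint.isOpenEmbedding_coe, fun _ _ => Iff.rfl⟩

theorem isOpenEmbedding_recip : IsOpenEmbedding recip :=
  (sphereInv_involutive.toPerm.toHomeomorphOfIsInducing
    (IsInducing.of_comp continuous_sphereInv continuous_sphereInv (by
      have : sphereInv ∘ sphereInv_involutive.toPerm = id := funext sphereInv_involutive
      rw [this]; exact IsInducing.id))).isOpenEmbedding.comp
    OnePoint.isOpenEmbedding_coe

theorem isChart_recip : IsChart recip := by
  refine ⟨isOpenEmbedding_recip, fun g w => ?_⟩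
  by_cases hw : w = 0
  · subst hw
    rw [recip_zero]
    exact Iff.rfl
  have h : ∀ {w : ℂ}, w ≠ 0 →
      (fun t => g (recip t)) =ᶠ[𝓝 w] fun t => g ((t⁻¹ : ℂ) : OnePoint ℂ) := by
    intro w hw
    filter_upwards [isOpen_ne.mem_nhds hw] with t ht
    rw [recip_of_ne ht]
  have h' : (fun t : ℂ => g (t : OnePoint ℂ)) =ᶠ[𝓝 w⁻¹] fun t => g (recip t⁻¹) := by
    filter_upwards [isOpen_ne.mem_nhds (inv_ne_zero hw)] with t ht
    rw [recip_of_ne (inv_ne_zero ht), inv_inv]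
  rw [recip_of_ne hw]
  change AnalyticAt ℂ (fun t : ℂ => g (t : OnePoint ℂ)) w⁻¹ ↔ _
  rw [analyticAt_congr (h hw), analyticAt_congr h']
  constructor
  · intro H
    have h2 := H.comp_of_eq (analyticAt_inv hw) rfl
    refine h2.congr ?_
    filter_upwards [isOpen_ne.mem_nhds hw] with t ht
    simp only [Function.comp_apply, inv_inv]
    rw [recip_of_ne ht]
  · intro H
    have h2 := H.comp_of_eq (analyticAt_inv (inv_ne_zero hw)) (inv_inv w)
    refine h2.congr ?_
    filter_upwards [isOpen_ne.mem_nhds (inv_ne_zero hw)] with t ht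
    simp only [Function.comp_apply, inv_inv]
    rw [recip_of_ne (inv_ne_zero ht), inv_inv]

theorem exists_chart (z : OnePoint ℂ) : ∃ (φ : ℂ → OnePoint ℂ) (a : ℂ), IsChart φ ∧ φ a = z := by
  induction z using OnePoint.rec with
  | infty => exact ⟨recip, 0, isChart_recip, recip_zero⟩
  | coe w => exact ⟨_, w, isChart_coe, rfl⟩

theorem IsChart.nhdsNE {φ : ℂ → OnePoint ℂ} (h : IsChart φ) (a : ℂ) :
    map φ (𝓝[≠] a) = 𝓝[≠] (φ a) := by
  have := h.emb.toIsEmbedding.map_nhdsWithin_eq {a}ᶜ a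
  rw [this]
  refine nhdsWithin_eq_nhdsWithin (mem_range_self a) (h.emb.isOpen_range) ?_
  ext z
  constructor
  · rintro ⟨⟨t, ht, rfl⟩, h2⟩
    exact ⟨fun h3 => ht (h.emb.injective h3), h2⟩
  · rintro ⟨h1, ⟨t, rfl⟩⟩
    exact ⟨⟨t, fun h3 => h1 (by rw [h3]; rfl), rfl⟩, mem_range_self t⟩

instance nhdsNE_sphere_neBot (z : OnePoint ℂ) : (𝓝[≠] z).NeBot := by
  obtain ⟨φ, a, h, rfl⟩ := exists_chart z
  rw [← h.nhdsNE]
  infer_instance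

theorem locallyConnectedSpace_sphere : LocallyConnectedSpace (OnePoint ℂ) := by
  rw [locallyConnectedSpace_iff_connected_subsets]
  intro z U hU
  obtain ⟨φ, a, h, rfl⟩ := exists_chart z
  have h1 : φ ⁻¹' U ∈ 𝓝 a := h.emb.continuous.continuousAt hU
  obtain ⟨ε, hε, hb⟩ := Metric.mem_nhds_iff.1 h1
  refine ⟨φ '' Metric.ball a ε, ?_, ?_, image_subset_iff.2 hb⟩
  · rw [← h.emb.map_nhds_eq]
    exact image_mem_map (Metric.ball_mem_nhds a hε)
  · exact (convex_ball a ε).isPreconnected.image _ h.emb.continuous.continuousOn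

/-! ### Analytic functions on the Riemann sphere -/

theorem AnalyticAtSphere.congr {g g' : OnePoint ℂ → ℂ} {z : OnePoint ℂ} (h : AnalyticAtSphere g z)
    (e : g =ᶠ[𝓝 z] g') : AnalyticAtSphere g' z := by
  obtain ⟨φ, a, hφ, rfl⟩ := exists_chart z
  rw [hφ.analytic_iff] at h ⊢
  exact AnalyticAt.congr h (hφ.emb.continuous.continuousAt.eventually e)

theorem AnalyticAtSphere.continuousAt {g : OnePoint ℂ → ℂ} {z : OnePoint ℂ}
    (h : AnalyticAtSphere g z) : ContinuousAt g z := by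
  obtain ⟨φ, a, hφ, rfl⟩ := exists_chart z
  rw [hφ.analytic_iff] at h
  exact hφ.emb.continuousAt_iff.1 h.continuousAt

theorem AnalyticAtSphere.add {g g' : OnePoint ℂ → ℂ} {z : OnePoint ℂ} (h : AnalyticAtSphere g z)
    (h' : AnalyticAtSphere g' z) : AnalyticAtSphere (fun t => g t + g' t) z := by
  obtain ⟨φ, a, hφ, rfl⟩ := exists_chart z
  rw [hφ.analytic_iff] at h h' ⊢
  exact h.add h'

theorem AnalyticAtSphere.sub {g g' : OnePoint ℂ → ℂ} {z : OnePoint ℂ} (h : AnalyticAtSphere g z)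
    (h' : AnalyticAtSphere g' z) : AnalyticAtSphere (fun t => g t - g' t) z := by
  obtain ⟨φ, a, hφ, rfl⟩ := exists_chart z
  rw [hφ.analytic_iff] at h h' ⊢
  exact h.sub h'

theorem AnalyticAtSphere.mul {g g' : OnePoint ℂ → ℂ} {z : OnePoint ℂ} (h : AnalyticAtSphere g z)
    (h' : AnalyticAtSphere g' z) : AnalyticAtSphere (fun t => g t * g' t) z := by
  obtain ⟨φ, a, hφ, rfl⟩ := exists_chart z
  rw [hφ.analytic_iff] at h h' ⊢
  exact h.mul h'

theorem AnalyticAtSphere.const (c : ℂ) (z : OnePoint ℂ) : AnalyticAtSphere (fun _ => c) z := by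
  obtain ⟨φ, a, hφ, rfl⟩ := exists_chart z
  rw [hφ.analytic_iff]
  exact analyticAt_const

theorem AnalyticAtSphere.sum {ι : Type*} (s : Finset ι) {g : ι → OnePoint ℂ → ℂ} {z : OnePoint ℂ}
    (h : ∀ i ∈ s, AnalyticAtSphere (g i) z) : AnalyticAtSphere (fun t => ∑ i ∈ s, g i t) z := by
  classical
  induction s using Finset.induction_on with
  | empty => simpa using AnalyticAtSphere.const 0 z
  | insert i s hi ih =>
    simp only [Finset.sum_insert hi]
    exact (h i (Finset.mem_insert_self i s)).add
      (ih fun j hj => h j (Finset.mem_insert_of_mem hj))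

/-- The identity theorem on the Riemann sphere. -/
theorem eqOn_of_preconnected {g g' : OnePoint ℂ → ℂ} {U : Set (OnePoint ℂ)}
    (hU : IsPreconnected U) (hg : ∀ z ∈ U, AnalyticAtSphere g z)
    (hg' : ∀ z ∈ U, AnalyticAtSphere g' z) {z₀ : OnePoint ℂ} (hz₀ : z₀ ∈ U)
    (h : g =ᶠ[𝓝 z₀] g') : EqOn g g' U := by
  have key : U ⊆ {z | g =ᶠ[𝓝 z] g'} := by
    refine hU.subset_of_closure_inter_subset ?_ ⟨z₀, hz₀, h⟩ ?_
    · exact isOpen_iff_mem_nhds.2 fun z hz => eventually_eventually_nhds.2 hz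
    · rintro z ⟨hz, hzU⟩
      obtain ⟨φ, a, hφ, rfl⟩ := exists_chart z
      have h1 := (hφ.analytic_iff _ _).1 ((hg _ hzU).sub (hg' _ hzU))
      rcases h1.eventually_eq_zero_or_eventually_ne_zero with h2 | h2
      · change ∀ᶠ t in 𝓝 (φ a), g t = g' t
        rw [← hφ.emb.map_nhds_eq, eventually_map]
        exact h2.mono fun t ht => sub_eq_zero.1 ht
      · have h3 : ∀ᶠ t in 𝓝[≠] (φ a), g t ≠ g' t := by
          rw [← hφ.nhdsNE, eventually_map]
          exact h2.mono fun t ht h => ht (sub_eq_zero.2 h)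
        rw [eventually_nhdsWithin_iff] at h3
        obtain ⟨y, hy1, hy2⟩ := (mem_closure_iff_frequently.1 hz).and_eventually h3 |>.exists
        by_cases hya : y = φ a
        · rwa [hya] at hy1
        · exact absurd hy1.self_of_nhds (hy2 hya)
  exact fun z hz => (key hz).self_of_nhds

theorem isPreconnected_ball_diff_center (a : ℂ) (ρ : ℝ) :
    IsPreconnected (Metric.ball a ρ \ {a}) := by
  have h : Metric.ball a ρ \ {a} =
      (fun p : ℝ × ℝ => a + p.1 * Complex.exp (p.2 * Complex.I)) '' (Ioo 0 ρ ×ˢ univ) := by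
    ext z
    constructor
    · rintro ⟨h1, h2⟩
      refine ⟨(‖z - a‖, (z - a).arg), ⟨⟨norm_pos_iff.2 (sub_ne_zero.2 h2), ?_⟩, mem_univ _⟩, ?_⟩
      · rwa [Metric.mem_ball, dist_eq_norm] at h1
      · simp [Complex.norm_mul_exp_arg_mul_I]
    · rintro ⟨⟨r, t⟩, ⟨⟨h1, h2⟩, -⟩, rfl⟩
      have h3 : ‖(r : ℂ) * Complex.exp (t * Complex.I)‖ = r := by
        rw [norm_mul, Complex.norm_exp_ofReal_mul_I, mul_one, Complex.norm_real,
          Real.norm_of_nonneg h1.le]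
      refine ⟨by simpa [dist_eq_norm, abs_of_pos h1] using h2, fun h4 => ?_⟩
      have h5 : (r : ℂ) * Complex.exp (t * Complex.I) = 0 := by simpa using h4
      rw [h5, norm_zero] at h3
      exact h1.ne h3
  rw [h]
  exact ((convex_Ioo 0 ρ).prod convex_univ).isPreconnected.image _ (by fun_prop)

/-- Removing a relatively discrete set from a connected open subset of the sphere leaves a
connected set. -/
theorem isPreconnected_diff_of_discrete {W D : Set (OnePoint ℂ)} (hW : IsPreconnected W)
    (hWo : IsOpen W) (hD : ∀ z ∈ W, ∀ᶠ y in 𝓝[≠] z, y ∉ D) : IsPreconnected (W \ D) := by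
  rw [isPreconnected_iff_subset_of_disjoint]
  intro u v hu hv huv hdis
  -- near each point of `W`, a punctured neighbourhood lies entirely in `u` or entirely in `v`
  have loc : ∀ z ∈ W, (∀ᶠ y in 𝓝[≠] z, y ∈ u) ∨ (∀ᶠ y in 𝓝[≠] z, y ∈ v) := by
    intro z hz
    obtain ⟨φ, a, hφ, rfl⟩ := exists_chart z
    have h1 : ∀ᶠ y in 𝓝[≠] (φ a), y ∈ W \ D :=
      ((hWo.eventually_mem hz).filter_mono nhdsWithin_le_nhds).and (hD _ hz)
    rw [← hφ.nhdsNE, eventually_map] at h1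
    obtain ⟨ρ, hρ, hb⟩ := Metric.mem_nhdsWithin_iff.1 h1
    have hb' : φ '' (Metric.ball a ρ \ {a}) ⊆ W \ D := by
      rintro _ ⟨t, ht, rfl⟩
      exact hb ⟨ht.1, ht.2⟩
    have hc : IsPreconnected (φ '' (Metric.ball a ρ \ {a})) :=
      (isPreconnected_ball_diff_center a ρ).image _ hφ.emb.continuous.continuousOn
    have hmem : Metric.ball a ρ \ {a} ∈ 𝓝[≠] a :=
      sdiff_mem_nhdsWithin_compl (Metric.ball_mem_nhds a hρ) {a}
    rcases isPreconnected_iff_subset_of_disjoint.1 hc u v hu hv (hb'.trans huv)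
      (by
        rw [eq_empty_iff_forall_notMem] at hdis ⊢
        exact fun y hy => hdis y ⟨hb' hy.1, hy.2⟩) with h | h
    · left
      rw [← hφ.nhdsNE, eventually_map]
      filter_upwards [hmem] with t ht using h (mem_image_of_mem _ ht)
    · right
      rw [← hφ.nhdsNE, eventually_map]
      filter_upwards [hmem] with t ht using h (mem_image_of_mem _ ht)
  have hop : ∀ s : Set (OnePoint ℂ), IsOpen s → IsOpen {z | ∀ᶠ y in 𝓝[≠] z, y ∈ s} := by
    intro s hs
    rw [isOpen_iff_mem_nhds]
    intro z hz
    have h1 := eventually_eventually_nhdsWithin.2 hz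
    rw [eventually_nhdsWithin_iff] at h1
    filter_upwards [h1] with y hy
    by_cases hyz : y = z
    · rw [hyz]; exact hz
    · have h2 := hy hyz
      rw [eventually_nhdsWithin_iff] at h2
      exact Filter.Eventually.filter_mono nhdsWithin_le_nhds (by
        filter_upwards [h2, isOpen_ne.mem_nhds hyz] with t ht htz using ht htz)
  have lim : ∀ s t : Set (OnePoint ℂ), IsOpen s → W \ D ∩ (s ∩ t) = ∅ →
      ∀ z ∈ W \ D, (∀ᶠ y in 𝓝[≠] z, y ∈ t) → z ∉ s := by
    intro s t hs hst z hz ht hzs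
    obtain ⟨y, h1, h2, h3, h4⟩ := (ht.and (((hs.eventually_mem hzs).filter_mono
      nhdsWithin_le_nhds).and (((hWo.eventually_mem hz.1).filter_mono nhdsWithin_le_nhds).and
      (hD _ hz.1)))).exists
    exact (eq_empty_iff_forall_notMem.1 hst) y ⟨⟨h3, h4⟩, h2, h1⟩
  rcases isPreconnected_iff_subset_of_disjoint.1 hW _ _ (hop u hu) (hop v hv) loc (by
    rw [eq_empty_iff_forall_notMem]
    rintro z ⟨hz, h1 : ∀ᶠ y in 𝓝[≠] z, y ∈ u, h2 : ∀ᶠ y in 𝓝[≠] z, y ∈ v⟩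
    obtain ⟨y, h1, h2, h3, h4⟩ := (h1.and (h2.and
      (((hWo.eventually_mem hz).filter_mono nhdsWithin_le_nhds).and (hD _ hz)))).exists
    exact (eq_empty_iff_forall_notMem.1 hdis) y ⟨⟨h3, h4⟩, h1, h2⟩) with h | h
  · left
    intro z hz
    exact (huv hz).resolve_right (lim v u hv (by rwa [inter_comm v u]) z hz (h hz.1))
  · right
    intro z hz
    exact (huv hz).resolve_left (lim u v hu hdis z hz (h hz.1))

/-! ### Rational maps of the Riemann sphere -/

theorem ratMap_coe (r : RatFunc ℂ) (a : ℂ) : ratMap r (a : OnePoint ℂ) =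
    if r.denom.eval a = 0 then ∞ else ((r.num.eval a / r.denom.eval a : ℂ) : OnePoint ℂ) := by
  classical
  change (if r.denom.eval a = 0 then ∞ else ((r.num.eval a / r.denom.eval a : ℂ) : OnePoint ℂ)) = _
  congr

theorem ratMap_infty (r : RatFunc ℂ) : ratMap r ∞ =
    if r.denom.natDegree < r.num.natDegree then ∞
      else ((r.num.coeff r.denom.natDegree / r.denom.leadingCoeff : ℂ) : OnePoint ℂ) := by
  change (if r.denom.natDegree < r.num.natDegree then ∞
      else ((r.num.coeff r.denom.natDegree / r.denom.leadingCoeff : ℂ) : OnePoint ℂ)) = _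
  congr

theorem recip_div (a b : ℂ) (hb : b ≠ 0) :
    recip (a / b) = if a = 0 then ∞ else ((b / a : ℂ) : OnePoint ℂ) := by
  split_ifs with h
  · rw [h, zero_div, recip_zero]
  · rw [recip_of_ne (div_ne_zero h hb), inv_div]

theorem num_eval_ne_zero (r : RatFunc ℂ) {a : ℂ} (h : r.denom.eval a = 0) : r.num.eval a ≠ 0 := by
  obtain ⟨p, q, hpq⟩ := r.isCoprime_num_denom
  intro h0
  have := congrArg (Polynomial.eval a) hpq
  simp [h, h0] at this

theorem eval_inv_eq (p : Polynomial ℂ) {w : ℂ} (hw : w ≠ 0) :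
    p.eval w⁻¹ = p.reverse.eval w / w ^ p.natDegree := by
  have : Invertible w⁻¹ := invertibleOfNonzero (inv_ne_zero hw)
  have h := Polynomial.eval₂_reverse_mul_pow (RingHom.id ℂ) w⁻¹ p
  rw [invOf_eq_inv, inv_inv] at h
  simp only [Polynomial.eval₂_id] at h
  rw [← h, inv_pow, div_eq_mul_inv]

theorem reverse_eval_zero (p : Polynomial ℂ) : p.reverse.eval 0 = p.leadingCoeff := by
  rw [← Polynomial.coeff_zero_eq_eval_zero, Polynomial.coeff_zero_reverse]

/-- A rational map is, in suitable charts of the sphere, an analytic function. -/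
theorem exists_lift_ratMap (r : RatFunc ℂ) (z : OnePoint ℂ) :
    ∃ (φ ψ : ℂ → OnePoint ℂ) (a : ℂ) (u : ℂ → ℂ), IsChart φ ∧ IsChart ψ ∧ φ a = z ∧
      AnalyticAt ℂ u a ∧ ∀ᶠ w in 𝓝 a, ratMap r (φ w) = ψ (u w) := by
  have hpoly : ∀ (p : Polynomial ℂ) (a : ℂ), AnalyticAt ℂ (fun w => p.eval w) a := fun p a =>
    AnalyticOnNhd.eval_polynomial p a (mem_univ a)
  induction z using OnePoint.rec with
  | coe a =>
    by_cases h : r.denom.eval a = 0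
    · have hn := num_eval_ne_zero r h
      refine ⟨_, recip, a, fun w => r.denom.eval w / r.num.eval w, isChart_coe, isChart_recip, rfl,
        (hpoly _ _).div (hpoly _ _) hn, ?_⟩
      filter_upwards [(hpoly r.num a).continuousAt.eventually_ne hn] with w hw
      rw [ratMap_coe, recip_div _ _ hw]
    · refine ⟨_, _, a, fun w => r.num.eval w / r.denom.eval w, isChart_coe, isChart_coe, rfl,
        (hpoly _ _).div (hpoly _ _) h, ?_⟩
      filter_upwards [(hpoly r.denom a).continuousAt.eventually_ne h] with w hw
      rw [ratMap_coe, if_neg hw]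
  | infty =>
    have hd0 : r.denom.reverse.eval 0 ≠ 0 := by
      rw [reverse_eval_zero]
      exact Polynomial.leadingCoeff_ne_zero.2 r.denom_ne_zero
    have hfin : ∀ w : ℂ, w ≠ 0 → ratMap r (recip w) =
        if r.denom.reverse.eval w = 0 then ∞ else
          ((r.num.reverse.eval w / w ^ r.num.natDegree / (r.denom.reverse.eval w /
            w ^ r.denom.natDegree) : ℂ) : OnePoint ℂ) := by
      intro w hw
      rw [recip_of_ne hw, ratMap_coe, eval_inv_eq _ hw, eval_inv_eq _ hw]
      simp [hw]
    by_cases h : r.denom.natDegree < r.num.natDegree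
    · have hn0 : r.num.reverse.eval 0 ≠ 0 := by
        rw [reverse_eval_zero]
        refine Polynomial.leadingCoeff_ne_zero.2 fun h0 => ?_
        rw [h0] at h
        simp at h
      refine ⟨recip, recip, 0, fun w => w ^ (r.num.natDegree - r.denom.natDegree) *
        r.denom.reverse.eval w / r.num.reverse.eval w, isChart_recip, isChart_recip, recip_zero,
        ((analyticAt_id.pow _).mul (hpoly _ _)).div (hpoly _ _) hn0, ?_⟩
      filter_upwards [(hpoly r.num.reverse 0).continuousAt.eventually_ne hn0,
        (hpoly r.denom.reverse 0).continuousAt.eventually_ne hd0] with w hw hw'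
      by_cases hw0 : w = 0
      · subst hw0
        rw [recip_zero, ratMap_infty, if_pos h, zero_pow (Nat.sub_ne_zero_of_lt h), zero_mul,
          zero_div, recip_zero]
      · rw [hfin w hw0, if_neg hw', recip_div _ _ hw, if_neg (by positivity)]
        congr 1
        have : w ^ r.num.natDegree = w ^ (r.num.natDegree - r.denom.natDegree) *
          w ^ r.denom.natDegree := by rw [← pow_add, Nat.sub_add_cancel h.le]
        rw [this]
        field_simp
    · refine ⟨recip, _, 0, fun w => w ^ (r.denom.natDegree - r.num.natDegree) *
        r.num.reverse.eval w / r.denom.reverse.eval w, isChart_recip, isChart_coe, recip_zero,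
        ((analyticAt_id.pow _).mul (hpoly _ _)).div (hpoly _ _) hd0, ?_⟩
      rw [not_lt] at h
      filter_upwards [(hpoly r.denom.reverse 0).continuousAt.eventually_ne hd0] with w hw'
      by_cases hw0 : w = 0
      · subst hw0
        rw [recip_zero, ratMap_infty, if_neg h.not_gt, reverse_eval_zero, reverse_eval_zero]
        rcases h.eq_or_lt with h1 | h1
        · rw [h1, Nat.sub_self, pow_zero, one_mul, ← h1]; rfl
        · rw [zero_pow (Nat.sub_ne_zero_of_lt h1), zero_mul,
            Polynomial.coeff_eq_zero_of_natDegree_lt h1]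
      · rw [hfin w hw0, if_neg hw']
        congr 1
        have : w ^ r.denom.natDegree = w ^ (r.denom.natDegree - r.num.natDegree) *
          w ^ r.num.natDegree := by rw [← pow_add, Nat.sub_add_cancel h]
        rw [this]
        field_simp

theorem continuous_ratMap (r : RatFunc ℂ) : Continuous (ratMap r) := by
  rw [continuous_iff_continuousAt]
  intro z
  obtain ⟨φ, ψ, a, u, hφ, hψ, rfl, hu, h⟩ := exists_lift_ratMap r z
  rw [← hφ.emb.continuousAt_iff]
  exact (hψ.emb.continuous.continuousAt.comp hu.continuousAt).congr (h.mono fun w hw => hw.symm)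

theorem AnalyticAtSphere.comp_ratMap {g : OnePoint ℂ → ℂ} {r : RatFunc ℂ} {z : OnePoint ℂ}
    (hg : AnalyticAtSphere g (ratMap r z)) : AnalyticAtSphere (fun t => g (ratMap r t)) z := by
  obtain ⟨φ, ψ, a, u, hφ, hψ, rfl, hu, h⟩ := exists_lift_ratMap r z
  rw [h.self_of_nhds, hψ.analytic_iff] at hg
  rw [hφ.analytic_iff]
  exact (hg.comp hu).congr (h.mono fun w hw => by simp [hw])

/-- The finite value of a point of the sphere, with the junk value `0` at `∞`. -/
noncomputable def toC (z : OnePoint ℂ) : ℂ := z.elim 0 id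

@[simp] theorem toC_coe (a : ℂ) : toC (a : OnePoint ℂ) = a := rfl

theorem coe_toC {z : OnePoint ℂ} (h : z ≠ ∞) : ((toC z : ℂ) : OnePoint ℂ) = z := by
  induction z using OnePoint.rec with
  | infty => exact absurd rfl h
  | coe a => rfl

theorem analyticAtSphere_toC {z : OnePoint ℂ} (h : z ≠ ∞) : AnalyticAtSphere toC z := by
  induction z using OnePoint.rec with
  | infty => exact absurd rfl h
  | coe a => exact analyticAt_id

theorem analyticAtSphere_ratMap {r : RatFunc ℂ} {z : OnePoint ℂ} (h : z ∉ poles r) :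
    AnalyticAtSphere (fun t => toC (ratMap r t)) z :=
  (analyticAtSphere_toC h).comp_ratMap

theorem finite_ratMap_fiber_coe (r : RatFunc ℂ) (e : OnePoint ℂ)
    (h : ∀ c : ℂ, e = (c : OnePoint ℂ) → r ≠ RatFunc.C c) : (ratMap r ⁻¹' {e}).Finite := by
  have key : {a : ℂ | ratMap r (a : OnePoint ℂ) = e}.Finite := by
    induction e using OnePoint.rec with
    | infty =>
      refine (r.denom.rootSet_finite ℂ).subset fun a ha => ?_
      rw [Polynomial.mem_rootSet]
      refine ⟨r.denom_ne_zero, ?_⟩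
      by_contra h0
      rw [mem_ofPred_eq, ratMap_coe, if_neg (by simpa using h0)] at ha
      exact OnePoint.coe_ne_infty _ ha
    | coe c =>
      have hne : r.num - Polynomial.C c * r.denom ≠ 0 := by
        intro h0
        refine h c rfl ?_
        rw [← r.num_div_denom, sub_eq_zero.1 h0, map_mul, mul_div_assoc, div_self
          (RatFunc.algebraMap_ne_zero r.denom_ne_zero), mul_one, RatFunc.algebraMap_C]
      refine ((r.num - Polynomial.C c * r.denom).rootSet_finite ℂ).subset fun a ha => ?_
      rw [Polynomial.mem_rootSet]
      refine ⟨hne, ?_⟩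
      rw [mem_ofPred_eq, ratMap_coe] at ha
      split_ifs at ha with h1
      · exact absurd ha.symm (OnePoint.coe_ne_infty _)
      · rw [OnePoint.coe_eq_coe, div_eq_iff h1] at ha
        simp [ha]
  refine ((key.image ((↑) : ℂ → OnePoint ℂ)).union (finite_singleton ∞)).subset fun z hz => ?_
  induction z using OnePoint.rec with
  | infty => exact Or.inr rfl
  | coe a => exact Or.inl ⟨a, hz, rfl⟩

theorem finite_poles (r : RatFunc ℂ) : (poles r).Finite :=
  finite_ratMap_fiber_coe r ∞ fun c hc => absurd hc.symm (OnePoint.coe_ne_infty c)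

theorem eventually_nhdsNE_notMem_of_finite {E : Set (OnePoint ℂ)} (hE : E.Finite)
    (z : OnePoint ℂ) : ∀ᶠ y in 𝓝[≠] z, y ∉ E := by
  have h : (E \ {z})ᶜ ∈ 𝓝 z :=
    (hE.subset sdiff_subset).isClosed.isOpen_compl.mem_nhds fun h => h.2 rfl
  filter_upwards [mem_nhdsWithin_of_mem_nhds h, self_mem_nhdsWithin] with y hy hyz hyE
  exact hy ⟨hyE, hyz⟩

theorem tendsto_ratMap_nhdsNE {r : RatFunc ℂ} (hr : ∀ c : ℂ, r ≠ RatFunc.C c) (z : OnePoint ℂ) :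
    Tendsto (ratMap r) (𝓝[≠] z) (𝓝[≠] (ratMap r z)) :=
  tendsto_nhdsWithin_iff.2 ⟨(continuous_ratMap r).continuousAt.mono_left nhdsWithin_le_nhds,
    eventually_nhdsNE_notMem_of_finite (finite_ratMap_fiber_coe r _ fun c _ => hr c) z⟩

theorem tendsto_iterate_ratMap_nhdsNE {r : RatFunc ℂ} (hr : ∀ c : ℂ, r ≠ RatFunc.C c) (n : ℕ)
    (z : OnePoint ℂ) :
    Tendsto (ratMap r)^[n] (𝓝[≠] z) (𝓝[≠] ((ratMap r)^[n] z)) := by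
  induction n generalizing z with
  | zero => exact tendsto_id
  | succ n ih =>
    rw [Function.iterate_succ]
    exact (ih _).comp (tendsto_ratMap_nhdsNE hr z)

/-! ### Values of rational functions at finite points -/

/-- The rational function `r` has no pole at the finite point `z`. -/
def RegularAt (z : ℂ) (r : RatFunc ℂ) : Prop := r.denom.eval z ≠ 0

/-- The value of a rational function at a finite point. -/
noncomputable def value (z : ℂ) (r : RatFunc ℂ) : ℂ := r.eval (RingHom.id ℂ) z

theorem regularAt_iff {z : ℂ} {r : RatFunc ℂ} :
    RegularAt z r ↔ (z : OnePoint ℂ) ∉ poles r := by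
  rw [RegularAt, poles, mem_ofPred_eq, ratMap_coe]
  split_ifs with h <;> simp [h]

theorem RegularAt.ratMap_eq {z : ℂ} {r : RatFunc ℂ} (h : RegularAt z r) :
    ratMap r (z : OnePoint ℂ) = ((value z r : ℂ) : OnePoint ℂ) := by
  rw [ratMap_coe, if_neg h, value, RatFunc.eval, Polynomial.eval₂_id, Polynomial.eval₂_id]

theorem RegularAt.toC_ratMap {z : ℂ} {r : RatFunc ℂ} (h : RegularAt z r) :
    toC (ratMap r (z : OnePoint ℂ)) = value z r := by rw [h.ratMap_eq, toC_coe]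

theorem RegularAt.eval₂_ne {z : ℂ} {r : RatFunc ℂ} (h : RegularAt z r) :
    Polynomial.eval₂ (RingHom.id ℂ) z r.denom ≠ 0 := by rwa [Polynomial.eval₂_id]

theorem RegularAt.of_dvd {z : ℂ} {r : RatFunc ℂ} {p : Polynomial ℂ} (h : r.denom ∣ p)
    (hp : p.eval z ≠ 0) : RegularAt z r := by
  obtain ⟨q, rfl⟩ := h
  intro h0
  rw [Polynomial.eval_mul, h0, zero_mul] at hp
  exact hp rfl

theorem RegularAt.add {z : ℂ} {r s : RatFunc ℂ} (hr : RegularAt z r) (hs : RegularAt z s) :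
    RegularAt z (r + s) :=
  .of_dvd (RatFunc.denom_add_dvd r s) (by rw [Polynomial.eval_mul]; exact mul_ne_zero hr hs)

theorem RegularAt.mul {z : ℂ} {r s : RatFunc ℂ} (hr : RegularAt z r) (hs : RegularAt z s) :
    RegularAt z (r * s) :=
  .of_dvd (RatFunc.denom_mul_dvd r s) (by rw [Polynomial.eval_mul]; exact mul_ne_zero hr hs)

theorem regularAt_C (z c : ℂ) : RegularAt z (RatFunc.C c) := by simp [RegularAt]

theorem regularAt_X (z : ℂ) : RegularAt z RatFunc.X := by simp [RegularAt]

theorem value_add {z : ℂ} {r s : RatFunc ℂ} (hr : RegularAt z r) (hs : RegularAt z s) :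
    value z (r + s) = value z r + value z s :=
  RatFunc.eval_add _ _ hr.eval₂_ne hs.eval₂_ne

theorem value_mul {z : ℂ} {r s : RatFunc ℂ} (hr : RegularAt z r) (hs : RegularAt z s) :
    value z (r * s) = value z r * value z s :=
  RatFunc.eval_mul _ _ hr.eval₂_ne hs.eval₂_ne

@[simp] theorem value_C (z c : ℂ) : value z (RatFunc.C c) = c := RatFunc.eval_C ..

@[simp] theorem value_X (z : ℂ) : value z RatFunc.X = z := RatFunc.eval_X ..

theorem regularAt_zero (z : ℂ) : RegularAt z 0 := by simp [RegularAt]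

theorem regularAt_one (z : ℂ) : RegularAt z 1 := by simp [RegularAt]

@[simp] theorem value_zero (z : ℂ) : value z 0 = 0 := RatFunc.eval_zero ..

@[simp] theorem value_one (z : ℂ) : value z 1 = 1 := RatFunc.eval_one ..

theorem value_sum {ι : Type*} (z : ℂ) (s : Finset ι) (r : ι → RatFunc ℂ)
    (h : ∀ i ∈ s, RegularAt z (r i)) :
    RegularAt z (∑ i ∈ s, r i) ∧ value z (∑ i ∈ s, r i) = ∑ i ∈ s, value z (r i) := by
  classical
  induction s using Finset.induction_on with
  | empty => simpa using regularAt_zero z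
  | insert i s hi ih =>
    have h1 := ih fun j hj => h j (Finset.mem_insert_of_mem hj)
    have h2 := h i (Finset.mem_insert_self i s)
    rw [Finset.sum_insert hi, Finset.sum_insert hi, value_add h2 h1.1, h1.2]
    exact ⟨h2.add h1.1, rfl⟩

theorem RegularAt.of_mul_eq {z : ℂ} {r : RatFunc ℂ} {p q : Polynomial ℂ} (hq : q.eval z ≠ 0)
    (h : r * algebraMap _ _ q = algebraMap _ _ p) : RegularAt z r := by
  have hq0 : q ≠ 0 := fun h0 => hq (by simp [h0])
  refine .of_dvd (p := q) ?_ hq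
  rw [RatFunc.denom_dvd hq0]
  exact ⟨p, by rw [← h, mul_div_cancel_right₀ _ (RatFunc.algebraMap_ne_zero hq0)]⟩

/-! ### Isolated points of the spectrum -/

theorem continuousLinearMap_circleIntegral {E E' : Type*} [NormedAddCommGroup E] [NormedSpace ℂ E]
    [CompleteSpace E] [NormedAddCommGroup E'] [NormedSpace ℂ E'] [CompleteSpace E'] (L : E →L[ℂ] E')
    {f : ℂ → E} {c : ℂ} {R : ℝ} (hf : CircleIntegrable f c R) :
    L (∮ z in C(c, R), f z) = ∮ z in C(c, R), L (f z) := by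
  rw [circleIntegral, circleIntegral, ← L.intervalIntegral_comp_comm hf.out]
  simp

/-- If the contour integral of the resolvent around `c` vanishes, then `c` is not in the spectrum:
the inverse of `c - a` is given by Cauchy's formula. -/
theorem notMem_spectrum_of_circleIntegral_resolvent {A : Type*} [NormedRing A] [NormedAlgebra ℂ A]
    [CompleteSpace A] (a : A) (c : ℂ) {R : ℝ} (hR : 0 < R)
    (hsub : ∀ z ∈ Metric.sphere c R, z ∉ spectrum ℂ a)
    (hint : ∮ z in C(c, R), resolvent a z = 0) : c ∉ spectrum ℂ a := by
  have hcont : ContinuousOn (resolvent a) (Metric.sphere c R) := fun z hz =>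
    (spectrum.hasDerivAt_resolvent_const_left
      (spectrum.notMem_iff.1 (hsub z hz))).continuousAt.continuousWithinAt
  have hne : ∀ z ∈ Metric.sphere c R, z - c ≠ 0 := fun z hz h => by
    rw [sub_eq_zero.1 h] at hz
    simp [hR.ne] at hz
  have hinv : ContinuousOn (fun z : ℂ => (z - c)⁻¹) (Metric.sphere c R) :=
    (continuousOn_id.sub continuousOn_const).inv₀ hne
  have hi1 : CircleIntegrable (fun z => (z - c)⁻¹ • resolvent a z) c R :=
    (hinv.smul hcont).circleIntegrable hR.le
  have hi2 : CircleIntegrable (fun z => (z - c)⁻¹ • (1 : A)) c R :=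
    (hinv.smul continuousOn_const).circleIntegrable hR.le
  have hi3 : CircleIntegrable (resolvent a) c R := hcont.circleIntegrable hR.le
  set J := ∮ z in C(c, R), (z - c)⁻¹ • resolvent a z with hJ
  have h1 : ∮ z in C(c, R), ((z - c)⁻¹ • (1 : A) - resolvent a z) =
      (2 * Real.pi * Complex.I : ℂ) • (1 : A) := by
    rw [circleIntegral.integral_sub hi2 hi3, hint, sub_zero, circleIntegral.integral_smul_const,
      circleIntegral.integral_sub_center_inv c hR.ne']
  have hz : ∀ z ∈ Metric.sphere c R, IsUnit (algebraMap ℂ A z - a) := fun z hz =>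
    spectrum.notMem_iff.1 (hsub z hz)
  have hdec : ∀ z, algebraMap ℂ A c - a = (algebraMap ℂ A z - a) - (z - c) • (1 : A) := by
    intro z
    rw [Algebra.algebraMap_eq_smul_one, Algebra.algebraMap_eq_smul_one, sub_smul]
    abel
  have hl : (algebraMap ℂ A c - a) * J = (2 * Real.pi * Complex.I : ℂ) • (1 : A) := by
    rw [← h1]
    refine (continuousLinearMap_circleIntegral (ContinuousLinearMap.mul ℂ A (algebraMap ℂ A c - a))
      hi1).trans (circleIntegral.integral_congr hR.le fun z hzs => ?_)
    simp only [ContinuousLinearMap.mul_apply']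
    rw [mul_smul_comm, hdec z, sub_mul, resolvent, Ring.mul_inverse_cancel _ (hz z hzs),
      smul_one_mul, smul_sub, smul_smul, inv_mul_cancel₀ (hne z hzs), one_smul]
  have hr : J * (algebraMap ℂ A c - a) = (2 * Real.pi * Complex.I : ℂ) • (1 : A) := by
    rw [← h1]
    refine (continuousLinearMap_circleIntegral ((ContinuousLinearMap.mul ℂ A).flip
      (algebraMap ℂ A c - a)) hi1).trans (circleIntegral.integral_congr hR.le fun z hzs => ?_)
    simp only [ContinuousLinearMap.flip_apply, ContinuousLinearMap.mul_apply']
    rw [smul_mul_assoc, hdec z, mul_sub, resolvent, Ring.inverse_mul_cancel _ (hz z hzs),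
      mul_smul_one, smul_sub, smul_smul, inv_mul_cancel₀ (hne z hzs), one_smul]
  have h2 : (2 * Real.pi * Complex.I : ℂ) ≠ 0 := Complex.two_pi_I_ne_zero
  rw [spectrum.notMem_iff]
  refine ⟨⟨algebraMap ℂ A c - a, (2 * Real.pi * Complex.I : ℂ)⁻¹ • J, ?_, ?_⟩, rfl⟩
  · rw [mul_smul_comm, hl, smul_smul, inv_mul_cancel₀ h2, one_smul]
  · rw [smul_mul_assoc, hr, smul_smul, inv_mul_cancel₀ h2, one_smul]

/-- The Hilbert space `ℓ²(V)` of square summable functions with unit weights. -/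
abbrev UnitL2 (V : Type*) : Type _ := lp (fun _ : V => ℂ) 2

section

variable {V : Type*}

open Classical in
/-- The matrix coefficient of `(1 - zT)⁻¹` at `(x, y)`. -/
noncomputable def resCoeff (T : UnitL2 V →L[ℂ] UnitL2 V) (z : ℂ) (x y : V) : ℂ :=
  (Ring.inverse (1 - z • T) (lp.single 2 y (1 : ℂ)) : UnitL2 V) x

/-- Evaluation of an operator at a pair of coordinates. -/
noncomputable def entryCLM [DecidableEq V] (x y : V) : (UnitL2 V →L[ℂ] UnitL2 V) →L[ℂ] ℂ :=
  (lp.evalCLM ℂ (fun _ : V => ℂ) 2 x).comp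
    (ContinuousLinearMap.apply ℂ (UnitL2 V) (lp.single 2 y (1 : ℂ)))

theorem entryCLM_apply [DecidableEq V] (x y : V) (S : UnitL2 V →L[ℂ] UnitL2 V) :
    entryCLM x y S = (S (lp.single 2 y (1 : ℂ)) : UnitL2 V) x := rfl

theorem eq_zero_of_entry [DecidableEq V] (S : UnitL2 V →L[ℂ] UnitL2 V)
    (h : ∀ x y, entryCLM x y S = 0) : S = 0 := by
  have h1 : ∀ y (c : ℂ), S (lp.single 2 y c) = 0 := by
    intro y c
    have : (lp.single 2 y c : UnitL2 V) = c • lp.single 2 y (1 : ℂ) := by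
      rw [← lp.single_smul, smul_eq_mul, mul_one]
    rw [this, map_smul]
    have h2 : S (lp.single 2 y (1 : ℂ)) = 0 := by
      ext x
      exact h x y
    rw [h2, smul_zero]
  ext1 f
  have h3 := (lp.hasSum_single (by simp) f).mapL S
  simp only [h1] at h3
  exact h3.unique hasSum_zero

theorem analyticAt_resCoeff {T : UnitL2 V →L[ℂ] UnitL2 V} {z : ℂ} (h : IsUnit (1 - z • T))
    (x y : V) : AnalyticAt ℂ (fun t => resCoeff T t x y) z := by
  classical
  have h1 : AnalyticAt ℂ (fun t : ℂ => 1 - t • T) z :=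
    analyticAt_const.sub (analyticAt_id.smul analyticAt_const)
  obtain ⟨u, hu⟩ := h
  have h2 : AnalyticAt ℂ (fun t : ℂ => Ring.inverse (1 - t • T)) z :=
    AnalyticAt.fun_comp (by rw [← hu]; exact analyticAt_inverse u) h1
  have h3 := ((entryCLM x y).analyticAt _).comp h2
  refine h3.congr (Eventually.of_forall fun t => ?_)
  simp only [resCoeff, Function.comp_apply, entryCLM_apply]

/-- If the matrix coefficients of `(1 - zT)⁻¹` near `z = 1 / c` extend analytically across `1 / c`
(and, in case `c = 0`, with the value `0` there), then `c` is not in the spectrum of `T`. -/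
theorem notMem_spectrum_of_extension (T : UnitL2 V →L[ℂ] UnitL2 V) (c : ℂ)
    (g : V → V → OnePoint ℂ → ℂ)
    (hg : ∀ᶠ z in 𝓝 (recip c), ∀ x y, AnalyticAtSphere (g x y) z)
    (heq : ∀ᶠ z in 𝓝[≠] (recip c), ∀ t : ℂ, z = (t : OnePoint ℂ) →
      IsUnit (1 - t • T) ∧ ∀ x y, g x y z = resCoeff T t x y)
    (h0 : c = 0 → ∀ x y, g x y ∞ = 0) : c ∉ spectrum ℂ T := by
  classical
  have h1 : ∀ᶠ t in 𝓝 c, ∀ x y, AnalyticAt ℂ (fun t => g x y (recip t)) t :=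
    (isChart_recip.emb.continuous.continuousAt.eventually hg).mono
      fun t ht x y => (isChart_recip.analytic_iff _ _).1 (ht x y)
  have h2 : ∀ᶠ t in 𝓝[≠] c, t ≠ 0 ∧ IsUnit (1 - t⁻¹ • T) ∧
      ∀ x y, g x y (recip t) = resCoeff T t⁻¹ x y := by
    rw [← isChart_recip.nhdsNE, eventually_map] at heq
    have hne : ∀ᶠ t in 𝓝[≠] c, t ≠ 0 := by
      by_cases hc : c = 0
      · subst hc; exact self_mem_nhdsWithin
      · exact (isOpen_ne.eventually_mem hc).filter_mono nhdsWithin_le_nhds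
    filter_upwards [heq, hne] with t ht ht0
    exact ⟨ht0, ht _ (recip_of_ne ht0)⟩
  rw [eventually_nhdsWithin_iff] at h2
  have h3 : ∀ᶠ t in 𝓝 c, c ≠ 0 → t ≠ 0 := by
    by_cases hc : c = 0
    · simp [hc]
    · exact (isOpen_ne.eventually_mem hc).mono fun t ht _ => ht
  obtain ⟨ρ, hρ, hball⟩ := Metric.eventually_nhds_iff_ball.1 (h1.and (h2.and h3))
  have hR : 0 < ρ / 2 := by positivity
  have hsub : Metric.closedBall c (ρ / 2) ⊆ Metric.ball c ρ :=
    Metric.closedBall_subset_ball (by linarith)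
  have hs : ∀ t ∈ Metric.sphere c (ρ / 2), t ≠ 0 ∧ IsUnit (1 - t⁻¹ • T) ∧
      ∀ x y, g x y (recip t) = resCoeff T t⁻¹ x y := by
    intro t ht
    refine (hball t (hsub (Metric.sphere_subset_closedBall ht))).2.1 fun h => ?_
    rw [mem_singleton_iff.1 h] at ht
    simp at ht
    linarith
  have hfac : ∀ t : ℂ, t ≠ 0 → algebraMap ℂ (UnitL2 V →L[ℂ] UnitL2 V) t - T =
      t • (1 - t⁻¹ • T) := by
    intro t ht
    rw [smul_sub, smul_smul, mul_inv_cancel₀ ht, one_smul, Algebra.algebraMap_eq_smul_one]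
  have hns : ∀ t ∈ Metric.sphere c (ρ / 2), t ∉ spectrum ℂ T := by
    intro t ht
    obtain ⟨ht0, hu, -⟩ := hs t ht
    rw [spectrum.notMem_iff, hfac t ht0]
    exact hu.smul (Units.mk0 t ht0)
  refine notMem_spectrum_of_circleIntegral_resolvent T c hR hns ?_
  have hcont : ContinuousOn (resolvent T) (Metric.sphere c (ρ / 2)) := fun z hz =>
    (spectrum.hasDerivAt_resolvent_const_left
      (spectrum.notMem_iff.1 (hns z hz))).continuousAt.continuousWithinAt
  refine eq_zero_of_entry _ fun x y => ?_
  rw [continuousLinearMap_circleIntegral _ (hcont.circleIntegrable hR.le)]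
  have hval : ∀ t ∈ Metric.sphere c (ρ / 2), entryCLM x y (resolvent T t) =
      t⁻¹ * g x y (recip t) := by
    intro t ht
    obtain ⟨ht0, hu, hge⟩ := hs t ht
    have h4 : resolvent T t = t⁻¹ • Ring.inverse (1 - t⁻¹ • T) := by
      rw [resolvent, hfac t ht0]
      have hu' : IsUnit (t • (1 - t⁻¹ • T)) := hu.smul (Units.mk0 t ht0)
      have h5 : t • (1 - t⁻¹ • T) * (t⁻¹ • Ring.inverse (1 - t⁻¹ • T)) = 1 := by
        rw [smul_mul_smul_comm, mul_inv_cancel₀ ht0, one_smul, Ring.mul_inverse_cancel _ hu]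
      exact left_inv_eq_right_inv (Ring.inverse_mul_cancel _ hu') h5
    rw [h4, map_smul, hge, smul_eq_mul, entryCLM_apply, resCoeff]
  rw [circleIntegral.integral_congr hR.le hval]
  have hd : DifferentiableOn ℂ (fun t => g x y (recip t)) (Metric.closedBall c (ρ / 2)) :=
    fun t ht => ((hball t (hsub ht)).1 x y).differentiableAt.differentiableWithinAt
  -- for `c = 0` the integrand has a pole, with residue `g x y ∞`
  by_cases hc : c = 0
  · subst hc
    have h5 := (DifferentiableOn.diffContOnCl (by
      rwa [closure_ball _ hR.ne'])).circleIntegral_sub_inv_smul (f := fun t => g x y (recip t))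
      (Metric.mem_ball_self hR)
    simp only [sub_zero, smul_eq_mul, recip_zero, h0 rfl, mul_zero] at h5
    exact h5
  · have h6 : DifferentiableOn ℂ (fun t => t⁻¹ * g x y (recip t)) (Metric.closedBall c (ρ / 2)) :=
      (differentiableOn_id.inv fun t ht => (hball t (hsub ht)).2.2 hc).mul hd
    exact (DifferentiableOn.diffContOnCl (by
      rwa [closure_ball _ hR.ne'])).circleIntegral_eq_zero hR.le

end

/-! ### The transition operator on the unweighted space -/

section

variable {V : Type*} {G : SimpleGraph V} [G.LocallyFinite]

theorem walk_add (f g : V → ℂ) : walk G (f + g) = walk G f + walk G g := by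
  ext x
  simp only [walk, Pi.add_apply, Finset.sum_add_distrib, add_div]

theorem walk_smul (c : ℂ) (f : V → ℂ) : walk G (c • f) = c • walk G f := by
  ext x
  simp only [walk, Pi.smul_apply, smul_eq_mul, ← Finset.mul_sum, mul_div_assoc]

/-- The equation `u - z P u = f` is uniquely solvable in `ℓ²(X)` for every `f ∈ ℓ²(X)`. -/
def Solvable (G : SimpleGraph V) [G.LocallyFinite] (z : ℂ) : Prop :=
  ∀ f ∈ degL2Sub G, ∃! u, u ∈ degL2Sub G ∧ ∀ x, u x - z * walk G u x = f x

/-- The isometry from `ℓ²(X)` with weights `deg x` onto the unweighted space. -/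
noncomputable def unitEquiv (hdeg : ∀ x, 0 < G.degree x) : DegL2 G ≃ₗᵢ[ℂ] UnitL2 V where
  toLinearEquiv := LinearEquiv.ofBijective (toUnweighted G) (by
    have hs : ∀ x, (Real.sqrt (G.degree x) : ℂ) ≠ 0 := fun x => by
      have : (0 : ℝ) < G.degree x := by exact_mod_cast hdeg x
      exact_mod_cast (Real.sqrt_pos.2 this).ne'
    constructor
    · intro f g h
      refine Subtype.ext (funext fun x => ?_)
      have h1 : (Real.sqrt (G.degree x) : ℂ) * f.1 x = (Real.sqrt (G.degree x) : ℂ) * g.1 x :=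
        congrArg (fun k : UnitL2 V => k x) h
      exact mul_left_cancel₀ (hs x) h1
    · intro h
      have h1 : Summable fun x => ‖h x‖ ^ 2 := by
        simpa using (lp.memℓp h).summable (by norm_num)
      refine ⟨(⟨fun x => (Real.sqrt (G.degree x) : ℂ)⁻¹ * h x, h1.congr fun x => ?_⟩ :
        degL2Sub G), ?_⟩
      · have h0 : (0 : ℝ) < G.degree x := by exact_mod_cast hdeg x
        rw [norm_mul, mul_pow, norm_inv, Complex.norm_real, Real.norm_eq_abs, inv_pow, sq_abs,
          Real.sq_sqrt h0.le, mul_inv_cancel_left₀ h0.ne']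
      · ext x
        exact mul_inv_cancel_left₀ (hs x) (h x))
  norm_map' _ := rfl

/-- The transition operator, as an operator on the unweighted space. -/
noncomputable def unitOp (hdeg : ∀ x, 0 < G.degree x) : UnitL2 V →L[ℂ] UnitL2 V :=
  (unitEquiv hdeg).toContinuousLinearEquiv.conjContinuousAlgEquiv (transOp G)

theorem unitOp_unitEquiv (hdeg : ∀ x, 0 < G.degree x) (f : DegL2 G) :
    unitOp hdeg (unitEquiv hdeg f) = unitEquiv hdeg (transOp G f) := by
  change unitEquiv hdeg (transOp G ((unitEquiv hdeg).symm (unitEquiv hdeg f))) = _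
  rw [LinearIsometryEquiv.symm_apply_apply]

theorem spectrum_unitOp (hdeg : ∀ x, 0 < G.degree x) :
    spectrum ℂ (unitOp hdeg) = spectrum ℂ (transOp G) :=
  AlgEquiv.spectrum_eq
    (unitEquiv hdeg).toContinuousLinearEquiv.conjContinuousAlgEquiv.toAlgEquiv (transOp G)

theorem norm_unitOp_le (hdeg : ∀ x, 0 < G.degree x) : ‖unitOp hdeg‖ ≤ 1 := by
  refine ContinuousLinearMap.opNorm_le_bound _ zero_le_one fun h => ?_
  obtain ⟨f, rfl⟩ := (unitEquiv hdeg).surjective h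
  rw [unitOp_unitEquiv, LinearIsometryEquiv.norm_map, LinearIsometryEquiv.norm_map]
  have h1 : ‖transOp G‖ ≤ 1 := LinearMap.mkContinuous_norm_le _ zero_le_one _
  exact (transOp G).le_of_opNorm_le h1 f

theorem one_sub_unitOp_unitEquiv (hdeg : ∀ x, 0 < G.degree x) (z : ℂ) (u f : degL2Sub G) :
    (1 - z • unitOp hdeg) (unitEquiv hdeg u) = unitEquiv hdeg f ↔
      ∀ x, u.1 x - z * walk G u.1 x = f.1 x := by
  have h : ∀ u f : DegL2 G, (1 - z • unitOp hdeg) (unitEquiv hdeg u) = unitEquiv hdeg f ↔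
      ∀ x, u.1 x - z * walk G u.1 x = f.1 x := fun u f => by
    have h1 : (1 - z • unitOp hdeg) (unitEquiv hdeg u) =
        unitEquiv hdeg (u - z • transOp G u) := by
      rw [map_sub, map_smul, ← unitOp_unitEquiv]
      rfl
    rw [h1, (unitEquiv hdeg).injective.eq_iff]
    exact Subtype.ext_iff.trans funext_iff
  exact h u f

theorem isUnit_one_sub_unitOp_iff (hdeg : ∀ x, 0 < G.degree x) (z : ℂ) :
    IsUnit (1 - z • unitOp hdeg) ↔ Solvable G z := by
  rw [ContinuousLinearMap.isUnit_iff_bijective, Function.bijective_iff_existsUnique,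
    (unitEquiv hdeg).surjective.forall]
  constructor
  · intro h f hf
    obtain ⟨k, hk, hu⟩ := h (⟨f, hf⟩ : degL2Sub G)
    obtain ⟨u, rfl⟩ := (unitEquiv hdeg).surjective k
    refine ⟨u.1, ⟨u.2, (one_sub_unitOp_unitEquiv hdeg z u ⟨f, hf⟩).1 hk⟩, ?_⟩
    rintro u' ⟨hu', he⟩
    have := hu (unitEquiv hdeg (⟨u', hu'⟩ : degL2Sub G))
      ((one_sub_unitOp_unitEquiv hdeg z ⟨u', hu'⟩ ⟨f, hf⟩).2 he)
    exact congrArg Subtype.val ((unitEquiv hdeg).injective this)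
  · intro h f
    obtain ⟨u, ⟨hu, he⟩, huniq⟩ := h f.1 f.2
    refine ⟨unitEquiv hdeg (⟨u, hu⟩ : degL2Sub G),
      (one_sub_unitOp_unitEquiv hdeg z ⟨u, hu⟩ f).2 he, fun k hk => ?_⟩
    obtain ⟨u', rfl⟩ := (unitEquiv hdeg).surjective k
    have := huniq u'.1 ⟨u'.2, (one_sub_unitOp_unitEquiv hdeg z u' f).1 hk⟩
    exact congrArg _ (Subtype.ext this)

/-- The coefficient `G(x, y | z)` of `(1 - zP)⁻¹`, i.e. the value at `x` of `(1 - zP)⁻¹ δ_y`. -/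
noncomputable def walkRes (hdeg : ∀ x, 0 < G.degree x) (z : ℂ) (x y : V) : ℂ :=
  (Real.sqrt (G.degree y) / Real.sqrt (G.degree x) : ℝ) * resCoeff (unitOp hdeg) z x y

theorem sqrt_degree_ne_zero (hdeg : ∀ x, 0 < G.degree x) (x : V) :
    (Real.sqrt (G.degree x) : ℂ) ≠ 0 := by
  have : (0 : ℝ) < G.degree x := by exact_mod_cast hdeg x
  exact_mod_cast (Real.sqrt_pos.2 this).ne'

open Classical in
theorem single_mem_degL2Sub (y : V) : Pi.single y (1 : ℂ) ∈ degL2Sub G := by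
  refine summable_of_ne_finset_zero (s := {y}) fun x hx => ?_
  rw [Finset.mem_singleton] at hx
  simp [hx]

open Classical in
theorem single_eq_unitEquiv (hdeg : ∀ x, 0 < G.degree x) (y : V) :
    (lp.single 2 y (1 : ℂ) : UnitL2 V) = (Real.sqrt (G.degree y) : ℂ)⁻¹ •
      unitEquiv hdeg (⟨Pi.single y (1 : ℂ), single_mem_degL2Sub y⟩ : degL2Sub G) := by
  ext x
  change (lp.single 2 y (1 : ℂ) : UnitL2 V) x = (Real.sqrt (G.degree y) : ℂ)⁻¹ *
    ((Real.sqrt (G.degree x) : ℂ) * (Pi.single y (1 : ℂ) : V → ℂ) x)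
  rw [lp.single_apply]
  by_cases hx : x = y
  · subst hx
    simp [inv_mul_cancel₀ (sqrt_degree_ne_zero hdeg x)]
  · simp [hx]

open Classical in
/-- For `z` in the resolvent set, `walkRes` gives the solution of `u - z P u = δ_y`. -/
theorem walkRes_spec (hdeg : ∀ x, 0 < G.degree x) {z : ℂ} (hz : Solvable G z) (y : V) :
    (fun x => walkRes hdeg z x y) ∈ degL2Sub G ∧
      ∀ x, walkRes hdeg z x y - z * walk G (fun t => walkRes hdeg z t y) x =
        (Pi.single y (1 : ℂ) : V → ℂ) x := by
  obtain ⟨u, ⟨hu, he⟩, -⟩ := hz _ (single_mem_degL2Sub y)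
  have hunit := (isUnit_one_sub_unitOp_iff hdeg z).2 hz
  have h1 := (one_sub_unitOp_unitEquiv hdeg z ⟨u, hu⟩ ⟨_, single_mem_degL2Sub y⟩).2 he
  have h2 : Ring.inverse (1 - z • unitOp hdeg) (lp.single 2 y (1 : ℂ)) =
      (Real.sqrt (G.degree y) : ℂ)⁻¹ • unitEquiv hdeg (⟨u, hu⟩ : degL2Sub G) := by
    rw [single_eq_unitEquiv hdeg, map_smul, ← h1]
    congr 1
    change (Ring.inverse (1 - z • unitOp hdeg) * (1 - z • unitOp hdeg)) _ = _
    rw [Ring.inverse_mul_cancel _ hunit]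
    rfl
  have h3 : (fun x => walkRes hdeg z x y) = u := by
    ext x
    rw [walkRes, resCoeff, h2]
    change ((Real.sqrt (G.degree y) / Real.sqrt (G.degree x) : ℝ) : ℂ) *
      ((Real.sqrt (G.degree y) : ℂ)⁻¹ * ((Real.sqrt (G.degree x) : ℂ) * u x)) = u x
    have hx := sqrt_degree_ne_zero hdeg x
    have hy := sqrt_degree_ne_zero hdeg y
    push_cast
    field_simp
  refine ⟨h3 ▸ hu, fun x => ?_⟩
  rw [h3]
  exact (congrFun h3 x) ▸ he x

theorem analyticAt_walkRes (hdeg : ∀ x, 0 < G.degree x) {z : ℂ} (hz : Solvable G z) (x y : V) :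
    AnalyticAt ℂ (fun t => walkRes hdeg t x y) z :=
  analyticAt_const.mul (analyticAt_resCoeff ((isUnit_one_sub_unitOp_iff hdeg z).2 hz) x y)

theorem norm_smul_unitOp_lt (hdeg : ∀ x, 0 < G.degree x) {z : ℂ} (hz : ‖z‖ < 1) :
    ‖z • unitOp hdeg‖ < 1 := by
  rw [norm_smul]
  exact (mul_le_of_le_one_right (norm_nonneg z) (norm_unitOp_le hdeg)).trans_lt hz

theorem solvable_of_norm_lt (hdeg : ∀ x, 0 < G.degree x) {z : ℂ} (hz : ‖z‖ < 1) :
    Solvable G z :=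
  (isUnit_one_sub_unitOp_iff hdeg z).1 (isUnit_one_sub_of_norm_lt_one (norm_smul_unitOp_lt hdeg hz))

open Classical in
theorem unitOp_pow_single (hdeg : ∀ x, 0 < G.degree x) (n : ℕ) (x y : V) :
    ((unitOp hdeg ^ n) (lp.single 2 y (1 : ℂ)) : UnitL2 V) x =
      (Real.sqrt (G.degree y) : ℂ)⁻¹ * ((Real.sqrt (G.degree x) : ℂ) * stepProb G n x y) := by
  have h : ∃ hm : (fun t => (stepProb G n t y : ℂ)) ∈ degL2Sub G,
      (unitOp hdeg ^ n) (lp.single 2 y (1 : ℂ)) = (Real.sqrt (G.degree y) : ℂ)⁻¹ •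
        unitEquiv hdeg (⟨_, hm⟩ : degL2Sub G) := by
    induction n with
    | zero =>
      have h0 : (fun t => (stepProb G 0 t y : ℂ)) = Pi.single y (1 : ℂ) := by
        ext t
        simp only [stepProb, Pi.single_apply]
        split_ifs <;> simp
      refine ⟨h0 ▸ single_mem_degL2Sub y, ?_⟩
      rw [pow_zero]
      refine (single_eq_unitEquiv hdeg y).trans ?_
      congr 2
      exact Subtype.ext h0.symm
    | succ n ih =>
      obtain ⟨hm, ih⟩ := ih
      have h0 : (fun t => (stepProb G (n + 1) t y : ℂ)) =
          walk G fun t => (stepProb G n t y : ℂ) := by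
        ext t
        simp [stepProb, walk]
      refine ⟨h0 ▸ (walk_bound G _ hm).1, ?_⟩
      rw [pow_succ']
      change unitOp hdeg ((unitOp hdeg ^ n) _) = _
      rw [ih, map_smul]
      congr 1
      refine (unitOp_unitEquiv hdeg _).trans ?_
      congr 1
      exact Subtype.ext h0.symm
  obtain ⟨hm, h⟩ := h
  rw [h]
  rfl

/-- In the unit disc the coefficients of the resolvent are the Green functions. -/
theorem walkRes_eq_green (hdeg : ∀ x, 0 < G.degree x) {z : ℂ} (hz : ‖z‖ < 1) (x y : V) :
    walkRes hdeg z x y = green G x y z := by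
  classical
  have h1 := (summable_geometric_of_norm_lt_one
    (norm_smul_unitOp_lt hdeg hz)).hasSum.mapL (entryCLM x y)
  have h2 : ∑' n : ℕ, (z • unitOp hdeg) ^ n = Ring.inverse (1 - z • unitOp hdeg) := by
    rw [NormedRing.inverse_one_sub _ (norm_smul_unitOp_lt hdeg hz)]
    rfl
  rw [h2] at h1
  have h3 := h1.mul_left ((Real.sqrt (G.degree y) / Real.sqrt (G.degree x) : ℝ) : ℂ)
  rw [green, walkRes]
  refine Eq.trans ?_ (h3.congr_fun ?_).tsum_eq.symm
  · rw [entryCLM_apply, resCoeff]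
  · intro n
    rw [smul_pow, map_smul, entryCLM_apply, unitOp_pow_single, smul_eq_mul]
    have hx := sqrt_degree_ne_zero hdeg x
    have hy := sqrt_degree_ne_zero hdeg y
    push_cast
    field_simp

end

/-! ### Matrices of rational functions -/

/-- The matrix `1 - X Q` of polynomials. -/
noncomputable def polyMat {n : Type*} [DecidableEq n] (Q : Matrix n n ℂ) :
    Matrix n n (Polynomial ℂ) :=
  1 - (Polynomial.X : Polynomial ℂ) • Q.map Polynomial.C

theorem polyMat_map {n : Type*} [DecidableEq n] (Q : Matrix n n ℂ) :
    (polyMat Q).map (algebraMap (Polynomial ℂ) (RatFunc ℂ)) =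
      1 - (RatFunc.X : RatFunc ℂ) • Q.map (RatFunc.C (K := ℂ)) := by
  ext i j
  simp only [polyMat, Matrix.map_apply, Matrix.sub_apply, Matrix.smul_apply, smul_eq_mul, map_sub,
    map_mul, RatFunc.algebraMap_X, RatFunc.algebraMap_C, Matrix.one_apply]
  split_ifs <;> simp

theorem polyMat_eval {n : Type*} [DecidableEq n] (Q : Matrix n n ℂ) (z : ℂ) :
    (polyMat Q).map (Polynomial.evalRingHom z) = 1 - z • Q := by
  ext i j
  simp only [polyMat, Matrix.map_apply, Matrix.sub_apply, Matrix.smul_apply, smul_eq_mul, map_sub,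
    map_mul, Matrix.one_apply]
  split_ifs <;> simp

section

variable {n m : Type*} [Fintype n] [DecidableEq n] [Fintype m] [DecidableEq m]

/-- The matrix `(1 - X Q)⁻¹` of rational functions. -/
noncomputable def starMat (Q : Matrix n n ℂ) : Matrix n n (RatFunc ℂ) :=
  (1 - (RatFunc.X : RatFunc ℂ) • Q.map (RatFunc.C (K := ℂ)))⁻¹

theorem eval_det_polyMat (Q : Matrix n n ℂ) (z : ℂ) :
    (polyMat Q).det.eval z = (1 - z • Q).det := by
  rw [← polyMat_eval, ← RingHom.mapMatrix_apply, ← RingHom.map_det]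
  rfl

theorem det_one_sub_X_smul (Q : Matrix n n ℂ) :
    (1 - (RatFunc.X : RatFunc ℂ) • Q.map (RatFunc.C (K := ℂ))).det =
      algebraMap (Polynomial ℂ) (RatFunc ℂ) (polyMat Q).det := by
  rw [← polyMat_map, ← RingHom.mapMatrix_apply, ← RingHom.map_det]

theorem isUnit_det_one_sub_X_smul (Q : Matrix n n ℂ) :
    IsUnit (1 - (RatFunc.X : RatFunc ℂ) • Q.map (RatFunc.C (K := ℂ))).det := by
  rw [det_one_sub_X_smul, isUnit_iff_ne_zero]
  refine RatFunc.algebraMap_ne_zero fun h => ?_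
  have := eval_det_polyMat Q 0
  simp [h] at this

theorem mul_starMat (Q : Matrix n n ℂ) :
    (1 - (RatFunc.X : RatFunc ℂ) • Q.map (RatFunc.C (K := ℂ))) * starMat Q = 1 :=
  Matrix.mul_nonsing_inv _ (isUnit_det_one_sub_X_smul Q)

theorem starMat_mul (Q : Matrix n n ℂ) :
    starMat Q * (1 - (RatFunc.X : RatFunc ℂ) • Q.map (RatFunc.C (K := ℂ))) = 1 :=
  Matrix.nonsing_inv_mul _ (isUnit_det_one_sub_X_smul Q)

/-- The entries of `(1 - X Q)⁻¹`, one step of the walk after the other. -/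
theorem starMat_apply (Q : Matrix n n ℂ) (x y : n) :
    starMat Q x y = (if x = y then 1 else 0) +
      RatFunc.X * ∑ i, RatFunc.C (Q x i) * starMat Q i y := by
  have h := congrFun (congrFun (mul_starMat Q) x) y
  rw [sub_mul, one_mul, Matrix.sub_apply, smul_mul_assoc, Matrix.smul_apply, Matrix.mul_apply,
    smul_eq_mul, Matrix.one_apply, sub_eq_iff_eq_add] at h
  exact h

theorem starMat_apply_of_row_eq_zero (Q : Matrix n n ℂ) (x y : n) (h : ∀ i, Q x i = 0) :
    starMat Q x y = if x = y then 1 else 0 := by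
  rw [starMat_apply]
  simp [h]

theorem starMat_reindex (e : n ≃ m) {Q : Matrix n n ℂ} {Q' : Matrix m m ℂ}
    (h : ∀ i j, Q' (e i) (e j) = Q i j) (i j : n) : starMat Q' (e i) (e j) = starMat Q i j := by
  have h1 : Q'.submatrix e e = Q := by ext i j; exact h i j
  have h2 : (starMat Q').submatrix e e = starMat Q := by
    rw [starMat, starMat, ← Matrix.inv_submatrix_equiv, ← h1]
    congr 1
    ext i j
    simp [Matrix.one_apply]
  exact congrFun (congrFun h2 i) j

theorem regularAt_starMat {Q : Matrix n n ℂ} {z : ℂ} (h : (1 - z • Q).det ≠ 0) (x y : n) :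
    RegularAt z (starMat Q x y) := by
  rw [← eval_det_polyMat] at h
  refine RegularAt.of_mul_eq (p := (polyMat Q).adjugate x y) h ?_
  have h1 : (1 - (RatFunc.X : RatFunc ℂ) • Q.map (RatFunc.C (K := ℂ))).det • starMat Q =
      ((polyMat Q).adjugate).map (algebraMap (Polynomial ℂ) (RatFunc ℂ)) := by
    rw [starMat, Matrix.inv_def, smul_smul, Ring.mul_inverse_cancel _ (isUnit_det_one_sub_X_smul Q),
      one_smul, ← polyMat_map, ← RingHom.mapMatrix_apply, ← RingHom.mapMatrix_apply,
      ← RingHom.map_adjugate]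
  have h2 := congrFun (congrFun h1 x) y
  rw [det_one_sub_X_smul, Matrix.smul_apply, smul_eq_mul, Matrix.map_apply] at h2
  rw [mul_comm, h2]

/-- The value at `z` of the matrix `(1 - X Q)⁻¹`. -/
noncomputable def starVal (Q : Matrix n n ℂ) (z : ℂ) : Matrix n n ℂ := (starMat Q).map (value z)

theorem mul_starVal {Q : Matrix n n ℂ} {z : ℂ} (h : ∀ x y, RegularAt z (starMat Q x y)) :
    (1 - z • Q) * starVal Q z = 1 := by
  ext x y
  have h2 : ∀ i ∈ Finset.univ, RegularAt z (RatFunc.C (Q x i) * starMat Q i y) := fun i _ =>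
    (regularAt_C z _).mul (h i y)
  have h3 := value_sum z Finset.univ _ h2
  have h4 : RegularAt z (if x = y then 1 else 0) := by
    split_ifs
    · exact regularAt_one z
    · exact regularAt_zero z
  have h1 := congrArg (value z) (starMat_apply Q x y)
  rw [value_add h4 ((regularAt_X z).mul h3.1), value_mul (regularAt_X z) h3.1, h3.2, value_X] at h1
  rw [sub_mul, one_mul, Matrix.sub_apply, smul_mul_assoc, Matrix.smul_apply, Matrix.mul_apply,
    starVal, Matrix.map_apply, h1, smul_eq_mul, Matrix.one_apply]
  have h5 : ∀ i, value z (RatFunc.C (Q x i) * starMat Q i y) =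
      Q x i * (starMat Q).map (value z) i y := fun i => by
    rw [value_mul (regularAt_C z _) (h i y), value_C, Matrix.map_apply]
  simp only [h5]
  split_ifs <;> simp

theorem starVal_mul {Q : Matrix n n ℂ} {z : ℂ} (h : ∀ x y, RegularAt z (starMat Q x y)) :
    starVal Q z * (1 - z • Q) = 1 := mul_eq_one_comm.1 (mul_starVal h)

/-- Walks from `x` to `y`, split at their first visit to `v`; here `Q₀` is obtained from `Q` by
absorption at `v`. -/
theorem starMat_of_update_row {Q Q₀ : Matrix n n ℂ} {v : n} (hv : ∀ i, Q₀ v i = 0)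
    (hne : ∀ x, x ≠ v → ∀ i, Q₀ x i = Q x i) (x y : n) :
    starMat Q x y = starMat Q₀ x y + starMat Q₀ x v * (starMat Q v y - if v = y then 1 else 0) := by
  have h1 : ∀ i, ((1 - (RatFunc.X : RatFunc ℂ) • Q₀.map (RatFunc.C (K := ℂ))) * starMat Q) i y =
      (if i = y then 1 else 0) + if i = v then (starMat Q v y - if v = y then 1 else 0) else 0 := by
    intro i
    rw [sub_mul, one_mul, Matrix.sub_apply, smul_mul_assoc, Matrix.smul_apply, Matrix.mul_apply,
      smul_eq_mul]
    by_cases hi : i = v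
    · subst hi
      simp [hv]
    · rw [starMat_apply Q i y]
      simp [hi, hne i hi]
  have h2 : starMat Q x y = ∑ i, starMat Q₀ x i *
      ((1 - (RatFunc.X : RatFunc ℂ) • Q₀.map (RatFunc.C (K := ℂ))) * starMat Q) i y := by
    rw [← Matrix.mul_apply, ← mul_assoc, starMat_mul, one_mul]
  rw [h2, Finset.sum_congr rfl fun i _ => by
      rw [h1 i, mul_add, mul_ite, mul_ite, mul_one, mul_zero],
    Finset.sum_add_distrib, Finset.sum_ite_eq', Finset.sum_ite_eq', if_pos (Finset.mem_univ _),
    if_pos (Finset.mem_univ _)]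

/-- Return and passage functions in terms of the walk absorbed at `v` as well. -/
theorem starMat_return_passage {Q Q₀ : Matrix n n ℂ} {v w : n} (hvw : v ≠ w) (hv : ∀ i, Q₀ v i = 0)
    (hne : ∀ x, x ≠ v → ∀ i, Q₀ x i = Q x i) :
    starMat Q v v * (1 - RatFunc.X * ∑ i, RatFunc.C (Q v i) * starMat Q₀ i v) = 1 ∧
    starMat Q v w = starMat Q v v * (RatFunc.X * ∑ i, RatFunc.C (Q v i) * starMat Q₀ i w) := by
  have h1 : ∀ x, starMat Q x v = starMat Q₀ x v * starMat Q v v := fun x => by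
    rw [starMat_of_update_row hv hne x v]
    simp only [if_true]
    ring
  have h2 : ∀ x, starMat Q x w = starMat Q₀ x w + starMat Q₀ x v * starMat Q v w := fun x => by
    rw [starMat_of_update_row hv hne x w]
    simp [hvw]
  have h3 := starMat_apply Q v v
  have h4 := starMat_apply Q v w
  rw [Finset.sum_congr rfl fun i _ => by rw [h1 i, ← mul_assoc], ← Finset.sum_mul,
    if_pos rfl] at h3
  rw [Finset.sum_congr rfl fun i _ => by rw [h2 i, mul_add, ← mul_assoc],
    Finset.sum_add_distrib, ← Finset.sum_mul, if_neg hvw, zero_add] at h4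
  set a := ∑ i, RatFunc.C (Q v i) * starMat Q₀ i v
  set b := ∑ i, RatFunc.C (Q v i) * starMat Q₀ i w
  set f := starMat Q v v
  set p := starMat Q v w
  have h5 : f * (1 - RatFunc.X * a) = 1 := by linear_combination h3
  refine ⟨h5, ?_⟩
  have h6 : p * (1 - RatFunc.X * a) = RatFunc.X * b := by linear_combination h4
  calc p = p * (f * (1 - RatFunc.X * a)) := by rw [h5, mul_one]
    _ = f * (p * (1 - RatFunc.X * a)) := by ring
    _ = _ := by rw [h6]

/-- The inverse of a matrix `1 - z Q` is a polynomial in `Q`. -/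
theorem exists_aeval_one_sub_smul {Q : Matrix n n ℂ} {z : ℂ} (h : (1 - z • Q).det ≠ 0) :
    ∃ q : Polynomial ℂ,
      Polynomial.aeval Q ((1 - Polynomial.C z * Polynomial.X) * q - 1) = 0 := by
  -- Cayley–Hamilton for `B`, solved for `B⁻¹`
  set B := 1 - z • Q with hB
  have h0 : B.charpoly.coeff 0 ≠ 0 := by
    rw [Matrix.det_eq_sign_charpoly_coeff] at h
    exact right_ne_zero_of_mul h
  have h1 := B.aeval_self_charpoly
  rw [← Polynomial.divX_mul_X_add B.charpoly, map_add, map_mul, Polynomial.aeval_X,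
    Polynomial.aeval_C] at h1
  have h2 : Polynomial.aeval Q (1 - Polynomial.C z * Polynomial.X) = B := by
    simp [hB, Algebra.smul_def]
  refine ⟨Polynomial.C (-(B.charpoly.coeff 0)⁻¹) *
    B.charpoly.divX.comp (1 - Polynomial.C z * Polynomial.X), ?_⟩
  rw [map_sub, map_mul, map_mul, Polynomial.aeval_comp, h2, map_one, Polynomial.aeval_C]
  have h3 : B * (Polynomial.aeval B) B.charpoly.divX = -(algebraMap ℂ _ (B.charpoly.coeff 0)) := by
    have h4 := congrArg (Polynomial.aeval B) (mul_comm B.charpoly.divX Polynomial.X)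
    rw [map_mul, map_mul, Polynomial.aeval_X] at h4
    rw [← h4]
    exact eq_neg_of_add_eq_zero_left h1
  rw [← mul_assoc, ← Algebra.commutes, mul_assoc, h3, ← map_neg, ← map_mul, neg_mul_neg,
    inv_mul_cancel₀ h0, map_one, sub_self]

end

/-! ### Cells -/

section

variable {V : Type*} {G : SimpleGraph V} {F C D : Set V}

theorem notMem_of_mem_cell (hC : C ∈ cells G F) {x : V} (hx : x ∈ C) : x ∉ F := by
  obtain ⟨c, rfl⟩ := hC
  obtain ⟨y, -, rfl⟩ := hx
  exact y.2

theorem exists_cell {x : V} (hx : x ∉ F) : ∃ C ∈ cells G F, x ∈ C :=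
  ⟨_, ⟨(G.induce Fᶜ).connectedComponentMk ⟨x, hx⟩, rfl⟩, ⟨⟨x, hx⟩, rfl, rfl⟩⟩

theorem cell_eq_of_mem (hC : C ∈ cells G F) (hD : D ∈ cells G F) {x : V} (hx : x ∈ C)
    (hx' : x ∈ D) : C = D := by
  obtain ⟨c, rfl⟩ := hC
  obtain ⟨d, rfl⟩ := hD
  obtain ⟨y, hy, rfl⟩ := hx
  obtain ⟨y', hy', h⟩ := hx'
  rw [Subtype.ext h] at hy'
  rw [SimpleGraph.ConnectedComponent.mem_supp_iff] at hy hy'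
  rw [← hy, ← hy']

theorem mem_cell_of_adj (hC : C ∈ cells G F) {x y : V} (hx : x ∈ C) (h : G.Adj x y)
    (hy : y ∉ F) : y ∈ C := by
  obtain ⟨c, rfl⟩ := hC
  obtain ⟨x, hx, rfl⟩ := hx
  refine ⟨⟨y, hy⟩, ?_, rfl⟩
  rw [SimpleGraph.ConnectedComponent.mem_supp_iff] at hx ⊢
  rw [← hx]
  exact SimpleGraph.ConnectedComponent.sound
    (SimpleGraph.Adj.reachable (show (G.induce Fᶜ).Adj ⟨y, hy⟩ x from h.symm))

theorem bdry_subset (hC : C ∈ cells G F) : bdry G C ⊆ F := by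
  rintro x ⟨hx, y, hy, h⟩
  by_contra hxF
  exact hx (mem_cell_of_adj hC hy h hxF)

theorem mem_clos_of_adj {x y : V} (hx : x ∈ C) (h : G.Adj x y) : y ∈ clos G C := by
  by_cases hy : y ∈ C
  · exact Or.inl hy
  · exact Or.inr ⟨hy, x, hx, h⟩

theorem mem_bdry_iff_of_mem_clos (hC : C ∈ cells G F) {x : V} (hx : x ∈ clos G C) :
    x ∈ bdry G C ↔ x ∈ F :=
  ⟨fun h => bdry_subset hC h, fun h => hx.resolve_left fun h' => notMem_of_mem_cell hC h' h⟩

theorem mem_iff_of_mem_clos (hC : C ∈ cells G F) {x : V} (hx : x ∈ clos G C) :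
    x ∈ C ↔ x ∉ F :=
  ⟨fun h => notMem_of_mem_cell hC h, fun h => hx.resolve_right fun h' => h (bdry_subset hC h')⟩

/-- A property which is inherited by neighbours inside a cell holds on the whole cell as soon as it
holds at one vertex. -/
theorem cell_induction (hC : C ∈ cells G F) {p : V → Prop}
    (h : ∀ x ∈ C, ∀ y ∈ C, G.Adj x y → p x → p y) {x y : V} (hx : x ∈ C) (hy : y ∈ C)
    (hp : p x) : p y := by
  obtain ⟨c, rfl⟩ := hC
  obtain ⟨x, hx, rfl⟩ := hx
  obtain ⟨y, hy, rfl⟩ := hy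
  rw [SimpleGraph.ConnectedComponent.mem_supp_iff] at hx hy
  obtain ⟨q⟩ := SimpleGraph.ConnectedComponent.exact (hx.trans hy.symm)
  induction q with
  | nil => exact hp
  | @cons a b d hab q ih =>
    have hb : (G.induce Fᶜ).connectedComponentMk b = c := by
      rw [← hx]
      exact SimpleGraph.ConnectedComponent.sound hab.symm.reachable
    exact ih hb (h a ⟨a, hx, rfl⟩ b ⟨b, hb, rfl⟩ hab hp) hy

/-- The cell which contains a vertex outside of `F`. -/
def cellOf (G : SimpleGraph V) (F : Set V) (x : V) : Set V := {y | ∃ C ∈ cells G F, x ∈ C ∧ y ∈ C}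

theorem cellOf_eq (hC : C ∈ cells G F) {x : V} (hx : x ∈ C) : cellOf G F x = C := by
  ext y
  constructor
  · rintro ⟨D, hD, h1, h2⟩
    rwa [cell_eq_of_mem hC hD hx h1]
  · exact fun hy => ⟨C, hC, hx, hy⟩

theorem cellOf_mem_cells {x : V} (hx : x ∉ F) : cellOf G F x ∈ cells G F := by
  obtain ⟨C, hC, hxC⟩ := exists_cell (G := G) hx
  rwa [cellOf_eq hC hxC]

theorem mem_cellOf {x : V} (hx : x ∉ F) : x ∈ cellOf G F x := by
  obtain ⟨C, hC, hxC⟩ := exists_cell (G := G) hx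
  exact ⟨C, hC, hxC, hxC⟩

theorem mem_bdry_cellOf {s y : V} (hs : s ∈ F) (hy : y ∉ F) (h : G.Adj s y) :
    s ∈ bdry G (cellOf G F y) :=
  ⟨fun h' => notMem_of_mem_cell (cellOf_mem_cells hy) h' hs, y, mem_cellOf hy, h.symm⟩

/-- Every vertex lies in the closure of some cell. -/
theorem exists_mem_clos (hF : ∀ x ∈ F, ∀ y ∈ F, ¬ G.Adj x y) (hnb : ∀ x, ∃ y, G.Adj x y) (x : V) :
    ∃ C ∈ cells G F, x ∈ clos G C := by
  by_cases hx : x ∈ F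
  · obtain ⟨y, hy⟩ := hnb x
    have hyF : y ∉ F := fun h => hF x hx y h hy
    exact ⟨_, cellOf_mem_cells hyF, Or.inr (mem_bdry_cellOf hx hyF hy)⟩
  · exact ⟨_, cellOf_mem_cells hx, Or.inl (mem_cellOf hx)⟩

theorem clos_finite [G.LocallyFinite] (hC : C.Finite) : (clos G C).Finite := by
  refine hC.union (Set.Finite.subset (hC.biUnion fun y _ =>
    (G.neighborFinset y).finite_toSet) ?_)
  rintro x ⟨-, y, hy, h⟩
  simp only [mem_iUnion]
  exact ⟨y, hy, by simpa using h⟩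

/-! ### The walk on the closure of a cell -/

open Classical in
theorem absMatrix_apply (G : SimpleGraph V) (C B : Set V) (x y : clos G C) :
    absMatrix G C B x y = if G.Adj x y ∧ (x : V) ∉ B then
      (((G.induce (clos G C)).neighborSet x).ncard : ℂ)⁻¹ else 0 := by
  rw [absMatrix]

theorem starMatrix_eq (G : SimpleGraph V) (C B : Set V) [Fintype (clos G C)]
    [DecidableEq (clos G C)] : starMatrix G C B = starMat (absMatrix G C B) := by
  rw [starMatrix, dif_pos (inferInstance : Finite (clos G C)), starMat]
  congr!

theorem absMatrix_of_mem (B : Set V) {x : clos G C} (hx : (x : V) ∈ B) (y : clos G C) :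
    absMatrix G C B x y = 0 := by
  classical
  rw [absMatrix_apply, if_neg fun h => h.2 hx]

theorem absMatrix_congr (B B' : Set V) {x : clos G C} (hx : (x : V) ∈ B ↔ (x : V) ∈ B')
    (y : clos G C) : absMatrix G C B x y = absMatrix G C B' x y := by
  classical
  rw [absMatrix_apply, absMatrix_apply, hx]

/-- The transition matrices are invariant under isomorphisms of the closures of cells. -/
theorem absMatrix_iso (e : G.induce (clos G C) ≃g G.induce (clos G D)) {B B' : Set V}
    (hB : ∀ x : clos G C, (e x : V) ∈ B' ↔ (x : V) ∈ B) (x y : clos G C) :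
    absMatrix G D B' (e x) (e y) = absMatrix G C B x y := by
  classical
  have h1 : G.Adj (e x : V) (e y) ↔ G.Adj (x : V) y := e.map_adj_iff
  have h2 : ((G.induce (clos G D)).neighborSet (e x)).ncard =
      ((G.induce (clos G C)).neighborSet x).ncard := by
    rw [← e.image_neighborSet, Set.ncard_image_of_injective _ e.injective]
  rw [absMatrix_apply, absMatrix_apply, h1, h2, hB]

theorem starMatrix_iso [Finite (clos G C)] (e : G.induce (clos G C) ≃g G.induce (clos G D))
    {B B' : Set V} (hB : ∀ x : clos G C, (e x : V) ∈ B' ↔ (x : V) ∈ B) (x y : clos G C) :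
    starMatrix G D B' (e x) (e y) = starMatrix G C B x y := by
  classical
  let _ : Fintype (clos G C) := Fintype.ofFinite _
  let _ : Fintype (clos G D) := Fintype.ofEquiv _ e.toEquiv
  rw [starMatrix_eq, starMatrix_eq]
  exact starMat_reindex e.toEquiv (absMatrix_iso e hB) x y

theorem sum_absMatrix_eq [Fintype (clos G C)] [G.LocallyFinite] [DecidablePred (· ∈ clos G C)]
    {B : Set V} {x : clos G C} (hx : (x : V) ∉ B) (u : V → ℂ) :
    ∑ y, absMatrix G C B x y * u y = (∑ y ∈ G.neighborFinset x with y ∈ clos G C, u y) /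
      ((G.neighborFinset x).filter (· ∈ clos G C)).card := by
  classical
  have hmap : (G.neighborFinset x).filter (· ∈ clos G C) =
      (Finset.univ.filter (fun y : clos G C => G.Adj x y)).map
        (Function.Embedding.subtype _) := by
    ext y
    simp
  have hcard : ((G.induce (clos G C)).neighborSet x).ncard =
      ((G.neighborFinset x).filter (· ∈ clos G C)).card := by
    rw [hmap, Finset.card_map, Set.ncard_eq_toFinset_card']
    congr 1
    ext y
    simp
  rw [hmap, Finset.sum_map, ← hmap, ← hcard, Finset.sum_filter, Finset.sum_div]
  refine Finset.sum_congr rfl fun y _ => ?_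
  rw [absMatrix_apply]
  simp only [Function.Embedding.subtype_apply]
  by_cases h : G.Adj x y
  · rw [if_pos ⟨h, hx⟩, if_pos h, div_eq_inv_mul]
  · rw [if_neg fun h' => h h'.1, if_neg h, zero_mul, zero_div]

/-- Inside a cell, the walk on the closure of the cell is the walk on the whole graph. -/
theorem sum_absMatrix_bdry [Fintype (clos G C)] [G.LocallyFinite] {x : clos G C}
    (hx : (x : V) ∈ C) (u : V → ℂ) :
    ∑ y, absMatrix G C (bdry G C) x y * u y = walk G u x := by
  classical
  rw [sum_absMatrix_eq (fun h => h.1 hx), Finset.filter_true_of_mem, walk,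
    SimpleGraph.card_neighborFinset_eq_degree]
  intro y hy
  exact mem_clos_of_adj hx (by simpa using hy)

/-! ### Substochastic matrices -/

theorem absMatrix_eq_ofReal (G : SimpleGraph V) (C B : Set V) (x y : clos G C) :
    ∃ r : ℝ, 0 ≤ r ∧ absMatrix G C B x y = r := by
  classical
  rw [absMatrix_apply]
  split_ifs
  · exact ⟨((((G.induce (clos G C)).neighborSet x).ncard : ℝ))⁻¹, by positivity, by simp⟩
  · exact ⟨0, le_rfl, by simp⟩

theorem sum_norm_absMatrix_le [Fintype (clos G C)] (B : Set V)
    (x : clos G C) : ∑ y, ‖absMatrix G C B x y‖ ≤ 1 := by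
  classical
  have h1 : ∀ y, ‖absMatrix G C B x y‖ ≤ if G.Adj x y then
      (((G.induce (clos G C)).neighborSet x).ncard : ℝ)⁻¹ else 0 := by
    intro y
    rw [absMatrix_apply]
    by_cases h : G.Adj x y
    · rw [if_pos h]
      split_ifs <;> simp
    · rw [if_neg h, if_neg fun h' => h h'.1, norm_zero]
  refine (Finset.sum_le_sum fun y _ => h1 y).trans ?_
  rw [← Finset.sum_filter, Finset.sum_const, nsmul_eq_mul]
  have h2 : ((G.induce (clos G C)).neighborSet x).ncard =
      (Finset.univ.filter (fun y : clos G C => G.Adj x y)).card := by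
    rw [Set.ncard_eq_toFinset_card']
    congr 1
    ext y
    simp
  rw [h2]
  exact mul_inv_le_one

end

/-! ### Consequences of the symmetry of the cells -/

section

variable {V : Type*} {G : SimpleGraph V} {F C D : Set V}

theorem starMatrix_bdry_of_mem_bdry [Finite (clos G C)] [DecidableEq (clos G C)] {x : clos G C}
    (hx : (x : V) ∈ bdry G C) (y : clos G C) :
    starMatrix G C (bdry G C) x y = if x = y then 1 else 0 := by
  let _ : Fintype (clos G C) := Fintype.ofFinite _
  rw [starMatrix_eq]
  exact starMat_apply_of_row_eq_zero _ _ _ fun i => absMatrix_of_mem _ hx i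

/-- The rows of boundary vertices are constant and contribute no poles. -/
theorem notMem_poles_of_notMem_innerPoles [Finite (clos G C)] {z : OnePoint ℂ}
    (hz : z ∉ innerPoles G C) (x y : clos G C) : z ∉ poles (starMatrix G C (bdry G C) x y) := by
  classical
  have hconst : ∀ c : ℂ, z ∉ poles (RatFunc.C c) := by
    intro c
    induction z using OnePoint.rec with
    | infty => simp [poles, ratMap_infty]
    | coe a => exact regularAt_iff.1 (regularAt_C a c)
  rcases x.2 with hx | hx
  · exact fun h => hz ⟨x, y, hx, h⟩
  · rw [starMatrix_bdry_of_mem_bdry hx]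
    split_ifs
    · exact map_one (RatFunc.C (K := ℂ)) ▸ hconst 1
    · exact map_zero (RatFunc.C (K := ℂ)) ▸ hconst 0

theorem regularAt_of_notMem_innerPoles [Finite (clos G C)] {z : ℂ}
    (hz : (z : OnePoint ℂ) ∉ innerPoles G C) (x y : clos G C) :
    RegularAt z (starMatrix G C (bdry G C) x y) :=
  regularAt_iff.2 (notMem_poles_of_notMem_innerPoles hz x y)

theorem finite_clos_of_mem_cells [G.LocallyFinite] (hF : IsSymSelfSimilar G F)
    (hC : C ∈ cells G F) : Finite (clos G C) :=
  (clos_finite (hF.finite_cells C hC)).to_subtype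

/-- There is an isomorphism between the closures of any two cells which matches their boundaries and
takes prescribed values at two boundary vertices. -/
theorem exists_cell_iso (hF : IsSymSelfSimilar G F) (hC : C ∈ cells G F) (hD : D ∈ cells G F)
    {v w : clos G C} (hv : v ∈ bdryIn G C) (hw : w ∈ bdryIn G C) (hvw : v ≠ w) {s t : clos G D}
    (hs : s ∈ bdryIn G D) (ht : t ∈ bdryIn G D) (hst : s ≠ t) :
    ∃ e : G.induce (clos G C) ≃g G.induce (clos G D),
      (∀ x, (e x : V) ∈ bdry G D ↔ (x : V) ∈ bdry G C) ∧ e v = s ∧ e w = t := by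
  obtain ⟨α, hα⟩ := hF.cell_iso C hC D hD
  have hmem : ∀ x ∈ bdryIn G C, α x ∈ bdryIn G D := fun x hx => hα ▸ mem_image_of_mem _ hx
  obtain ⟨γ, hγ, h1, h2⟩ := hF.double_trans D hD (α v) (hmem v hv) (α w) (hmem w hw) s hs t ht
    (fun h => hvw (α.injective h)) hst
  refine ⟨α.trans γ, fun x => ?_, h1, h2⟩
  have h3 : γ (α x) ∈ bdryIn G D ↔ x ∈ bdryIn G C := by
    conv_lhs => rw [← hγ]
    rw [γ.injective.mem_set_image, ← hα, α.injective.mem_set_image]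
  exact h3

theorem exists_bdry_ne (hF : IsSymSelfSimilar G F) (hC : C ∈ cells G F) (hD : D ∈ cells G F)
    {v w : clos G C} (hv : v ∈ bdryIn G C) (hw : w ∈ bdryIn G C) (hvw : v ≠ w) (s : clos G D) :
    ∃ t ∈ bdryIn G D, s ≠ t := by
  obtain ⟨α, hα⟩ := hF.cell_iso C hC D hD
  have hmem : ∀ x ∈ bdryIn G C, α x ∈ bdryIn G D := fun x hx => hα ▸ mem_image_of_mem _ hx
  by_cases h : s = α v
  · exact ⟨α w, hmem w hw, fun h' => hvw (α.injective (h.symm.trans h'))⟩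
  · exact ⟨α v, hmem v hv, h⟩

theorem ncard_bdry_eq (hF : IsSymSelfSimilar G F) (hC : C ∈ cells G F) (hD : D ∈ cells G F) :
    (bdry G D).ncard = (bdry G C).ncard := by
  obtain ⟨α, hα⟩ := hF.cell_iso C hC D hD
  have h : ∀ E : Set V, (bdryIn G E).ncard = (bdry G E).ncard := by
    intro E
    have : bdry G E = Subtype.val '' bdryIn G E := by
      ext x
      constructor
      · exact fun hx => ⟨⟨x, Or.inr hx⟩, hx, rfl⟩
      · rintro ⟨y, hy, rfl⟩
        exact hy
    rw [this, Set.ncard_image_of_injective _ Subtype.val_injective]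
  rw [← h, ← h, ← hα, Set.ncard_image_of_injective _ α.injective]

/-- The number of neighbours in a cell `D` of a vertex `s`. -/
noncomputable def bdryDeg (G : SimpleGraph V) (D : Set V) (s : V) : ℕ := {y ∈ D | G.Adj s y}.ncard

theorem ncard_neighborSet_eq_bdryDeg (hF : IsSymSelfSimilar G F) (hD : D ∈ cells G F)
    {s : clos G D} (hs : s ∈ bdryIn G D) :
    ((G.induce (clos G D)).neighborSet s).ncard = bdryDeg G D s := by
  rw [bdryDeg, ← Set.ncard_image_of_injective _ Subtype.val_injective]
  congr 1
  ext y
  constructor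
  · rintro ⟨y, hy, rfl⟩
    have hy' : G.Adj s y := hy
    refine ⟨(mem_iff_of_mem_clos hD y.2).2 fun h => ?_, hy'⟩
    exact hF.not_adj s (bdry_subset hD hs) y h hy'
  · rintro ⟨hy, h⟩
    exact ⟨⟨y, Or.inl hy⟩, h, rfl⟩

theorem bdryDeg_eq (hF : IsSymSelfSimilar G F) (hC : C ∈ cells G F) (hD : D ∈ cells G F)
    {v w : clos G C} (hv : v ∈ bdryIn G C) (hw : w ∈ bdryIn G C) (hvw : v ≠ w) {s : V}
    (hs : s ∈ bdry G D) : bdryDeg G D s = bdryDeg G C v := by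
  have hs' : (⟨s, Or.inr hs⟩ : clos G D) ∈ bdryIn G D := hs
  obtain ⟨t, ht, hst⟩ := exists_bdry_ne hF hC hD hv hw hvw ⟨s, Or.inr hs⟩
  obtain ⟨e, -, h1, -⟩ := exists_cell_iso hF hC hD hv hw hvw hs' ht hst
  rw [← ncard_neighborSet_eq_bdryDeg hF hC hv, ← ncard_neighborSet_eq_bdryDeg hF hD hs', ← h1,
    ← e.image_neighborSet, Set.ncard_image_of_injective _ e.injective]

theorem bdryDeg_pos [G.LocallyFinite] {s : V} (hs : s ∈ bdry G D) : 0 < bdryDeg G D s := by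
  obtain ⟨-, y, hy, h⟩ := hs
  rw [bdryDeg, Set.ncard_pos ((G.neighborFinset s).finite_toSet.subset fun y hy => by
    simpa using hy.2)]
  exact ⟨y, hy, h.symm⟩

/-- The generating function, at `z`, of the walks on the closure of `C` which start at `s`, end at
`t` and do not meet the boundary in between. -/
noncomputable def passage (G : SimpleGraph V) (C : Set V) [Fintype (clos G C)] (z : ℂ)
    (s t : clos G C) : ℂ :=
  z * ∑ y, absMatrix G C ∅ s y * value z (starMatrix G C (bdry G C) y t)

theorem passage_iso [Fintype (clos G C)] [Fintype (clos G D)]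
    (e : G.induce (clos G C) ≃g G.induce (clos G D))
    (he : ∀ x, (e x : V) ∈ bdry G D ↔ (x : V) ∈ bdry G C) (z : ℂ) (s t : clos G C) :
    passage G D z (e s) (e t) = passage G C z s t := by
  rw [passage, passage]
  congr 1
  refine (Fintype.sum_equiv e.toEquiv _ _ fun y => ?_).symm
  have h1 := absMatrix_iso e (B := ∅) (B' := ∅) (fun x => Iff.rfl) s y
  have h2 := starMatrix_iso e he y t
  change _ = absMatrix G D ∅ (e s) (e y) * value z (starMatrix G D (bdry G D) (e y) (e t))
  rw [h1, h2]

theorem passage_self_eq [Fintype (clos G C)] [Fintype (clos G D)] (hF : IsSymSelfSimilar G F)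
    (hC : C ∈ cells G F) (hD : D ∈ cells G F) {v w : clos G C} (hv : v ∈ bdryIn G C)
    (hw : w ∈ bdryIn G C) (hvw : v ≠ w) (z : ℂ) {s : clos G D} (hs : s ∈ bdryIn G D) :
    passage G D z s s = passage G C z v v := by
  obtain ⟨t, ht, hst⟩ := exists_bdry_ne hF hC hD hv hw hvw s
  obtain ⟨e, he, h1, -⟩ := exists_cell_iso hF hC hD hv hw hvw hs ht hst
  rw [← h1, passage_iso e he]

theorem passage_ne_eq [Fintype (clos G C)] [Fintype (clos G D)] (hF : IsSymSelfSimilar G F)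
    (hC : C ∈ cells G F) (hD : D ∈ cells G F) {v w : clos G C} (hv : v ∈ bdryIn G C)
    (hw : w ∈ bdryIn G C) (hvw : v ≠ w) (z : ℂ) {s t : clos G D} (hs : s ∈ bdryIn G D)
    (ht : t ∈ bdryIn G D) (hst : s ≠ t) : passage G D z s t = passage G C z v w := by
  obtain ⟨e, he, h1, h2⟩ := exists_cell_iso hF hC hD hv hw hvw hs ht hst
  rw [← h1, ← h2, passage_iso e he]

/-- At a finite point which is no pole of the return function and of the inner transition
functions, the transition function is finite, and the return and transition functions are expressed
by the passage functions. -/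
theorem value_return_transition [Fintype (clos G C)] {v w : clos G C} (hv : v ∈ bdryIn G C)
    (hvw : v ≠ w) {z : ℂ} (hz : (z : OnePoint ℂ) ∉ innerPoles G C)
    (hf : (z : OnePoint ℂ) ∉ poles (returnFn G C v)) :
    RegularAt z (transitionFn G C v w) ∧
    value z (returnFn G C v) * (1 - passage G C z v v) = 1 ∧
    value z (transitionFn G C v w) =
      value z (returnFn G C v) * passage G C z v w * (((bdry G C).ncard : ℂ) - 1) := by
  classical
  have hreg := regularAt_of_notMem_innerPoles hz
  have hf' := regularAt_iff.2 hf
  have hrow : ∀ i, absMatrix G C (bdry G C \ {(v : V)}) v i = absMatrix G C ∅ v i := fun i =>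
    absMatrix_congr _ _ (by simp) i
  obtain ⟨h1, h2⟩ := starMat_return_passage (Q := absMatrix G C (bdry G C \ {(v : V)}))
    (Q₀ := absMatrix G C (bdry G C)) hvw (fun i => absMatrix_of_mem _ hv i)
    (fun x hx i => absMatrix_congr _ _ (by
      have : (x : V) ≠ v := fun h => hx (Subtype.ext h)
      simp [this]) i)
  simp only [hrow, ← starMatrix_eq] at h1 h2
  have hs : ∀ t, RegularAt z (RatFunc.X * ∑ i, RatFunc.C (absMatrix G C ∅ v i) *
      starMatrix G C (bdry G C) i t) ∧ value z (RatFunc.X * ∑ i, RatFunc.C (absMatrix G C ∅ v i) *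
      starMatrix G C (bdry G C) i t) = passage G C z v t := by
    intro t
    have h3 := value_sum z Finset.univ (fun i => RatFunc.C (absMatrix G C ∅ v i) *
      starMatrix G C (bdry G C) i t) fun i _ => (regularAt_C z _).mul (hreg i t)
    refine ⟨(regularAt_X z).mul h3.1, ?_⟩
    rw [value_mul (regularAt_X z) h3.1, h3.2, value_X, passage]
    congr 1
    exact Finset.sum_congr rfl fun i _ => by rw [value_mul (regularAt_C z _) (hreg i t), value_C]
  have hd : transitionFn G C v w = returnFn G C v * (RatFunc.X * ∑ i,
      RatFunc.C (absMatrix G C ∅ v i) * starMatrix G C (bdry G C) i w) *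
      RatFunc.C (((bdry G C).ncard : ℂ) - 1) := by
    rw [transitionFn, h2, returnFn]
  refine ⟨?_, ?_, ?_⟩
  · rw [hd]
    exact (hf'.mul (hs w).1).mul (regularAt_C z _)
  · have h4 : returnFn G C v + RatFunc.C (-1) * (returnFn G C v * (RatFunc.X * ∑ i,
      RatFunc.C (absMatrix G C ∅ v i) * starMatrix G C (bdry G C) i v)) = 1 := by
      rw [← h1, returnFn, map_neg, map_one]
      ring
    have h5 := congrArg (value z) h4
    rw [value_add hf' ((regularAt_C z _).mul (hf'.mul (hs v).1)), value_mul (regularAt_C z _)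
      (hf'.mul (hs v).1), value_mul hf' (hs v).1, (hs v).2, value_C, value_one] at h5
    linear_combination h5
  · rw [hd, value_mul (hf'.mul (hs w).1) (regularAt_C z _), value_mul hf' (hs w).1, (hs w).2,
      value_C]

end

/-! ### Solving the walk equation off `F` -/

section

variable {V : Type*} {G : SimpleGraph V} [G.LocallyFinite] {F C D : Set V}

open Classical in
/-- The averaging operator of the walk absorbed in `F`. -/
noncomputable def offWalk (G : SimpleGraph V) [G.LocallyFinite] (F : Set V) :
    Module.End ℂ (V → ℂ) where
  toFun f x := if x ∈ F then 0 else walk G f x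
  map_add' f g := by
    ext x
    rw [walk_add]
    by_cases h : x ∈ F <;> simp [h]
  map_smul' c f := by
    ext x
    rw [walk_smul]
    by_cases h : x ∈ F <;> simp [h]

theorem offWalk_of_mem (f : V → ℂ) {x : V} (hx : x ∈ F) : offWalk G F f x = 0 := if_pos hx

theorem offWalk_of_notMem (f : V → ℂ) {x : V} (hx : x ∉ F) : offWalk G F f x = walk G f x :=
  if_neg hx

theorem mem_degL2Sub_of_le {f g : V → ℂ} (hf : f ∈ degL2Sub G) (h : ∀ x, g x = 0 ∨ g x = f x) :
    g ∈ degL2Sub G := by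
  refine Summable.of_nonneg_of_le (fun x => by positivity) (fun x => ?_) hf
  rcases h x with h | h
  · rw [h, norm_zero, zero_pow two_ne_zero, mul_zero]
    positivity
  · rw [h]

theorem walk_mem_degL2Sub {f : V → ℂ} (hf : f ∈ degL2Sub G) : walk G f ∈ degL2Sub G :=
  (walk_bound G f hf).1

theorem offWalk_mem_degL2Sub {f : V → ℂ} (hf : f ∈ degL2Sub G) : offWalk G F f ∈ degL2Sub G :=
  mem_degL2Sub_of_le (walk_mem_degL2Sub hf) fun x => by
    by_cases hx : x ∈ F
    · exact Or.inl (offWalk_of_mem f hx)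
    · exact Or.inr (offWalk_of_notMem f hx)

theorem aeval_offWalk_mem_degL2Sub (p : Polynomial ℂ) {f : V → ℂ} (hf : f ∈ degL2Sub G) :
    Polynomial.aeval (offWalk G F) p f ∈ degL2Sub G := by
  induction p using Polynomial.induction_on' with
  | add p q hp hq =>
    rw [map_add]
    exact (degL2Sub G).add_mem hp hq
  | monomial n a =>
    rw [Polynomial.aeval_monomial]
    change a • ((offWalk G F ^ n) f) ∈ _
    refine (degL2Sub G).smul_mem a ?_
    induction n with
    | zero => exact hf
    | succ n ih =>
      rw [pow_succ']
      exact offWalk_mem_degL2Sub ih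

/-- On the closure of a cell, the walk absorbed in `F` acts by the transition matrix of the cell. -/
theorem offWalk_restrict [Fintype (clos G D)] (hD : D ∈ cells G F) (f : V → ℂ) :
    (fun x : clos G D => offWalk G F f x) = (absMatrix G D (bdry G D)).mulVec fun x => f x := by
  ext x
  rw [Matrix.mulVec, dotProduct]
  by_cases hx : (x : V) ∈ D
  · rw [offWalk_of_notMem f (notMem_of_mem_cell hD hx), sum_absMatrix_bdry hx]
  · have hx' : (x : V) ∈ bdry G D := x.2.resolve_left hx
    rw [offWalk_of_mem f (bdry_subset hD hx')]
    exact (Finset.sum_eq_zero fun y _ => by rw [absMatrix_of_mem _ hx', zero_mul]).symm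

theorem aeval_offWalk_restrict [Fintype (clos G D)] [DecidableEq (clos G D)] (hD : D ∈ cells G F)
    (p : Polynomial ℂ) (f : V → ℂ) :
    (fun x : clos G D => Polynomial.aeval (offWalk G F) p f x) =
      (Polynomial.aeval (absMatrix G D (bdry G D)) p).mulVec fun x => f x := by
  induction p using Polynomial.induction_on' with
  | add p q hp hq =>
    rw [map_add, map_add, Matrix.add_mulVec, ← hp, ← hq]
    rfl
  | monomial n a =>
    rw [Polynomial.aeval_monomial, Polynomial.aeval_monomial, ← Algebra.smul_def,
      ← Algebra.smul_def, Matrix.smul_mulVec]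
    change a • (fun x : clos G D => (offWalk G F ^ n) f x) = _
    congr 1
    induction n with
    | zero => simp
    | succ n ih =>
      rw [pow_succ', pow_succ', ← Matrix.mulVec_mulVec, ← ih]
      exact offWalk_restrict hD _

/-- If `z` is no pole of the inner transition functions, then `1 - z P_F`, where `P_F` is the walk
absorbed in `F`, is invertible. The inverse is a polynomial in `P_F`, because the matrices of `P_F`
on all cells are conjugate by permutations; in particular it preserves `ℓ²`. -/
theorem exists_inverse_offWalk (hF : IsSymSelfSimilar G F) (hnb : ∀ x, ∃ y, G.Adj x y)
    (hC : C ∈ cells G F) {z : ℂ} (hz : (z : OnePoint ℂ) ∉ innerPoles G C) :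
    ∃ E : Module.End ℂ (V → ℂ), (∀ f ∈ degL2Sub G, E f ∈ degL2Sub G) ∧
      (∀ f, E (f - z • offWalk G F f) = f) ∧ (∀ f, E f - z • offWalk G F (E f) = f) ∧
      ∀ D ∈ cells G F, ∀ (_ : Fintype (clos G D)) (f : V → ℂ) (x : clos G D),
        E f x = ∑ y, value z (starMatrix G D (bdry G D) x y) * f y := by
  classical
  have hfinC := finite_clos_of_mem_cells hF hC
  let _ : Fintype (clos G C) := Fintype.ofFinite _
  have hreg := regularAt_of_notMem_innerPoles hz
  simp only [starMatrix_eq] at hreg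
  have hdet : (1 - z • absMatrix G C (bdry G C)).det ≠ 0 := fun h => by
    have := congrArg Matrix.det (mul_starVal hreg)
    rw [Matrix.det_mul, h, zero_mul, Matrix.det_one] at this
    exact zero_ne_one this
  obtain ⟨q, hq⟩ := exists_aeval_one_sub_smul hdet
  have hiso : ∀ D ∈ cells G F, ∃ e : G.induce (clos G C) ≃g G.induce (clos G D),
      ∀ x, (e x : V) ∈ bdry G D ↔ (x : V) ∈ bdry G C := by
    intro D hD
    obtain ⟨α, hα⟩ := hF.cell_iso C hC D hD
    refine ⟨α, fun x => ?_⟩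
    have h3 : α x ∈ bdryIn G D ↔ x ∈ bdryIn G C := by
      rw [← hα, α.injective.mem_set_image]
    exact h3
  have hqD : ∀ D ∈ cells G F, ∀ (_ : Fintype (clos G D)),
      Polynomial.aeval (absMatrix G D (bdry G D)) ((1 - Polynomial.C z * Polynomial.X) * q - 1) =
        0 := by
    intro D hD _
    obtain ⟨e, he⟩ := hiso D hD
    have h1 : absMatrix G D (bdry G D) =
        Matrix.reindexAlgEquiv ℂ ℂ e.toEquiv (absMatrix G C (bdry G C)) := by
      ext x y
      obtain ⟨x, rfl⟩ := e.surjective x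
      obtain ⟨y, rfl⟩ := e.surjective y
      rw [absMatrix_iso e he, Matrix.coe_reindexAlgEquiv, Matrix.reindex_apply,
        Matrix.submatrix_apply]
      exact congrArg₂ _ (e.symm_apply_apply x).symm (e.symm_apply_apply y).symm
    rw [h1, Polynomial.aeval_algHom_apply, hq, map_zero]
  have hzero : Polynomial.aeval (offWalk G F)
      ((1 - Polynomial.C z * Polynomial.X) * q - 1) = 0 := by
    ext f x
    obtain ⟨D, hD, hx⟩ := exists_mem_clos hF.not_adj hnb x
    have := finite_clos_of_mem_cells hF hD
    let _ : Fintype (clos G D) := Fintype.ofFinite _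
    have h1 := congrFun (aeval_offWalk_restrict hD
      ((1 - Polynomial.C z * Polynomial.X) * q - 1) f) ⟨x, hx⟩
    rw [hqD D hD inferInstance, Matrix.zero_mulVec] at h1
    exact h1
  have hmul : ∀ f, (Polynomial.aeval (offWalk G F) (1 - Polynomial.C z * Polynomial.X)) f =
      f - z • offWalk G F f := by
    intro f
    simp
  rw [map_sub, map_one, sub_eq_zero] at hzero
  have hzero' := hzero
  rw [mul_comm, map_mul] at hzero'
  rw [map_mul] at hzero
  refine ⟨Polynomial.aeval (offWalk G F) q, fun f hf => aeval_offWalk_mem_degL2Sub q hf,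
    fun f => ?_, fun f => ?_, fun D hD _ f x => ?_⟩
  · rw [← hmul]
    exact congrFun (congrArg DFunLike.coe hzero') f
  · rw [← hmul]
    exact congrFun (congrArg DFunLike.coe hzero) f
  · have h1 := congrFun (aeval_offWalk_restrict hD q f) x
    refine h1.trans ?_
    have hregD : ∀ x y, RegularAt z (starMat (absMatrix G D (bdry G D)) x y) := by
      obtain ⟨e, he⟩ := hiso D hD
      intro x y
      obtain ⟨x, rfl⟩ := e.surjective x
      obtain ⟨y, rfl⟩ := e.surjective y
      rw [← starMatrix_eq, starMatrix_iso e he, starMatrix_eq]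
      exact hreg x y
    have h2 := hqD D hD inferInstance
    rw [map_sub, map_one, sub_eq_zero, map_mul] at h2
    have h3 : Polynomial.aeval (absMatrix G D (bdry G D)) (1 - Polynomial.C z * Polynomial.X) =
        1 - z • absMatrix G D (bdry G D) := by
      simp [Algebra.smul_def]
    rw [h3] at h2
    rw [← left_inv_eq_right_inv (starVal_mul hregD) h2, Matrix.mulVec, dotProduct, starMatrix_eq]
    rfl

end

/-! ### The walk observed on `F` -/

section

variable {V : Type*} {G : SimpleGraph V} [G.LocallyFinite] {F C D : Set V}

open Classical in
/-- The neighbours of `x` in the reduced graph which lie on the boundary of a cell `D` at `x` are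
all other boundary vertices of `D`. -/
theorem image_neighbors_bdry (ψ : G ≃g reduced G F) (hD : D ∈ cells G F) {x : V}
    (hx : (ψ x : V) ∈ bdry G D) :
    ((((G.neighborFinset x).filter fun x' => (ψ x' : V) ∈ bdry G D).image fun x' => (ψ x' : V) :
      Finset V) : Set V) = bdry G D \ {(ψ x : V)} := by
  ext t
  simp only [Finset.coe_image, Finset.coe_filter, SimpleGraph.mem_neighborFinset, mem_image,
    mem_ofPred_eq]
  constructor
  · rintro ⟨x', ⟨h1, h2⟩, rfl⟩
    exact ⟨h2, fun h => h1.ne (ψ.injective (Subtype.ext h.symm))⟩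
  · rintro ⟨h1, h2⟩
    obtain ⟨x', hx'⟩ := ψ.surjective ⟨t, bdry_subset hD h1⟩
    have hx'' : (ψ x' : V) = t := congrArg Subtype.val hx'
    refine ⟨x', ⟨?_, hx''.symm ▸ h1⟩, hx''⟩
    rw [← ψ.map_adj_iff]
    refine ⟨fun h => h2 ?_, D, hD, hx, hx''.symm ▸ h1⟩
    rw [← hx'', ← h]
    rfl

open Classical in
theorem sum_bdry_ne_eq (ψ : G ≃g reduced G F) (hD : D ∈ cells G F) [Fintype (clos G D)] {x : V}
    (hx : (ψ x : V) ∈ bdry G D) {k : V → ℂ} (hk : ∀ t ∉ F, k t = 0) :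
    ∑ t : clos G D, (if (t : V) = ψ x then 0 else k t) =
      ∑ x' ∈ G.neighborFinset x, if (ψ x' : V) ∈ bdry G D then k (ψ x') else 0 := by
  have hset := image_neighbors_bdry ψ hD hx
  rw [← Finset.sum_filter, ← Finset.sum_image (f := k) (g := fun x' => (ψ x' : V))
    (fun a _ b _ h => ψ.injective (Subtype.ext h))]
  have h1 : ∑ t : clos G D, (if (t : V) = ψ x then 0 else k t) =
      ∑ t ∈ (Finset.univ : Finset (clos G D)).map (Function.Embedding.subtype _),
        (if t = ψ x then 0 else k t) := by
    rw [Finset.sum_map]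
    rfl
  rw [h1]
  symm
  have hmem : ∀ t, t ∈ ((G.neighborFinset x).filter fun x' => (ψ x' : V) ∈ bdry G D).image
      (fun x' => (ψ x' : V)) ↔ t ∈ bdry G D ∧ t ≠ ψ x := by
    intro t
    rw [← Finset.mem_coe, hset]
    rfl
  refine (Finset.sum_congr (g := fun t => if t = (ψ x : V) then 0 else k t) rfl fun t ht =>
    (if_neg ((hmem t).1 ht).2).symm).trans ?_
  refine Finset.sum_subset (fun t ht => ?_) fun t ht ht' => ?_
  · exact Finset.mem_map.2 ⟨⟨t, Or.inr ((hmem t).1 ht).1⟩, Finset.mem_univ _, rfl⟩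
  · obtain ⟨t, -, rfl⟩ := Finset.mem_map.1 ht
    by_cases h : ((t : clos G D) : V) = ψ x
    · exact if_pos h
    · refine (if_neg h).trans (hk _ fun h3 => ht' ((hmem _).2 ⟨?_, h⟩))
      exact (mem_bdry_iff_of_mem_clos hD t.2).2 h3

theorem card_neighbors_eq_bdryDeg [DecidablePred (· ∈ D)] (s : V) :
    ((G.neighborFinset s).filter (· ∈ D)).card = bdryDeg G D s := by
  rw [bdryDeg, ← Set.ncard_coe_finset]
  congr 1
  ext y
  simp [and_comm]

open Classical in
/-- Each neighbour of `x` in the reduced graph is reached through exactly one cell, hence through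
the same number of neighbours of `x`. -/
theorem sum_neighbors_reduced (hF : IsSymSelfSimilar G F) (ψ : G ≃g reduced G F) {b : ℕ}
    (hb : ∀ D ∈ cells G F, ∀ s ∈ bdry G D, bdryDeg G D s = b) (x : V) (k : V → ℂ) :
    ∑ y ∈ G.neighborFinset (ψ x : V), ∑ x' ∈ G.neighborFinset x,
      (if (ψ x' : V) ∈ bdry G (cellOf G F y) then k (ψ x') else 0) =
    b * ∑ x' ∈ G.neighborFinset x, k (ψ x') := by
  rw [Finset.sum_comm, Finset.mul_sum]
  refine Finset.sum_congr rfl fun x' hx' => ?_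
  rw [← Finset.sum_filter, Finset.sum_const, nsmul_eq_mul]
  congr 2
  obtain ⟨hne, D, hD, h1, h2⟩ := ψ.map_adj_iff.2 ((G.mem_neighborFinset x x').1 hx')
  rw [← hb D hD _ h1, ← card_neighbors_eq_bdryDeg]
  congr 1
  refine Finset.filter_congr fun y hy => ?_
  have hadj : G.Adj (ψ x : V) y := by simpa using hy
  have hyF : y ∉ F := fun h => hF.not_adj _ (ψ x).2 y h hadj
  constructor
  · intro h
    by_contra hyD
    refine hne (Subtype.ext (hF.inter_subsingleton _ (cellOf_mem_cells hyF) D hD ?_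
      ⟨Or.inr (mem_bdry_cellOf (ψ x).2 hyF hadj), Or.inr h1⟩ ⟨Or.inr h, Or.inr h2⟩))
    intro h3
    exact hyD (h3 ▸ mem_cellOf hyF)
  · intro h
    rwa [cellOf_eq hD h]

theorem degree_reduced (hF : IsSymSelfSimilar G F) (ψ : G ≃g reduced G F) {b θ : ℕ}
    (hb : ∀ D ∈ cells G F, ∀ s ∈ bdry G D, bdryDeg G D s = b)
    (hθ : ∀ D ∈ cells G F, (bdry G D).ncard = θ) (x : V) :
    (G.degree (ψ x : V) : ℂ) * ((θ : ℂ) - 1) = b * G.degree x := by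
  classical
  have h := sum_neighbors_reduced hF ψ hb x (fun _ => 1)
  have h1 : ∑ x' ∈ G.neighborFinset x, (1 : ℂ) = G.degree x := by simp
  rw [h1] at h
  rw [← h, ← SimpleGraph.card_neighborFinset_eq_degree, ← nsmul_eq_mul, ← Finset.sum_const]
  refine Finset.sum_congr rfl fun y hy => ?_
  have hadj : G.Adj (ψ x : V) y := by simpa using hy
  have hyF : y ∉ F := fun h => hF.not_adj _ (ψ x).2 y h hadj
  have hD := cellOf_mem_cells (G := G) hyF
  have hx := mem_bdry_cellOf (ψ x).2 hyF hadj
  have := finite_clos_of_mem_cells hF hD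
  have hfin : (bdry G (cellOf G F y)).Finite :=
    (clos_finite (hF.finite_cells _ hD)).subset subset_union_right
  rw [← Finset.sum_filter, Finset.sum_const, nsmul_eq_mul, mul_one,
    ← Finset.card_image_of_injective _ (f := fun x' => (ψ x' : V))
      (fun a b h => ψ.injective (Subtype.ext h)), ← Set.ncard_coe_finset,
    image_neighbors_bdry ψ hD hx, Set.ncard_sdiff_singleton_of_mem hx, hθ _ hD, Nat.cast_sub,
    Nat.cast_one]
  rw [← hθ _ hD]
  exact (Set.ncard_pos hfin).2 ⟨_, hx⟩

/-- One step of the walk observed on `F`: if `u` extends `k` from `F` into the cells, then on `F`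
the function `z P u` is a combination of `k` and of the walk on the reduced graph applied to `k`. -/
theorem walk_extension (hF : IsSymSelfSimilar G F) (hdeg : ∀ x, 0 < G.degree x)
    (ψ : G ≃g reduced G F) {b θ : ℕ}
    (hb : ∀ D ∈ cells G F, ∀ s ∈ bdry G D, bdryDeg G D s = b)
    (hθ : ∀ D ∈ cells G F, (bdry G D).ncard = θ) {z α β : ℂ}
    (hα : ∀ D ∈ cells G F, ∀ (_ : Fintype (clos G D)), ∀ s ∈ bdryIn G D, passage G D z s s = α)
    (hβ : ∀ D ∈ cells G F, ∀ (_ : Fintype (clos G D)), ∀ s ∈ bdryIn G D, ∀ t ∈ bdryIn G D,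
      s ≠ t → passage G D z s t = β)
    {k u : V → ℂ} (hk : ∀ t ∉ F, k t = 0)
    (hu : ∀ D ∈ cells G F, ∀ (_ : Fintype (clos G D)) (x : clos G D),
        u x = ∑ y, value z (starMatrix G D (bdry G D) x y) * k y) (x : V) :
    z * walk G u (ψ x) = α * k (ψ x) + β * ((θ : ℂ) - 1) * walk G (fun x' => k (ψ x')) x := by
  classical
  set s : V := (ψ x : V) with hs
  have hnF : ∀ y ∈ G.neighborFinset s, y ∉ F := fun y hy h =>
    hF.not_adj _ (ψ x).2 y h (by simpa using hy)
  -- the contribution of a single cell at `s`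
  have hcell : ∀ D ∈ cells G F, s ∈ bdry G D →
      z * ∑ y ∈ G.neighborFinset s with y ∈ D, u y = ∑ y ∈ G.neighborFinset s with y ∈ D,
        (α * k s + β * ∑ x' ∈ G.neighborFinset x,
          if (ψ x' : V) ∈ bdry G D then k (ψ x') else 0) := by
    intro D hD hsD
    have := finite_clos_of_mem_cells hF hD
    let _ : Fintype (clos G D) := Fintype.ofFinite _
    have hfil : (G.neighborFinset s).filter (· ∈ clos G D) =
        (G.neighborFinset s).filter (· ∈ D) := by
      refine Finset.filter_congr fun y hy => ⟨fun h => ?_, Or.inl⟩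
      exact (mem_iff_of_mem_clos hD h).2 (hnF y hy)
    have h1 := sum_absMatrix_eq (B := ∅) (x := (⟨s, Or.inr hsD⟩ : clos G D)) (by simp) u
    rw [hfil, card_neighbors_eq_bdryDeg] at h1
    have hb0 : (bdryDeg G D s : ℂ) ≠ 0 := by exact_mod_cast (bdryDeg_pos hsD).ne'
    rw [eq_div_iff hb0] at h1
    rw [← h1, Finset.sum_const, card_neighbors_eq_bdryDeg, nsmul_eq_mul]
    have h2 : z * ∑ y, absMatrix G D ∅ ⟨s, Or.inr hsD⟩ y * u y =
        ∑ t : clos G D, passage G D z ⟨s, Or.inr hsD⟩ t * k t := by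
      simp only [passage, hu D hD inferInstance, Finset.mul_sum, Finset.sum_mul]
      rw [Finset.sum_comm]
      refine Finset.sum_congr rfl fun t _ => Finset.sum_congr rfl fun y _ => ?_
      ring
    have h3 : ∀ t : clos G D, passage G D z ⟨s, Or.inr hsD⟩ t * k t =
        (if t = ⟨s, Or.inr hsD⟩ then α * k s else 0) +
          β * (if (t : V) = s then 0 else k t) := by
      intro t
      by_cases ht : t = ⟨s, Or.inr hsD⟩
      · subst ht
        rw [hα D hD inferInstance _ hsD]
        simp
      · have ht' : (t : V) ≠ s := fun h => ht (Subtype.ext h)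
        rw [if_neg ht, if_neg ht', zero_add]
        rcases t.2 with h4 | h4
        · rw [hk _ (notMem_of_mem_cell hD h4), mul_zero, mul_zero]
        · rw [hβ D hD inferInstance _ hsD t h4 (Ne.symm ht)]
    rw [← mul_assoc, h2, Finset.sum_congr rfl fun t _ => h3 t, Finset.sum_add_distrib,
      Finset.sum_ite_eq', if_pos (Finset.mem_univ _), ← Finset.mul_sum,
      sum_bdry_ne_eq ψ hD hsD hk, mul_comm]
  have htot : z * ∑ y ∈ G.neighborFinset s, u y = ∑ y ∈ G.neighborFinset s,
      (α * k s + β * ∑ x' ∈ G.neighborFinset x,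
          if (ψ x' : V) ∈ bdry G (cellOf G F y) then k (ψ x') else 0) := by
    have hmaps : ∀ y ∈ G.neighborFinset s,
        cellOf G F y ∈ (G.neighborFinset s).image (cellOf G F) :=
      fun y hy => Finset.mem_image_of_mem _ hy
    rw [← Finset.sum_fiberwise_of_maps_to hmaps, ← Finset.sum_fiberwise_of_maps_to hmaps,
      Finset.mul_sum]
    refine Finset.sum_congr rfl fun D hDm => ?_
    obtain ⟨y₀, hy₀, rfl⟩ := Finset.mem_image.1 hDm
    have hD := cellOf_mem_cells (G := G) (hnF y₀ hy₀)
    have hfil : (G.neighborFinset s).filter (fun y => cellOf G F y = cellOf G F y₀) =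
        (G.neighborFinset s).filter (· ∈ cellOf G F y₀) := by
      refine Finset.filter_congr fun y hy => ⟨fun h => ?_, fun h => cellOf_eq hD h⟩
      rw [← h]
      exact mem_cellOf (hnF y hy)
    rw [hfil, hcell _ hD (mem_bdry_cellOf (ψ x).2 (hnF y₀ hy₀) (by simpa using hy₀))]
    refine Finset.sum_congr rfl fun y hy => ?_
    rw [cellOf_eq hD (Finset.mem_filter.1 hy).2]
  have hdx : (G.degree x : ℂ) ≠ 0 := by exact_mod_cast (hdeg x).ne'
  have hds : (G.degree s : ℂ) ≠ 0 := by exact_mod_cast (hdeg s).ne'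
  have hred := degree_reduced hF ψ hb hθ x
  rw [Finset.sum_add_distrib, ← Finset.mul_sum, ← Finset.mul_sum,
    sum_neighbors_reduced hF ψ hb, Finset.sum_const, SimpleGraph.card_neighborFinset_eq_degree,
    nsmul_eq_mul] at htot
  rw [walk, walk, ← mul_div_assoc, htot]
  field_simp
  linear_combination (-β * ∑ x' ∈ G.neighborFinset x, k (ψ x')) * hred

end

/-! ### Renormalization of the resolvent -/

theorem two_le_ncard_bdry {V : Type*} {G : SimpleGraph V} {C : Set V} [Finite (clos G C)]
    {v w : clos G C} (hv : v ∈ bdryIn G C)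
    (hw : w ∈ bdryIn G C) (hvw : v ≠ w) : 2 ≤ (bdry G C).ncard := by
  have hfin : (bdry G C).Finite := (Set.toFinite (clos G C)).subset subset_union_right
  exact (Set.one_lt_ncard_iff hfin).2 ⟨v, w, hv, hw, fun h => hvw (Subtype.ext h)⟩

section

variable {V : Type*} {G : SimpleGraph V} {F : Set V}

open Classical in
/-- The function on `V` which vanishes off `F` and corresponds on `F` to a function on the vertices
of the isomorphic graph. -/
noncomputable def liftF (ψ : G ≃g reduced G F) (κ : V → ℂ) (t : V) : ℂ :=
  if h : t ∈ F then κ (ψ.symm ⟨t, h⟩) else 0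

theorem liftF_apply (ψ : G ≃g reduced G F) (κ : V → ℂ) (x : V) : liftF ψ κ (ψ x) = κ x := by
  rw [liftF, dif_pos (ψ x).2]
  exact congrArg κ (ψ.symm_apply_apply x)

theorem liftF_of_notMem (ψ : G ≃g reduced G F) (κ : V → ℂ) {t : V} (ht : t ∉ F) :
    liftF ψ κ t = 0 := dif_neg ht

theorem liftF_comp (ψ : G ≃g reduced G F) {k : V → ℂ} (hk : ∀ t ∉ F, k t = 0) :
    liftF ψ (fun x => k (ψ x)) = k := by
  ext t
  by_cases ht : t ∈ F
  · rw [liftF, dif_pos ht]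
    exact congrArg (fun s : F => k s) (ψ.apply_symm_apply ⟨t, ht⟩)
  · rw [liftF_of_notMem ψ _ ht, hk t ht]

end

section

variable {V : Type*} {G : SimpleGraph V} [G.LocallyFinite] {F C D : Set V}

theorem walk_sub (f g : V → ℂ) : walk G (f - g) = walk G f - walk G g := by
  ext x
  simp only [walk, Pi.sub_apply, Finset.sum_sub_distrib, sub_div]

/-- The isomorphism with the reduced graph multiplies all degrees by one constant, so that it
preserves square summability. -/
theorem exists_degree_eq_mul (hF : IsSymSelfSimilar G F) (ψ : G ≃g reduced G F) (hC : C ∈ cells G F)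
    {v w : clos G C} (hv : v ∈ bdryIn G C) (hw : w ∈ bdryIn G C) (hvw : v ≠ w) :
    ∃ c : ℝ, 0 < c ∧ ∀ x, (G.degree x : ℝ) = c * G.degree (ψ x : V) := by
  have := finite_clos_of_mem_cells hF hC
  have h2 := two_le_ncard_bdry hv hw hvw
  have hb : 0 < bdryDeg G C v := bdryDeg_pos hv
  have hb' : (0 : ℝ) < bdryDeg G C v := by exact_mod_cast hb
  have h2' : (2 : ℝ) ≤ (bdry G C).ncard := by exact_mod_cast h2
  refine ⟨((bdry G C).ncard - 1) / bdryDeg G C v, by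
    apply div_pos <;> linarith, fun x => ?_⟩
  have h := degree_reduced hF ψ (fun D hD s hs => bdryDeg_eq hF hC hD hv hw hvw hs)
    (fun D hD => ncard_bdry_eq hF hC hD) x
  have h' : (G.degree (ψ x : V) : ℝ) * (((bdry G C).ncard : ℝ) - 1) =
      bdryDeg G C v * G.degree x := by exact_mod_cast h
  field_simp
  linarith

theorem comp_mem_degL2Sub (hF : IsSymSelfSimilar G F) (ψ : G ≃g reduced G F) (hC : C ∈ cells G F)
    {v w : clos G C} (hv : v ∈ bdryIn G C) (hw : w ∈ bdryIn G C) (hvw : v ≠ w) {f : V → ℂ}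
    (hf : f ∈ degL2Sub G) : (fun x => f (ψ x)) ∈ degL2Sub G := by
  obtain ⟨c, -, hc⟩ := exists_degree_eq_mul hF ψ hC hv hw hvw
  have h1 := Summable.comp_injective (i := fun x => (ψ x : V))
    (show Summable fun x => (G.degree x : ℝ) * ‖f x‖ ^ 2 from hf)
    (fun a b h => ψ.injective (Subtype.ext h))
  refine (h1.mul_left c).congr fun x => ?_
  rw [hc x]
  simp only [Function.comp_apply]
  ring

theorem liftF_mem_degL2Sub (hF : IsSymSelfSimilar G F) (ψ : G ≃g reduced G F)
    (hC : C ∈ cells G F) {v w : clos G C} (hv : v ∈ bdryIn G C) (hw : w ∈ bdryIn G C) (hvw : v ≠ w)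
    {κ : V → ℂ} (hκ : κ ∈ degL2Sub G) : liftF ψ κ ∈ degL2Sub G := by
  obtain ⟨c, hc0, hc⟩ := exists_degree_eq_mul hF ψ hC hv hw hvw
  have hinj : Function.Injective fun x => (ψ x : V) :=
    fun a b h => ψ.injective (Subtype.ext h)
  refine (hinj.summable_iff fun t ht => ?_).1 ((Summable.mul_left c⁻¹
    (show Summable fun x => (G.degree x : ℝ) * ‖κ x‖ ^ 2 from hκ)).congr fun x => ?_)
  · have : t ∉ F := fun h => ht ⟨ψ.symm ⟨t, h⟩, congrArg Subtype.val (ψ.apply_symm_apply ⟨t, h⟩)⟩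
    simp [liftF_of_notMem ψ κ this]
  · simp only [Function.comp_apply]
    rw [liftF_apply, hc x]
    field_simp

/-- Elimination of the interior of the cells: the Schur complement of `1 - zP` with respect to `F`
is, up to the factor `f(z)` and the isomorphism with the reduced graph, the operator `1 - d(z)P`. -/
theorem exists_schur (hF : IsSymSelfSimilar G F) (hdeg : ∀ x, 0 < G.degree x)
    (ψ : G ≃g reduced G F) (hC : C ∈ cells G F)
    {v w : clos G C} (hv : v ∈ bdryIn G C) (hw : w ∈ bdryIn G C) (hvw : v ≠ w) {z : ℂ}
    (hz : (z : OnePoint ℂ) ∉ innerPoles G C) (hf : (z : OnePoint ℂ) ∉ poles (returnFn G C v)) :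
    value z (returnFn G C v) ≠ 0 ∧
    ∃ E : Module.End ℂ (V → ℂ), (∀ f ∈ degL2Sub G, E f ∈ degL2Sub G) ∧
      (∀ f, E (f - z • offWalk G F f) = f) ∧ (∀ f, E f - z • offWalk G F (E f) = f) ∧
      (∀ D ∈ cells G F, ∀ (_ : Fintype (clos G D)) (f : V → ℂ) (x : clos G D),
        E f x = ∑ y, value z (starMatrix G D (bdry G D) x y) * f y) ∧
      ∀ k : V → ℂ, (∀ t ∉ F, k t = 0) → ∀ x,
        value z (returnFn G C v) * (k (ψ x) - z * walk G (E k) (ψ x)) =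
          k (ψ x) - value z (transitionFn G C v w) * walk G (fun x' => k (ψ x')) x := by
  have := finite_clos_of_mem_cells hF hC
  let _ : Fintype (clos G C) := Fintype.ofFinite _
  have hnb : ∀ x, ∃ y, G.Adj x y := fun x => by
    have h := hdeg x
    rwa [SimpleGraph.degree_pos_iff_exists_adj] at h
  obtain ⟨E, hE1, hE2, hE3, hE4⟩ := exists_inverse_offWalk hF hnb hC hz
  obtain ⟨-, h1, h2⟩ := value_return_transition (w := w) hv hvw hz hf
  refine ⟨left_ne_zero_of_mul_eq_one h1, E, hE1, hE2, hE3, hE4, fun k hk x => ?_⟩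
  have h3 := walk_extension hF hdeg ψ (fun D hD s hs => bdryDeg_eq hF hC hD hv hw hvw hs)
    (fun D hD => ncard_bdry_eq hF hC hD) (z := z)
    (fun D hD _ s hs => passage_self_eq hF hC hD hv hw hvw z hs)
    (fun D hD _ s hs t ht hst => passage_ne_eq hF hC hD hv hw hvw z hs ht hst) hk
    (u := E k) (fun D hD _ y => hE4 D hD _ k y) x
  rw [h3, h2]
  linear_combination k (ψ x) * h1

open Classical in
/-- The values off `F` of a function, extended by zero. -/
noncomputable def offF (F : Set V) (f : V → ℂ) (t : V) : ℂ := if t ∈ F then 0 else f t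

theorem sub_offWalk_of_eq {u f : V → ℂ} {z : ℂ} (h : ∀ x ∉ F, u x - z * walk G u x = f x) :
    u - z • offWalk G F u = offF F f + (u - offF F u) := by
  ext x
  simp only [Pi.sub_apply, Pi.add_apply, Pi.smul_apply, smul_eq_mul, offF]
  by_cases hx : x ∈ F
  · simp [offWalk_of_mem u hx, hx]
  · simp [offWalk_of_notMem u hx, hx, h x hx]

/-- If `1 - d(z)P` is invertible, then so is `1 - zP`. -/
theorem solvable_of_solvable_transition (hF : IsSymSelfSimilar G F) (hdeg : ∀ x, 0 < G.degree x)
    (hC : C ∈ cells G F) {v w : clos G C} (hv : v ∈ bdryIn G C) (hw : w ∈ bdryIn G C)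
    (hvw : v ≠ w) {z : ℂ} (hz : (z : OnePoint ℂ) ∉ innerPoles G C)
    (hf : (z : OnePoint ℂ) ∉ poles (returnFn G C v))
    (hs : Solvable G (value z (transitionFn G C v w))) : Solvable G z := by
  obtain ⟨ψ⟩ := hF.iso
  obtain ⟨hc, E, hE1, hE2, hE3, -, hE5⟩ := exists_schur hF hdeg ψ hC hv hw hvw hz hf
  set c := value z (returnFn G C v)
  set δ := value z (transitionFn G C v w)
  have hoff : ∀ x ∉ F, ∀ g : V → ℂ, E g x - z * walk G (E g) x = g x := fun x hx g => by
    have := congrFun (hE3 g) x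
    rwa [Pi.sub_apply, Pi.smul_apply, offWalk_of_notMem _ hx, smul_eq_mul] at this
  have hon : ∀ x ∈ F, ∀ g : V → ℂ, E g x = g x := fun x hx g => by
    have := congrFun (hE3 g) x
    rwa [Pi.sub_apply, Pi.smul_apply, offWalk_of_mem _ hx, smul_zero, sub_zero] at this
  -- uniqueness: `k = (1 - z P_F) u` is supported on `F`, and solves the equation for `d(z)` there
  have huniq : ∀ u ∈ degL2Sub G, (∀ x, u x - z * walk G u x = 0) → u = 0 := by
    intro u hu h
    set k := u - z • offWalk G F u with hk
    have hkm : k ∈ degL2Sub G :=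
      (degL2Sub G).sub_mem hu ((degL2Sub G).smul_mem z (offWalk_mem_degL2Sub hu))
    have huk : E k = u := hE2 u
    have hk0 : ∀ t ∉ F, k t = 0 := fun t ht => by
      rw [← hoff t ht k, huk, h t]
    have hκ : (fun x => k (ψ x)) = 0 := by
      have h1 := (hs 0 (degL2Sub G).zero_mem).unique
        (y₁ := fun x => k (ψ x)) (y₂ := 0)
      refine h1 ⟨comp_mem_degL2Sub hF ψ hC hv hw hvw hkm, fun x => ?_⟩
        ⟨(degL2Sub G).zero_mem, fun x => by simp [walk]⟩
      rw [← hE5 k hk0 x, huk, ← hon _ (ψ x).2 k, huk, h]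
      simp
    have hk00 : k = 0 := by
      rw [← liftF_comp ψ hk0, hκ]
      ext t
      by_cases ht : t ∈ F <;> simp [liftF, ht]
    rw [← huk, hk00, map_zero]
  intro f hfm
  have hf0 : offF F f ∈ degL2Sub G := mem_degL2Sub_of_le hfm fun x => by
    by_cases hx : x ∈ F
    · exact Or.inl (if_pos hx)
    · exact Or.inr (if_neg hx)
  -- existence: the right-hand side on `F` after elimination of the interior of the cells
  set φ : V → ℂ := f + z • walk G (E (offF F f)) with hφ
  have hφm : φ ∈ degL2Sub G :=
    (degL2Sub G).add_mem hfm ((degL2Sub G).smul_mem z (walk_mem_degL2Sub (hE1 _ hf0)))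
  obtain ⟨κ, ⟨hκm, hκ⟩, -⟩ := hs _ ((degL2Sub G).smul_mem c
    (comp_mem_degL2Sub hF ψ hC hv hw hvw hφm))
  have hk0 : ∀ t ∉ F, liftF ψ κ t = 0 := fun t ht => liftF_of_notMem ψ κ ht
  have hkm := liftF_mem_degL2Sub hF ψ hC hv hw hvw hκm
  set u₀ := E (offF F f + liftF ψ κ) with hu₀
  have hu₀m : u₀ ∈ degL2Sub G := hE1 _ ((degL2Sub G).add_mem hf0 hkm)
  have hsol : ∀ x, u₀ x - z * walk G u₀ x = f x := by
    intro x
    by_cases hx : x ∈ F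
    · obtain ⟨x', hx'⟩ := ψ.surjective ⟨x, hx⟩
      have hx'' : (ψ x' : V) = x := congrArg Subtype.val hx'
      have h1 := hE5 _ hk0 x'
      simp only [liftF_apply] at h1
      rw [hκ x'] at h1
      have h2 := mul_left_cancel₀ hc h1
      simp only [hφ, Pi.add_apply, Pi.smul_apply, smul_eq_mul, hx''] at h2
      rw [hu₀, hon x hx, map_add, walk_add, Pi.add_apply, Pi.add_apply, offF, if_pos hx,
        ← hx'', liftF_apply, hx'']
      linear_combination h2
    · rw [hu₀, hoff x hx, Pi.add_apply, hk0 x hx, add_zero, offF, if_neg hx]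
  refine ⟨u₀, ⟨hu₀m, hsol⟩, ?_⟩
  rintro u ⟨hum, hu⟩
  refine sub_eq_zero.1 (huniq _ ((degL2Sub G).sub_mem hum hu₀m) fun x => ?_)
  rw [walk_sub, Pi.sub_apply, Pi.sub_apply]
  linear_combination hu x - hsol x

/-- A function solving the walk equation off `F` is determined, on the closure of each cell, by its
values on the boundary of the cell. -/
theorem eq_sum_of_walk_eq (hF : IsSymSelfSimilar G F) (hdeg : ∀ x, 0 < G.degree x)
    (hC : C ∈ cells G F) {z : ℂ} (hz : (z : OnePoint ℂ) ∉ innerPoles G C)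
    {u f : V → ℂ} (h : ∀ x ∉ F, u x - z * walk G u x = f x) (hD : D ∈ cells G F)
    [Fintype (clos G D)] (x : clos G D) :
    u x = ∑ y, value z (starMatrix G D (bdry G D) x y) *
      (offF F f y + (u y - offF F u y)) := by
  have hnb : ∀ x, ∃ y, G.Adj x y := fun x => by
    have h := hdeg x
    rwa [SimpleGraph.degree_pos_iff_exists_adj] at h
  obtain ⟨E, -, hE2, -, hE4⟩ := exists_inverse_offWalk hF hnb hC hz
  have h1 := hE4 D hD inferInstance (u - z • offWalk G F u) x
  rw [hE2, sub_offWalk_of_eq h] at h1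
  exact h1

/-- The functional equation of the Green functions on `F`:
`G(ψ x, ψ y | z) = f(z) G(x, y | d(z))`. -/
theorem walkRes_functional_equation (hF : IsSymSelfSimilar G F) (hdeg : ∀ x, 0 < G.degree x)
    (ψ : G ≃g reduced G F) (hC : C ∈ cells G F) {v w : clos G C} (hv : v ∈ bdryIn G C)
    (hw : w ∈ bdryIn G C) (hvw : v ≠ w) {z : ℂ} (hz : (z : OnePoint ℂ) ∉ innerPoles G C)
    (hf : (z : OnePoint ℂ) ∉ poles (returnFn G C v))
    (hs : Solvable G (value z (transitionFn G C v w))) (x y : V) :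
    walkRes hdeg z (ψ x) (ψ y) =
      value z (returnFn G C v) * walkRes hdeg (value z (transitionFn G C v w)) x y := by
  classical
  obtain ⟨hc, E, hE1, hE2, hE3, -, hE5⟩ := exists_schur hF hdeg ψ hC hv hw hvw hz hf
  have hsz := solvable_of_solvable_transition hF hdeg hC hv hw hvw hz hf hs
  obtain ⟨hum, hu⟩ := walkRes_spec hdeg hsz (ψ y)
  obtain ⟨hrm, hr⟩ := walkRes_spec hdeg hs y
  set c := value z (returnFn G C v)
  set δ := value z (transitionFn G C v w)
  set u : V → ℂ := fun t => walkRes hdeg z t (ψ y) with hudef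
  set k := u - z • offWalk G F u with hk
  have hkm : k ∈ degL2Sub G :=
    (degL2Sub G).sub_mem hum ((degL2Sub G).smul_mem z (offWalk_mem_degL2Sub hum))
  have hk0 : ∀ t ∉ F, k t = 0 := fun t ht => by
    rw [hk, Pi.sub_apply, Pi.smul_apply, offWalk_of_notMem _ ht, smul_eq_mul]
    refine (hu t).trans (Pi.single_eq_of_ne (fun h => ht ?_) _)
    rw [h]
    exact (ψ y).2
  have hk1 : ∀ t, k (ψ t) = u (ψ t) := fun t => by
    rw [hk, Pi.sub_apply, Pi.smul_apply, offWalk_of_mem _ (ψ t).2, smul_zero, sub_zero]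
  have h1 := (hs _ ((degL2Sub G).smul_mem c (single_mem_degL2Sub y))).unique
    (y₁ := fun x => k (ψ x)) (y₂ := c • fun t => walkRes hdeg δ t y)
  have h2 := h1 ⟨comp_mem_degL2Sub hF ψ hC hv hw hvw hkm, fun t => ?_⟩
    ⟨(degL2Sub G).smul_mem c hrm, fun t => ?_⟩
  · have h3 := congrFun h2 x
    rw [hk1] at h3
    exact h3
  · rw [← hE5 k hk0 t, hE2 u, hk1 t]
    have h4 := hu (ψ t)
    have h5 : (Pi.single (ψ y : V) (1 : ℂ) : V → ℂ) (ψ t) = (Pi.single y (1 : ℂ) : V → ℂ) t := by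
      by_cases hty : t = y
      · subst hty; simp
      · rw [Pi.single_eq_of_ne hty, Pi.single_eq_of_ne fun h => hty (ψ.injective (Subtype.ext h))]
    rw [h5] at h4
    rw [Pi.smul_apply, smul_eq_mul, ← h4]
  · rw [walk_smul, Pi.smul_apply, Pi.smul_apply, Pi.smul_apply, smul_eq_mul, smul_eq_mul,
      smul_eq_mul, ← hr t]
    ring

end

/-! ### The transition function in the unit disc -/

/-- The maximum principle for the equation `u = z Q u` with a substochastic matrix `Q` and
`|z| < 1`, with boundary condition `|u| ≤ B`. -/
theorem norm_le_of_substochastic {n : Type*} [Fintype n] {Q : n → n → ℂ}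
    (hQ : ∀ x, ∑ y, ‖Q x y‖ ≤ 1) {z : ℂ} (hz : ‖z‖ < 1) {B : ℝ} (hB : 0 ≤ B) {u : n → ℂ}
    (h : ∀ x, ‖u x‖ ≤ B ∨ u x = z * ∑ y, Q x y * u y) (x : n) : ‖u x‖ ≤ B := by
  have : Nonempty n := ⟨x⟩
  obtain ⟨x₀, hx₀⟩ := Finite.exists_max fun x => ‖u x‖
  refine (hx₀ x).trans ?_
  rcases h x₀ with h1 | h1
  · exact h1
  · have h2 : ‖u x₀‖ ≤ ‖z‖ * ‖u x₀‖ := by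
      conv_lhs => rw [h1, norm_mul]
      refine mul_le_mul_of_nonneg_left ?_ (norm_nonneg z)
      calc ‖∑ y, Q x₀ y * u y‖ ≤ ∑ y, ‖Q x₀ y‖ * ‖u x₀‖ :=
            norm_sum_le_of_le _ fun y _ => by
              rw [norm_mul]
              exact mul_le_mul_of_nonneg_left (hx₀ y) (norm_nonneg _)
        _ ≤ 1 * ‖u x₀‖ := by
            rw [← Finset.sum_mul]
            exact mul_le_mul_of_nonneg_right (hQ x₀) (norm_nonneg _)
        _ = ‖u x₀‖ := one_mul _
    have h3 := norm_nonneg (u x₀)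
    nlinarith

section

variable {V : Type*} {G : SimpleGraph V} {F C : Set V}

theorem det_one_sub_smul_absMatrix [Fintype (clos G C)] [DecidableEq (clos G C)] (B : Set V)
    {z : ℂ} (hz : ‖z‖ < 1) : (1 - z • absMatrix G C B).det ≠ 0 := by
  intro h
  obtain ⟨u, hu0, hu⟩ := Matrix.exists_mulVec_eq_zero_iff.2 h
  refine hu0 (funext fun x => norm_le_zero_iff.1 (norm_le_of_substochastic
    (sum_norm_absMatrix_le B) hz le_rfl (fun x => Or.inr ?_) x))
  have h1 := congrFun hu x
  rw [Matrix.sub_mulVec, Matrix.one_mulVec, Matrix.smul_mulVec, Pi.sub_apply, Pi.smul_apply,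
    Pi.zero_apply, sub_eq_zero, smul_eq_mul, Matrix.mulVec, dotProduct] at h1
  exact h1

theorem regularAt_starMatrix [Finite (clos G C)] (B : Set V) {z : ℂ} (hz : ‖z‖ < 1)
    (x y : clos G C) : RegularAt z (starMatrix G C B x y) := by
  classical
  let _ : Fintype (clos G C) := Fintype.ofFinite _
  rw [starMatrix_eq]
  exact regularAt_starMat (det_one_sub_smul_absMatrix B hz) x y

theorem regularAt_transitionFn [Finite (clos G C)] {z : ℂ} (hz : ‖z‖ < 1) (v w : clos G C) :
    RegularAt z (transitionFn G C v w) :=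
  (regularAt_starMatrix _ hz v w).mul (regularAt_C z _)

theorem notMem_poles_union [Finite (clos G C)] {z : ℂ} (hz : ‖z‖ < 1) (v : clos G C) :
    (z : OnePoint ℂ) ∉ poles (returnFn G C v) ∪ innerPoles G C := by
  rintro (h | ⟨x, y, -, h⟩)
  · exact regularAt_iff.1 (regularAt_starMatrix _ hz v v) h
  · exact regularAt_iff.1 (regularAt_starMatrix _ hz x y) h

theorem value_starMatrix_apply [Fintype (clos G C)] [DecidableEq (clos G C)] (B : Set V) {z : ℂ}
    (hz : ‖z‖ < 1) (x y : clos G C) : value z (starMatrix G C B x y) =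
      (if x = y then 1 else 0) + z * ∑ i, absMatrix G C B x i * value z (starMatrix G C B i y) := by
  have hreg : ∀ x y, RegularAt z (starMat (absMatrix G C B) x y) :=
    fun x y => starMatrix_eq G C B ▸ regularAt_starMatrix B hz x y
  have h := congrFun (congrFun (mul_starVal hreg) x) y
  rw [sub_mul, one_mul, Matrix.sub_apply, smul_mul_assoc, Matrix.smul_apply, Matrix.mul_apply,
    smul_eq_mul, Matrix.one_apply, sub_eq_iff_eq_add] at h
  rw [starMatrix_eq]
  exact h

open Classical in
/-- The generating function, at `z`, of the walks from `x` which are stopped on first hitting a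
boundary vertex other than `v`. -/
noncomputable def exitFn (G : SimpleGraph V) (C : Set V) [Fintype (clos G C)] (v : clos G C) (z : ℂ)
    (x : clos G C) : ℂ :=
  ∑ y ∈ Finset.univ.filter (fun y : clos G C => (y : V) ∈ bdry G C \ {(v : V)}),
    value z (starMatrix G C (bdry G C \ {(v : V)}) x y)

open Classical in
/-- `exitFn` solves the walk equation in the cell and at `v`, with boundary value `1` at the other
boundary vertices. -/
theorem exitFn_apply [Fintype (clos G C)] (v : clos G C) {z : ℂ} (hz : ‖z‖ < 1) (x : clos G C) :
    exitFn G C v z x = (if (x : V) ∈ bdry G C \ {(v : V)} then 1 else 0) +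
      z * ∑ i, absMatrix G C (bdry G C \ {(v : V)}) x i * exitFn G C v z i := by
  rw [exitFn, Finset.sum_congr rfl fun y _ => value_starMatrix_apply _ hz x y,
    Finset.sum_add_distrib, Finset.sum_ite_eq, ← Finset.mul_sum, Finset.sum_comm]
  simp only [Finset.mem_filter, Finset.mem_univ, true_and, exitFn, Finset.mul_sum]

/-- By symmetry all boundary vertices other than `v` contribute equally to `exitFn`, which explains
the factor `|∂C| - 1` in the transition function. -/
theorem exitFn_self [Fintype (clos G C)] (hF : IsSymSelfSimilar G F) (hC : C ∈ cells G F)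
    {v w : clos G C} (hv : v ∈ bdryIn G C) (hw : w ∈ bdryIn G C) (hvw : v ≠ w) {z : ℂ}
    (hz : ‖z‖ < 1) : exitFn G C v z v = value z (transitionFn G C v w) := by
  classical
  have h1 : ∀ y : clos G C, (y : V) ∈ bdry G C \ {(v : V)} →
      value z (starMatrix G C (bdry G C \ {(v : V)}) v y) =
        value z (starMatrix G C (bdry G C \ {(v : V)}) v w) := by
    intro y hy
    obtain ⟨e, he, h1, h2⟩ := exists_cell_iso hF hC hC hv hw hvw hv (t := y) hy.1
      fun h => hy.2 (by rw [h]; rfl)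
    have h3 := starMatrix_iso e (B := bdry G C \ {(v : V)}) (B' := bdry G C \ {(v : V)})
      (fun x => by
        have : (e x : V) = v ↔ (x : V) = v := by
          rw [← Subtype.ext_iff, ← Subtype.ext_iff]
          conv_lhs => rw [← h1]
          exact e.injective.eq_iff
        simp only [Set.mem_sdiff, mem_singleton_iff, he, this]) v w
    rw [h1, h2] at h3
    rw [h3]
  have hcard : ((Finset.univ.filter fun y : clos G C =>
      (y : V) ∈ bdry G C \ {(v : V)}).card : ℂ) = ((bdry G C).ncard : ℂ) - 1 := by
    have h2 : (Finset.univ.filter fun y : clos G C => (y : V) ∈ bdry G C \ {(v : V)}).card =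
        (bdry G C \ {(v : V)}).ncard := by
      rw [← Set.ncard_coe_finset, ← Set.ncard_image_of_injective _ Subtype.val_injective]
      congr 1
      ext x
      constructor
      · rintro ⟨y, hy, rfl⟩
        simpa using hy
      · intro hx
        exact ⟨⟨x, Or.inr hx.1⟩, by simpa using hx, rfl⟩
    have h3 : 0 < (bdry G C).ncard :=
      (Set.ncard_pos ((Set.toFinite (clos G C)).subset subset_union_right)).2 ⟨v, hv⟩
    rw [h2, Set.ncard_sdiff_singleton_of_mem (show (v : V) ∈ bdry G C from hv),
      Nat.cast_sub h3, Nat.cast_one]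
  rw [exitFn, Finset.sum_congr rfl fun y hy => h1 y (Finset.mem_filter.1 hy).2, Finset.sum_const,
    nsmul_eq_mul, hcard, transitionFn, value_mul (regularAt_starMatrix _ hz v w) (regularAt_C z _),
    value_C, mul_comm]

theorem norm_exitFn_le [Fintype (clos G C)] (v : clos G C) {z : ℂ} (hz : ‖z‖ < 1) (x : clos G C) :
    ‖exitFn G C v z x‖ ≤ 1 := by
  classical
  refine norm_le_of_substochastic (sum_norm_absMatrix_le (bdry G C \ {(v : V)})) hz zero_le_one
    (fun x => ?_) x
  have h := exitFn_apply v hz x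
  by_cases hx : (x : V) ∈ bdry G C \ {(v : V)}
  · left
    rw [h, if_pos hx]
    simp [absMatrix_of_mem _ hx]
  · right
    rw [if_neg hx, zero_add] at h
    exact h

theorem norm_exitFn_le_norm [Fintype (clos G C)] (v : clos G C) {z : ℂ} (hz : ‖z‖ < 1)
    {x : clos G C} (hx : (x : V) ∉ bdry G C \ {(v : V)}) {B : ℝ} (hB : 0 ≤ B)
    (h : ∀ y : clos G C, G.Adj x y → ‖exitFn G C v z y‖ ≤ B) : ‖exitFn G C v z x‖ ≤ ‖z‖ * B := by
  classical
  rw [exitFn_apply v hz, if_neg hx, zero_add, norm_mul]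
  refine mul_le_mul_of_nonneg_left ?_ (norm_nonneg z)
  calc ‖∑ i, absMatrix G C (bdry G C \ {(v : V)}) x i * exitFn G C v z i‖
      ≤ ∑ i, ‖absMatrix G C (bdry G C \ {(v : V)}) x i‖ * B :=
        norm_sum_le_of_le _ fun y _ => by
          rw [norm_mul]
          by_cases hxy : G.Adj x y
          · exact mul_le_mul_of_nonneg_left (h y hxy) (norm_nonneg _)
          · rw [absMatrix_apply, if_neg fun h => hxy h.1]
            simp
    _ ≤ 1 * B := by
        rw [← Finset.sum_mul]
        exact mul_le_mul_of_nonneg_right (sum_norm_absMatrix_le _ x) hB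
    _ = B := one_mul B

/-- In the unit disc, `|d(z)| ≤ |z|²`: a walk from `v` to another vertex of `F` has at least two
steps. -/
theorem norm_transitionFn_le [Finite (clos G C)] (hF : IsSymSelfSimilar G F) (hC : C ∈ cells G F)
    {v w : clos G C} (hv : v ∈ bdryIn G C) (hw : w ∈ bdryIn G C) (hvw : v ≠ w) {z : ℂ}
    (hz : ‖z‖ < 1) : ‖value z (transitionFn G C v w)‖ ≤ ‖z‖ ^ 2 := by
  let _ : Fintype (clos G C) := Fintype.ofFinite _
  rw [← exitFn_self hF hC hv hw hvw hz, sq]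
  refine norm_exitFn_le_norm v hz (fun h => h.2 rfl) (norm_nonneg z) fun y hy => ?_
  have hyF : (y : V) ∉ F := fun h => hF.not_adj v (bdry_subset hC hv) y h hy
  have := norm_exitFn_le_norm v hz (x := y) (fun h => hyF (bdry_subset hC h.1)) zero_le_one
    fun x _ => norm_exitFn_le v hz x
  rwa [mul_one] at this

/-- The transition function does not vanish at `1/2`: otherwise the nonnegative function `exitFn`
would vanish at `v`, hence, step by step through the connected set `C`, at `w`, where it is at
least `1`. -/
theorem value_transitionFn_ne_zero [Finite (clos G C)] (hF : IsSymSelfSimilar G F)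
    (hC : C ∈ cells G F) {v w : clos G C} (hv : v ∈ bdryIn G C) (hw : w ∈ bdryIn G C)
    (hvw : v ≠ w) : value (1 / 2) (transitionFn G C v w) ≠ 0 := by
  classical
  let _ : Fintype (clos G C) := Fintype.ofFinite _
  have hz : ‖(1 / 2 : ℂ)‖ < 1 := by norm_num
  rw [← exitFn_self hF hC hv hw hvw hz]
  set B := bdry G C \ {(v : V)} with hB
  choose R hR0 hR using fun x y => absMatrix_eq_ofReal G C B x y
  set U : clos G C → ℝ := fun x => (exitFn G C v (1 / 2) x).re with hU
  have hUx : ∀ x, U x = (if (x : V) ∈ B then 1 else 0) + 1 / 2 * ∑ i, R x i * U i := by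
    intro x
    have h := congrArg Complex.re (exitFn_apply v hz x)
    simp only [← hB, hR] at h
    rw [Complex.add_re] at h
    refine h.trans ?_
    congr 1
    · split_ifs <;> simp
    · have : (1 / 2 : ℂ) = ((1 / 2 : ℝ) : ℂ) := by norm_num
      rw [this, Complex.re_ofReal_mul, Complex.re_sum]
      simp only [Complex.re_ofReal_mul, hU]
      norm_num
  have hRs : ∀ x, ∑ y, R x y ≤ 1 := by
    intro x
    have := sum_norm_absMatrix_le B x
    simp only [hR, Complex.norm_real, Real.norm_of_nonneg (hR0 _ _)] at this
    exact this
  have hUnn : ∀ x, 0 ≤ U x := by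
    have : Nonempty (clos G C) := ⟨v⟩
    obtain ⟨x₀, hx₀⟩ := Finite.exists_min U
    refine fun x => le_trans ?_ (hx₀ x)
    by_contra! hneg
    have h1 : U x₀ ≤ ∑ i, R x₀ i * U i := by
      calc U x₀ = 1 * U x₀ := (one_mul _).symm
        _ ≤ (∑ i, R x₀ i) * U x₀ := mul_le_mul_of_nonpos_right (hRs x₀) hneg.le
        _ ≤ ∑ i, R x₀ i * U i := by
            rw [Finset.sum_mul]
            exact Finset.sum_le_sum fun i _ => mul_le_mul_of_nonneg_left (hx₀ i) (hR0 _ _)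
    have h2 := hUx x₀
    have h3 : (0 : ℝ) ≤ if (x₀ : V) ∈ B then 1 else 0 := by split_ifs <;> norm_num
    linarith
  have hprop : ∀ x y : clos G C, (x : V) ∉ B → G.Adj x y → U x = 0 → U y = 0 := by
    intro x y hx hxy h0
    have h1 := hUx x
    rw [h0, if_neg hx, zero_add] at h1
    have h2 : ∑ i, R x i * U i = 0 := by linarith
    have h3 := (Finset.sum_eq_zero_iff_of_nonneg fun i _ => mul_nonneg (hR0 x i) (hUnn i)).1 h2 y
      (Finset.mem_univ y)
    refine (mul_eq_zero.1 h3).resolve_left fun h4 => ?_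
    have h5 := hR x y
    rw [h4, absMatrix_apply, if_pos ⟨hxy, hx⟩, Complex.ofReal_zero, inv_eq_zero,
      Nat.cast_eq_zero, Set.ncard_eq_zero] at h5
    have h6 : y ∈ (G.induce (clos G C)).neighborSet x := hxy
    rw [h5] at h6
    exact h6
  intro h0
  obtain ⟨hvC, a, ha, hav⟩ : (v : V) ∈ bdry G C := hv
  obtain ⟨hwC, c, hc, hcw⟩ : (w : V) ∈ bdry G C := hw
  have hBC : ∀ x ∈ C, x ∉ B := fun x hx h => h.1.1 hx
  have ha0 : U ⟨a, Or.inl ha⟩ = 0 := hprop v ⟨a, Or.inl ha⟩ (fun h => h.2 rfl) hav.symm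
    (congrArg Complex.re h0)
  obtain ⟨_, hc0⟩ := cell_induction hC (p := fun x => ∃ h : x ∈ clos G C, U ⟨x, h⟩ = 0)
    (fun x hx y hy hxy ⟨_, h⟩ => ⟨Or.inl hy, hprop ⟨x, Or.inl hx⟩ _ (hBC x hx) hxy h⟩) ha hc
    ⟨_, ha0⟩
  have hw0 := hprop _ w (hBC c hc) hcw hc0
  have hwB : (w : V) ∈ B := ⟨⟨hwC, c, hc, hcw⟩, fun h => hvw (Subtype.ext h.symm)⟩
  have h1 := hUx w
  rw [hw0, if_pos hwB] at h1
  have h2 : 0 ≤ ∑ i, R w i * U i := Finset.sum_nonneg fun i _ => mul_nonneg (hR0 _ _) (hUnn i)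
  linarith

/-- The transition function is not constant: it vanishes at `0` but not at `1/2`. -/
theorem transitionFn_ne_C [Finite (clos G C)] (hF : IsSymSelfSimilar G F)
    (hC : C ∈ cells G F) {v w : clos G C} (hv : v ∈ bdryIn G C) (hw : w ∈ bdryIn G C)
    (hvw : v ≠ w) (c : ℂ) : transitionFn G C v w ≠ RatFunc.C c := by
  intro h
  have h1 := norm_transitionFn_le hF hC hv hw hvw (z := 0) (by simp)
  have h2 := value_transitionFn_ne_zero hF hC hv hw hvw
  rw [h, value_C] at h1 h2
  simp at h1
  exact h2 h1

end

/-! ### The basin of attraction of a contracting rational map -/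

section

variable {d : RatFunc ℂ}

/-- The open unit disc in the Riemann sphere. -/
def disc : Set (OnePoint ℂ) := (fun z : ℂ => (z : OnePoint ℂ)) '' Metric.ball 0 1

theorem coe_mem_disc {z : ℂ} : (z : OnePoint ℂ) ∈ disc ↔ ‖z‖ < 1 := by
  constructor
  · rintro ⟨t, ht, h⟩
    rw [← OnePoint.coe_injective h]
    simpa using ht
  · exact fun h => ⟨z, by simpa using h, rfl⟩

theorem isOpen_disc : IsOpen disc :=
  OnePoint.isOpenEmbedding_coe.isOpenMap _ Metric.isOpen_ball

theorem isPreconnected_disc : IsPreconnected disc :=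
  (convex_ball (0 : ℂ) 1).isPreconnected.image _ OnePoint.continuous_coe.continuousOn

theorem zero_mem_disc : ((0 : ℂ) : OnePoint ℂ) ∈ disc := coe_mem_disc.2 (by simp)

/-- The rational function `d` has no poles in the unit disc and satisfies `|d(z)| ≤ |z|²` there. -/
def IsContracting (d : RatFunc ℂ) : Prop :=
  ∀ z : ℂ, ‖z‖ < 1 → RegularAt z d ∧ ‖value z d‖ ≤ ‖z‖ ^ 2

theorem IsContracting.iterate (hd : IsContracting d) {z : ℂ} (hz : ‖z‖ < 1) (n : ℕ) :
    ∃ t : ℂ, (ratMap d)^[n] z = (t : OnePoint ℂ) ∧ ‖t‖ ≤ ‖z‖ ^ (n + 1) := by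
  induction n with
  | zero => exact ⟨z, rfl, by simp⟩
  | succ n ih =>
    obtain ⟨t, ht, hn⟩ := ih
    have h1 : ‖t‖ ≤ ‖z‖ := hn.trans (pow_le_of_le_one (norm_nonneg z) hz.le (Nat.succ_ne_zero n))
    obtain ⟨h2, h3⟩ := hd t (h1.trans_lt hz)
    refine ⟨value t d, by rw [Function.iterate_succ_apply', ht, h2.ratMap_eq], ?_⟩
    calc ‖value t d‖ ≤ ‖t‖ ^ 2 := h3
      _ = ‖t‖ * ‖t‖ := sq _
      _ ≤ ‖z‖ ^ (n + 1) * ‖z‖ := mul_le_mul hn h1 (norm_nonneg _) (by positivity)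
      _ = ‖z‖ ^ (n + 1 + 1) := (pow_succ _ _).symm

theorem IsContracting.iterate_mem_disc (hd : IsContracting d) {z : OnePoint ℂ} (hz : z ∈ disc)
    (n : ℕ) : (ratMap d)^[n] z ∈ disc := by
  obtain ⟨z, hz', rfl⟩ := hz
  have hz : ‖z‖ < 1 := by simpa using hz'
  obtain ⟨t, ht, h⟩ := hd.iterate hz n
  change (ratMap d)^[n] (z : OnePoint ℂ) ∈ disc
  rw [ht, coe_mem_disc]
  exact (h.trans (pow_le_of_le_one (norm_nonneg z) hz.le (Nat.succ_ne_zero n))).trans_lt hz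

theorem IsContracting.disc_subset_basin (hd : IsContracting d) : disc ⊆ basin d := by
  rintro _ ⟨z, hz', rfl⟩
  have hz : ‖z‖ < 1 := by simpa using hz'
  choose t ht h using fun n => hd.iterate hz n
  have h1 : Tendsto t atTop (𝓝 0) := squeeze_zero_norm h
    ((tendsto_pow_atTop_nhds_zero_of_lt_one (norm_nonneg z) hz).comp (tendsto_add_atTop_nat 1))
  exact ((OnePoint.continuous_coe.tendsto (0 : ℂ)).comp h1).congr fun n => (ht n).symm

theorem exists_iterate_mem_disc {z : OnePoint ℂ} (hz : z ∈ basin d) :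
    ∃ n, (ratMap d)^[n] z ∈ disc :=
  (hz.eventually (isOpen_disc.mem_nhds zero_mem_disc)).exists

theorem ratMap_mem_basin_iff {z : OnePoint ℂ} : ratMap d z ∈ basin d ↔ z ∈ basin d := by
  change Tendsto (fun n : ℕ => (ratMap d)^[n] (ratMap d z)) atTop _ ↔
    Tendsto (fun n : ℕ => (ratMap d)^[n] z) atTop _
  rw [← tendsto_add_atTop_iff_nat (f := fun n : ℕ => (ratMap d)^[n] z) 1]
  simp only [Function.iterate_succ_apply]

theorem iterate_mem_basin_iff {z : OnePoint ℂ} (n : ℕ) :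
    (ratMap d)^[n] z ∈ basin d ↔ z ∈ basin d := by
  induction n generalizing z with
  | zero => exact Iff.rfl
  | succ n ih => rw [Function.iterate_succ_apply, ih, ratMap_mem_basin_iff]

theorem IsContracting.isOpen_basin (hd : IsContracting d) : IsOpen (basin d) := by
  rw [isOpen_iff_mem_nhds]
  intro z hz
  obtain ⟨n, hn⟩ := exists_iterate_mem_disc hz
  filter_upwards [((continuous_ratMap d).iterate n).continuousAt.preimage_mem_nhds
    (isOpen_disc.mem_nhds hn)] with y hy
  exact (iterate_mem_basin_iff n).1 (hd.disc_subset_basin hy)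

theorem IsContracting.isOpen_immediateBasin (hd : IsContracting d) :
    IsOpen (immediateBasin d) := by
  have := locallyConnectedSpace_sphere
  exact hd.isOpen_basin.connectedComponentIn

theorem immediateBasin_subset_basin : immediateBasin d ⊆ basin d :=
  connectedComponentIn_subset _ _

theorem IsContracting.disc_subset_immediateBasin (hd : IsContracting d) :
    disc ⊆ immediateBasin d :=
  isPreconnected_disc.subset_connectedComponentIn zero_mem_disc hd.disc_subset_basin

/-- The iterated preimages of a finite set which avoids the unit disc are discrete in the basin. -/
theorem IsContracting.eventually_notMem_preimages (hd : IsContracting d)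
    (hne : ∀ c, d ≠ RatFunc.C c) {E : Set (OnePoint ℂ)} (hE : E.Finite)
    (hdisc : ∀ z ∈ disc, z ∉ E) {z : OnePoint ℂ} (hz : z ∈ basin d) :
    ∀ᶠ y in 𝓝[≠] z, y ∉ ⋃ n : ℕ, (ratMap d)^[n] ⁻¹' E := by
  -- near `z` only the first `N` preimages matter, if the orbit of `z` is in the disc at time `N`
  obtain ⟨N, hN⟩ := exists_iterate_mem_disc hz
  have h1 : ∀ᶠ y in 𝓝[≠] z, (ratMap d)^[N] y ∈ disc :=
    (((continuous_ratMap d).iterate N).continuousAt.preimage_mem_nhds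
      (isOpen_disc.mem_nhds hN)) |> mem_nhdsWithin_of_mem_nhds
  have h2 : ∀ᶠ y in 𝓝[≠] z, ∀ n ∈ Finset.range N, (ratMap d)^[n] y ∉ E := by
    rw [Filter.eventually_all_finset]
    exact fun n _ => (tendsto_iterate_ratMap_nhdsNE hne n z).eventually
      (eventually_nhdsNE_notMem_of_finite hE _)
  filter_upwards [h1, h2] with y hy1 hy2 hy
  obtain ⟨n, hn⟩ := mem_iUnion.1 hy
  rcases lt_or_ge n N with h | h
  · exact hy2 n (Finset.mem_range.2 h) hn
  · refine hdisc _ ?_ hn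
    obtain ⟨m, rfl⟩ := Nat.exists_eq_add_of_le h
    rw [Nat.add_comm, Function.iterate_add_apply]
    exact hd.iterate_mem_disc hy1 m

/-- A fixed point at `∞` does not lie in the basin of attraction of `0`. -/
theorem ratMap_infty_ne {d : RatFunc ℂ} (h : (∞ : OnePoint ℂ) ∈ basin d) : ratMap d ∞ ≠ ∞ := by
  intro h1
  obtain ⟨n, hn⟩ := exists_iterate_mem_disc h
  have h2 : (ratMap d)^[n] ∞ = ∞ := Function.iterate_fixed h1 n
  rw [h2] at hn
  obtain ⟨t, -, ht⟩ := hn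
  exact OnePoint.coe_ne_infty t ht

end

/-! ### Reversibility -/

section

variable {V : Type*} {G : SimpleGraph V} [G.LocallyFinite]

/-- Splitting off the last instead of the first step, for the probabilities divided by the degree of
their last vertex. -/
theorem stepProb_succ_right (n : ℕ) (x y : V) :
    stepProb G (n + 1) x y = ∑ t ∈ G.neighborFinset y, stepProb G n x t / G.degree t := by
  classical
  induction n generalizing x with
  | zero =>
    simp only [stepProb]
    by_cases h : G.Adj x y
    · rw [Finset.sum_eq_single_of_mem y (by simpa using h) fun t _ ht => if_neg ht,
        Finset.sum_eq_single_of_mem x (by simpa using h.symm) fun t _ ht => by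
          rw [if_neg fun h => ht h.symm, zero_div]]
      simp
    · rw [Finset.sum_eq_zero fun t ht => if_neg fun h' => h (by
        rw [← h']
        simpa using ht), Finset.sum_eq_zero fun t ht => by
          rw [if_neg fun h' => h (by
            rw [h']
            simpa using SimpleGraph.Adj.symm ((G.mem_neighborFinset _ _).1 ht)), zero_div],
        zero_div]
  | succ n ih =>
    rw [stepProb, Finset.sum_congr rfl fun u _ => ih u, Finset.sum_comm, Finset.sum_div]
    refine Finset.sum_congr rfl fun t _ => ?_
    rw [← Finset.sum_div, stepProb, div_right_comm]

theorem stepProb_reversible (hdeg : ∀ x, 0 < G.degree x) (n : ℕ) (x y : V) :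
    G.degree x * stepProb G n x y = G.degree y * stepProb G n y x := by
  have h0 : ∀ x, (G.degree x : ℝ) ≠ 0 := fun x => by exact_mod_cast (hdeg x).ne'
  induction n generalizing x with
  | zero =>
    simp only [stepProb]
    by_cases h : x = y
    · rw [h]
    · rw [if_neg h, if_neg (Ne.symm h), mul_zero, mul_zero]
  | succ n ih =>
    rw [stepProb_succ_right n y x, stepProb, mul_div_cancel₀ _ (h0 x), Finset.mul_sum]
    refine Finset.sum_congr rfl fun u _ => ?_
    rw [← mul_div_assoc, ← ih u, mul_div_cancel_left₀ _ (h0 u)]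

theorem green_reversible (hdeg : ∀ x, 0 < G.degree x) (x y : V) (z : ℂ) :
    (G.degree x : ℂ) * green G x y z = G.degree y * green G y x z := by
  rw [green, green, ← tsum_mul_left, ← tsum_mul_left]
  refine tsum_congr fun n => ?_
  have h : ((G.degree x : ℂ)) * (stepProb G n x y : ℂ) = G.degree y * stepProb G n y x := by
    exact_mod_cast stepProb_reversible hdeg n x y
  rw [← mul_assoc, ← mul_assoc, h]

end

/-! ### Removable singularities -/

theorem AnalyticAtSphere.eventually {g : OnePoint ℂ → ℂ} {z : OnePoint ℂ}
    (h : AnalyticAtSphere g z) : ∀ᶠ y in 𝓝 z, AnalyticAtSphere g y := by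
  obtain ⟨φ, a, hφ, rfl⟩ := exists_chart z
  rw [hφ.analytic_iff] at h
  rw [← hφ.emb.map_nhds_eq, eventually_map]
  exact h.eventually_analyticAt.mono fun w hw => (hφ.analytic_iff g w).2 hw

/-- `h` is analytic at `z` after a change of its value at `z`. -/
def RemovableAt (h : OnePoint ℂ → ℂ) (z : OnePoint ℂ) : Prop :=
  ∃ g, AnalyticAtSphere g z ∧ g =ᶠ[𝓝[≠] z] h

/-- The function `h` with each value replaced by the limit over the punctured neighbourhoods of the
point. -/
noncomputable def puncturedLim (h : OnePoint ℂ → ℂ) (z : OnePoint ℂ) : ℂ := limUnder (𝓝[≠] z) h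

section

variable {h h' g : OnePoint ℂ → ℂ} {z : OnePoint ℂ}

theorem AnalyticAtSphere.removableAt (hg : AnalyticAtSphere g z) : RemovableAt g z :=
  ⟨g, hg, EventuallyEq.rfl⟩

theorem RemovableAt.congr (H : RemovableAt h z) (e : h =ᶠ[𝓝[≠] z] h') : RemovableAt h' z :=
  let ⟨g, hg, hgh⟩ := H
  ⟨g, hg, hgh.trans e⟩

theorem RemovableAt.add (H : RemovableAt h z) (H' : RemovableAt h' z) :
    RemovableAt (fun t => h t + h' t) z :=
  let ⟨_, hg, e⟩ := H
  let ⟨_, hg', e'⟩ := H'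
  ⟨_, hg.add hg', e.add e'⟩

theorem RemovableAt.mul (H : RemovableAt h z) (H' : RemovableAt h' z) :
    RemovableAt (fun t => h t * h' t) z :=
  let ⟨_, hg, e⟩ := H
  let ⟨_, hg', e'⟩ := H'
  ⟨_, hg.mul hg', e.mul e'⟩

theorem RemovableAt.sum {ι : Type*} (s : Finset ι) {h : ι → OnePoint ℂ → ℂ}
    (H : ∀ i, RemovableAt (h i) z) : RemovableAt (fun t => ∑ i ∈ s, h i t) z := by
  choose g hg e using H
  refine ⟨_, AnalyticAtSphere.sum s fun i _ => hg i, ?_⟩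
  filter_upwards [s.eventually_all.2 fun i _ => e i] with t ht
  exact Finset.sum_congr rfl ht

theorem puncturedLim_eq (hg : ContinuousAt g z) (e : g =ᶠ[𝓝[≠] z] h) : puncturedLim h z = g z :=
  ((hg.tendsto.mono_left nhdsWithin_le_nhds).congr' e).limUnder_eq

theorem eventually_puncturedLim_eq (hg : AnalyticAtSphere g z) (e : g =ᶠ[𝓝[≠] z] h) :
    g =ᶠ[𝓝 z] puncturedLim h := by
  rw [EventuallyEq, eventually_nhdsWithin_iff] at e
  filter_upwards [hg.eventually, e.eventually_nhds] with y hy1 hy2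
  refine (puncturedLim_eq hy1.continuousAt ?_).symm
  by_cases hyz : y = z
  · subst hyz
    exact eventually_nhdsWithin_iff.2 hy2
  · filter_upwards [mem_nhdsWithin_of_mem_nhds hy2,
      mem_nhdsWithin_of_mem_nhds (isOpen_ne.mem_nhds hyz)] with t ht1 ht2 using ht1 ht2

theorem RemovableAt.analyticAtSphere (H : RemovableAt h z) :
    AnalyticAtSphere (puncturedLim h) z :=
  let ⟨_, hg, e⟩ := H
  hg.congr (eventually_puncturedLim_eq hg e)

theorem AnalyticAtSphere.puncturedLim_eq (hg : AnalyticAtSphere g z) : puncturedLim g z = g z :=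
  SelfSim.puncturedLim_eq hg.continuousAt EventuallyEq.rfl

end

/-! ### Extension of the Green functions off a discrete set -/

section

variable {V : Type*} {G : SimpleGraph V} [G.LocallyFinite] {A D : Set (OnePoint ℂ)}

theorem isOpen_diff_of_discrete (hA : IsOpen A) (hD : ∀ z ∈ A, ∀ᶠ y in 𝓝[≠] z, y ∉ D) :
    IsOpen (A \ D) := by
  rw [isOpen_iff_mem_nhds]
  rintro z ⟨hzA, hzD⟩
  have h := eventually_nhdsWithin_iff.1 (hD z hzA)
  filter_upwards [hA.mem_nhds hzA, h] with y hy1 hy2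
  refine ⟨hy1, ?_⟩
  by_cases hyz : y = z
  · rwa [hyz]
  · exact hy2 hyz

theorem IsContinuation.eqOn (hA : IsPreconnected A) {x y : V} {g g' : OnePoint ℂ → ℂ}
    (hg : IsContinuation G x y A g) (hg' : IsContinuation G x y A g') : EqOn g g' A := by
  refine eqOn_of_preconnected hA hg.2.1 hg'.2.1 (hg.1 0 (by simp)) ?_
  filter_upwards [isOpen_disc.mem_nhds zero_mem_disc]
  rintro _ ⟨t, ht, rfl⟩
  have ht' : ‖t‖ < 1 := by simpa using ht
  exact (hg.2.2 t ht').trans (hg'.2.2 t ht').symm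

/-- A continuation of a Green function to a neighbourhood of a point extends every continuation
off a discrete set. -/
theorem removableAt_of_notMem_singularities
    (hD : ∀ z ∈ A, ∀ᶠ y in 𝓝[≠] z, y ∉ D) {x y : V} {r : OnePoint ℂ → ℂ}
    (hr : IsContinuation G x y (A \ D) r) {z : OnePoint ℂ} (hz : z ∈ A \ singularities G A) :
    RemovableAt r z := by
  obtain ⟨W, g, hWo, hWc, hWA, hzW, h1, h2, h3⟩ : ∃ (W : Set (OnePoint ℂ)) (g : OnePoint ℂ → ℂ),
      IsOpen W ∧ IsConnected W ∧ W ⊆ A ∧ z ∈ W ∧ IsContinuation G x y W g := by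
    by_contra h
    exact hz.2 ⟨hz.1, x, y, h⟩
  have hc : IsPreconnected (W \ D) :=
    isPreconnected_diff_of_discrete hWc.isPreconnected hWo fun z hz => hD z (hWA hz)
  have heq : EqOn g r (W \ D) := IsContinuation.eqOn hc
    ⟨fun t ht => ⟨h1 t ht, (hr.1 t ht).2⟩, fun t ht => h2 t ht.1, h3⟩
    ⟨fun t ht => ⟨h1 t ht, (hr.1 t ht).2⟩, fun t ht => hr.2.1 t ⟨hWA ht.1, ht.2⟩, hr.2.2⟩
  refine ⟨g, h2 z hzW, ?_⟩
  filter_upwards [mem_nhdsWithin_of_mem_nhds (hWo.mem_nhds hzW), hD z hz.1] with t ht1 ht2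
  exact heq ⟨ht1, ht2⟩

theorem diff_subset_diff_singularities (hA : IsOpen A) (hAc : IsPreconnected A)
    (hD : ∀ z ∈ A, ∀ᶠ y in 𝓝[≠] z, y ∉ D)
    (hr : ∀ x y, ∃ r, IsContinuation G x y (A \ D) r) : A \ D ⊆ A \ singularities G A := by
  rintro z hz
  refine ⟨hz.1, ?_⟩
  rintro ⟨-, x, y, h⟩
  obtain ⟨r, hr⟩ := hr x y
  exact h ⟨A \ D, r, isOpen_diff_of_discrete hA hD,
    ⟨⟨z, hz⟩, isPreconnected_diff_of_discrete hAc hA hD⟩, sdiff_subset, hz, hr⟩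

theorem isOpen_diff_singularities (hA : IsOpen A) (hAc : IsPreconnected A)
    (hD : ∀ z ∈ A, ∀ᶠ y in 𝓝[≠] z, y ∉ D)
    (hr : ∀ x y, ∃ r, IsContinuation G x y (A \ D) r) : IsOpen (A \ singularities G A) := by
  refine isOpen_diff_of_discrete hA fun z hz => ?_
  filter_upwards [mem_nhdsWithin_of_mem_nhds (hA.mem_nhds hz), hD z hz] with y hy1 hy2
  exact (diff_subset_diff_singularities hA hAc hD hr ⟨hy1, hy2⟩).2

theorem isPreconnected_diff_singularities (hA : IsOpen A) (hAc : IsPreconnected A)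
    (hD : ∀ z ∈ A, ∀ᶠ y in 𝓝[≠] z, y ∉ D)
    (hr : ∀ x y, ∃ r, IsContinuation G x y (A \ D) r) :
    IsPreconnected (A \ singularities G A) := by
  refine isPreconnected_diff_of_discrete hAc hA fun z hz => ?_
  filter_upwards [mem_nhdsWithin_of_mem_nhds (hA.mem_nhds hz), hD z hz] with y hy1 hy2
  exact (diff_subset_diff_singularities hA hAc hD hr ⟨hy1, hy2⟩).2

/-- A continuation of a Green function off a discrete set extends to all points which are not
singularities of the Green functions. -/
theorem isContinuation_puncturedLim (hA : IsOpen A) (hAc : IsPreconnected A)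
    (hD : ∀ z ∈ A, ∀ᶠ y in 𝓝[≠] z, y ∉ D)
    {r : V → V → OnePoint ℂ → ℂ} (hr : ∀ x y, IsContinuation G x y (A \ D) (r x y)) (x y : V) :
    IsContinuation G x y (A \ singularities G A) (puncturedLim (r x y)) := by
  have h0 := hr x y
  refine ⟨fun t ht => diff_subset_diff_singularities hA hAc hD (fun x y => ⟨_, hr x y⟩) (h0.1 t ht),
    fun z hz => (removableAt_of_notMem_singularities hD h0 hz).analyticAtSphere, fun t ht => ?_⟩
  rw [(h0.2.1 t (h0.1 t ht)).puncturedLim_eq, h0.2.2 t ht]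

end

/-! ### The resolvent off the exceptional set -/

section

variable {V : Type*} {G : SimpleGraph V} {F C D : Set V}

/-- All cells have the same inner poles, being isomorphic. -/
theorem innerPoles_subset (hF : IsSymSelfSimilar G F) (hC : C ∈ cells G F) (hD : D ∈ cells G F)
    [Finite (clos G C)] [Finite (clos G D)] : innerPoles G D ⊆ innerPoles G C := by
  intro z hz
  by_contra hzC
  obtain ⟨x, y, -, h⟩ := hz
  obtain ⟨α, hα⟩ := hF.cell_iso C hC D hD
  obtain ⟨x, rfl⟩ := α.surjective x
  obtain ⟨y, rfl⟩ := α.surjective y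
  rw [starMatrix_iso α (B := bdry G C) (B' := bdry G D) (fun x => by
    change α x ∈ bdryIn G D ↔ x ∈ bdryIn G C
    rw [← hα, α.injective.mem_set_image])] at h
  exact notMem_poles_of_notMem_innerPoles hzC x y h

theorem finite_poles_union [Finite (clos G C)] (v : clos G C) :
    (poles (returnFn G C v) ∪ innerPoles G C).Finite := by
  refine (finite_poles _).union ((Set.finite_iUnion fun p : clos G C × clos G C =>
    finite_poles (starMatrix G C (bdry G C) p.1 p.2)).subset ?_)
  rintro z ⟨x, y, -, h⟩
  exact mem_iUnion.2 ⟨(x, y), h⟩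

theorem isContracting_transitionFn [Finite (clos G C)] (hF : IsSymSelfSimilar G F)
    (hC : C ∈ cells G F) {v w : clos G C} (hv : v ∈ bdryIn G C) (hw : w ∈ bdryIn G C)
    (hvw : v ≠ w) : IsContracting (transitionFn G C v w) :=
  fun _ hz => ⟨regularAt_transitionFn hz v w, norm_transitionFn_le hF hC hv hw hvw hz⟩

end

section

variable {V : Type*} {G : SimpleGraph V} {F C : Set V} {v w : clos G C}

theorem notMem_of_notMem_exceptionalSet {z : OnePoint ℂ} (hz : z ∉ exceptionalSet G C v w) :
    z ∉ poles (returnFn G C v) ∪ innerPoles G C :=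
  fun h => hz (mem_iUnion.2 ⟨0, h⟩)

theorem ratMap_notMem_exceptionalSet {z : OnePoint ℂ} (hz : z ∉ exceptionalSet G C v w) :
    ratMap (transitionFn G C v w) z ∉ exceptionalSet G C v w := by
  intro h
  obtain ⟨n, hn⟩ := mem_iUnion.1 h
  exact hz (mem_iUnion.2 ⟨n + 1, by
    rwa [mem_preimage, Function.iterate_succ_apply]⟩)

theorem exceptionalSet_discrete [Finite (clos G C)] (hF : IsSymSelfSimilar G F)
    (hC : C ∈ cells G F) (hv : v ∈ bdryIn G C) (hw : w ∈ bdryIn G C) (hvw : v ≠ w)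
    {z : OnePoint ℂ} (hz : z ∈ basin (transitionFn G C v w)) :
    ∀ᶠ y in 𝓝[≠] z, y ∉ exceptionalSet G C v w := by
  refine (isContracting_transitionFn hF hC hv hw hvw).eventually_notMem_preimages
    (transitionFn_ne_C hF hC hv hw hvw) (finite_poles_union v) ?_ hz
  rintro _ ⟨t, ht, rfl⟩
  exact notMem_poles_union (by simpa using ht) v

theorem disc_disjoint_exceptionalSet [Finite (clos G C)] (hF : IsSymSelfSimilar G F)
    (hC : C ∈ cells G F) (hv : v ∈ bdryIn G C) (hw : w ∈ bdryIn G C) (hvw : v ≠ w)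
    {z : OnePoint ℂ} (hz : z ∈ disc) : z ∉ exceptionalSet G C v w := by
  intro h
  obtain ⟨n, hn⟩ := mem_iUnion.1 h
  obtain ⟨t, ht, h'⟩ := (isContracting_transitionFn hF hC hv hw hvw).iterate_mem_disc hz n
  change (t : OnePoint ℂ) = _ at h'
  rw [mem_preimage, ← h'] at hn
  exact notMem_poles_union (by simpa using ht) v hn

theorem ratMap_transitionFn_of_notMem [Finite (clos G C)] (hv : v ∈ bdryIn G C) (hvw : v ≠ w)
    {z : ℂ} (hz : (z : OnePoint ℂ) ∉ poles (returnFn G C v) ∪ innerPoles G C) :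
    ratMap (transitionFn G C v w) z = ((value z (transitionFn G C v w) : ℂ) : OnePoint ℂ) := by
  let _ : Fintype (clos G C) := Fintype.ofFinite _
  exact (value_return_transition hv hvw (fun h => hz (Or.inr h))
    fun h => hz (Or.inl h)).1.ratMap_eq

variable [G.LocallyFinite]

/-- Off the exceptional set, `1 - zP` is invertible in the basin of attraction: the orbit of `z`
under the transition function enters the unit disc. -/
theorem solvable_of_notMem_exceptionalSet [Finite (clos G C)] (hF : IsSymSelfSimilar G F)
    (hdeg : ∀ x, 0 < G.degree x) (hC : C ∈ cells G F) (hv : v ∈ bdryIn G C) (hw : w ∈ bdryIn G C)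
    (hvw : v ≠ w) {z : ℂ} (hz : (z : OnePoint ℂ) ∈ basin (transitionFn G C v w))
    (hzD : (z : OnePoint ℂ) ∉ exceptionalSet G C v w) : Solvable G z := by
  obtain ⟨n, hn⟩ := exists_iterate_mem_disc hz
  clear hz
  induction n generalizing z with
  | zero => exact solvable_of_norm_lt hdeg (coe_mem_disc.1 hn)
  | succ n ih =>
    have hE := notMem_of_notMem_exceptionalSet hzD
    have h1 := ratMap_transitionFn_of_notMem hv hvw hE
    have h2 := ratMap_notMem_exceptionalSet hzD
    rw [Function.iterate_succ_apply, h1] at hn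
    rw [h1] at h2
    exact solvable_of_solvable_transition hF hdeg hC hv hw hvw (fun h => hE (Or.inr h))
      (fun h => hE (Or.inl h)) (ih h2 hn)

/-- The matrix coefficients of the resolvent as functions on the Riemann sphere, with a junk value
at `∞`. -/
noncomputable def resFn (hdeg : ∀ x, 0 < G.degree x) (x y : V) (z : OnePoint ℂ) : ℂ :=
  walkRes hdeg (toC z) x y

theorem analyticAtSphere_resFn (hdeg : ∀ x, 0 < G.degree x) {z : ℂ} (hz : Solvable G z) (x y : V) :
    AnalyticAtSphere (resFn hdeg x y) z :=
  analyticAt_walkRes hdeg hz x y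

/-- Reversibility of the resolvent, by analytic continuation from the unit disc. -/
theorem resFn_reversible (hdeg : ∀ x, 0 < G.degree x) {A D : Set (OnePoint ℂ)} (hA : IsOpen A)
    (hAc : IsPreconnected A) (hdisc : disc ⊆ A \ D) (hD : ∀ z ∈ A, ∀ᶠ y in 𝓝[≠] z, y ∉ D)
    (hs : ∀ z : ℂ, (z : OnePoint ℂ) ∈ A \ D → Solvable G z) {z : OnePoint ℂ} (hz : z ∈ A \ D)
    (hz' : z ≠ ∞) (x y : V) :
    (G.degree x : ℂ) * resFn hdeg x y z = G.degree y * resFn hdeg y x z := by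
  have hc : IsPreconnected (A \ (D ∪ {∞})) := by
    refine isPreconnected_diff_of_discrete hAc hA fun z hz => ?_
    filter_upwards [hD z hz, eventually_nhdsNE_notMem_of_finite (finite_singleton ∞) z]
      with y hy1 hy2 using fun h => h.elim hy1 hy2
  have han : ∀ x y, ∀ z ∈ A \ (D ∪ {∞}),
      AnalyticAtSphere (fun z => (G.degree x : ℂ) * resFn hdeg x y z) z := by
    rintro x y z ⟨hzA, hzD⟩
    refine (AnalyticAtSphere.const _ z).mul ?_
    induction z using OnePoint.rec with
    | infty => exact absurd (Or.inr rfl) hzD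
    | coe a => exact analyticAtSphere_resFn hdeg (hs a ⟨hzA, fun h => hzD (Or.inl h)⟩) x y
  have h0 := hdisc zero_mem_disc
  refine eqOn_of_preconnected hc (han x y) (han y x)
    (z₀ := ((0 : ℂ) : OnePoint ℂ)) ⟨h0.1, fun h => h.elim h0.2 (OnePoint.coe_ne_infty 0)⟩ ?_
    ⟨hz.1, fun h => h.elim hz.2 hz'⟩
  filter_upwards [isOpen_disc.mem_nhds zero_mem_disc]
  rintro _ ⟨t, ht, rfl⟩
  have ht' : ‖t‖ < 1 := by simpa using ht
  simp only [resFn, toC_coe, walkRes_eq_green hdeg ht', green_reversible hdeg x y t]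

theorem eventually_nhdsNE_infty {p : OnePoint ℂ → Prop} {U : Set (OnePoint ℂ)} (hU : IsOpen U)
    (h : ∞ ∈ U) (hp : ∀ t : ℂ, (t : OnePoint ℂ) ∈ U → p t) : ∀ᶠ z in 𝓝[≠] ∞, p z := by
  filter_upwards [mem_nhdsWithin_of_mem_nhds (hU.mem_nhds h), self_mem_nhdsWithin] with z hz hz'
  induction z using OnePoint.rec with
  | infty => exact absurd rfl hz'
  | coe a => exact hp a hz

/-- The resolvent on a cell is determined by its boundary values, also at `∞`. -/
theorem removableAt_infty_of_forall_mem (hF : IsSymSelfSimilar G F) (hdeg : ∀ x, 0 < G.degree x)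
    (hC : C ∈ cells G F) {U : Set (OnePoint ℂ)} (hU : IsOpen U) (hUi : ∞ ∈ U)
    (hUE : ∀ z ∈ U, z ∉ innerPoles G C) (hs : ∀ z : ℂ, (z : OnePoint ℂ) ∈ U → Solvable G z) {y : V}
    (h : ∀ t ∈ F, RemovableAt (resFn hdeg t y) ∞) (x : V) : RemovableAt (resFn hdeg x y) ∞ := by
  classical
  have := finite_clos_of_mem_cells hF hC
  obtain ⟨D, hD, hx⟩ := exists_mem_clos hF.not_adj (fun x => by
    have h := hdeg x
    rwa [SimpleGraph.degree_pos_iff_exists_adj] at h) x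
  have := finite_clos_of_mem_cells hF hD
  let _ : Fintype (clos G D) := Fintype.ofFinite _
  have hUD : ∀ z ∈ U, z ∉ innerPoles G D := fun z hz h => hUE z hz (innerPoles_subset hF hC hD h)
  have hR : ∀ s, RemovableAt (fun z => if s ∈ F then resFn hdeg s y z else 0) ∞ := fun s => by
    by_cases hs : s ∈ F
    · simpa only [if_pos hs] using h s hs
    · simpa only [if_neg hs] using (AnalyticAtSphere.const 0 ∞).removableAt
  refine RemovableAt.congr (RemovableAt.sum Finset.univ fun s : clos G D =>
    (analyticAtSphere_ratMap (notMem_poles_of_notMem_innerPoles (hUD ∞ hUi) ⟨x, hx⟩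
      s)).removableAt.mul ((AnalyticAtSphere.const (offF F (Pi.single y 1) s) ∞).removableAt.add
        (hR s))) ?_
  refine eventually_nhdsNE_infty hU hUi fun t ht => ?_
  have h1 := eq_sum_of_walk_eq hF hdeg hC (hUE t ht)
    (fun x _ => (walkRes_spec hdeg (hs t ht) y).2 x) hD ⟨x, hx⟩
  refine Eq.trans (Finset.sum_congr rfl fun s _ => ?_) h1.symm
  rw [(regularAt_iff.2 (notMem_poles_of_notMem_innerPoles (hUD t ht) ⟨x, hx⟩ s)).toC_ratMap]
  congr 2
  simp only [offF, resFn, toC_coe]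
  split_ifs <;> simp

/-- The matrix coefficients of the resolvent extend analytically to `∞`, if `∞` lies in the
immediate basin of attraction and not in the exceptional set. -/
theorem removableAt_infty_resFn (hF : IsSymSelfSimilar G F) (hdeg : ∀ x, 0 < G.degree x)
    (hC : C ∈ cells G F) [Finite (clos G C)] (hv : v ∈ bdryIn G C) (hw : w ∈ bdryIn G C)
    (hvw : v ≠ w)
    (hi : ∞ ∈ immediateBasin (transitionFn G C v w) \ exceptionalSet G C v w) (x y : V) :
    RemovableAt (resFn hdeg x y) ∞ := by
  obtain ⟨ψ⟩ := hF.iso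
  set d := transitionFn G C v w with hd
  have hcon := isContracting_transitionFn hF hC hv hw hvw
  set A := immediateBasin d with hA
  set D := exceptionalSet G C v w with hDdef
  have hAo : IsOpen A := hcon.isOpen_immediateBasin
  have hAc : IsPreconnected A := isPreconnected_connectedComponentIn
  have hD : ∀ z ∈ A, ∀ᶠ y in 𝓝[≠] z, y ∉ D := fun z hz =>
    exceptionalSet_discrete hF hC hv hw hvw (immediateBasin_subset_basin hz)
  have hs : ∀ z : ℂ, (z : OnePoint ℂ) ∈ A \ D → Solvable G z := fun z hz =>
    solvable_of_notMem_exceptionalSet hF hdeg hC hv hw hvw (immediateBasin_subset_basin hz.1) hz.2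
  have hdisc : disc ⊆ A \ D := fun z hz =>
    ⟨hcon.disc_subset_immediateBasin hz, disc_disjoint_exceptionalSet hF hC hv hw hvw hz⟩
  have hU : IsOpen (A \ D) := isOpen_diff_of_discrete hAo hD
  have hUE : ∀ z ∈ A \ D, z ∉ innerPoles G C := fun z hz h =>
    notMem_of_notMem_exceptionalSet hz.2 (Or.inr h)
  have hdeg0 : ∀ x, (G.degree x : ℂ) ≠ 0 := fun x => by exact_mod_cast (hdeg x).ne'
  -- the functional equation handles the coefficients between two vertices of `F`
  have hψ : ∀ x y, RemovableAt (resFn hdeg (ψ x) (ψ y)) ∞ := by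
    intro x y
    have h1 : ratMap d ∞ ≠ ∞ := ratMap_infty_ne (immediateBasin_subset_basin hi.1)
    have h2 : AnalyticAtSphere (resFn hdeg x y) (ratMap d ∞) := by
      rw [← coe_toC h1]
      refine analyticAtSphere_resFn hdeg (solvable_of_notMem_exceptionalSet hF hdeg hC hv hw hvw
        ?_ ?_) x y
      · rw [coe_toC h1]
        exact ratMap_mem_basin_iff.2 (immediateBasin_subset_basin hi.1)
      · rw [coe_toC h1]
        exact ratMap_notMem_exceptionalSet hi.2
    refine RemovableAt.congr (AnalyticAtSphere.removableAt ((analyticAtSphere_ratMap fun h =>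
      notMem_of_notMem_exceptionalSet hi.2 (Or.inl h)).mul h2.comp_ratMap)) ?_
    refine eventually_nhdsNE_infty hU hi fun t ht => ?_
    have hE := notMem_of_notMem_exceptionalSet ht.2
    have h3 := ratMap_transitionFn_of_notMem hv hvw hE
    have h4 := ratMap_notMem_exceptionalSet ht.2
    have h5 := ratMap_mem_basin_iff.2 (immediateBasin_subset_basin ht.1)
    rw [h3] at h4 h5
    have hf : (t : OnePoint ℂ) ∉ poles (returnFn G C v) := fun h => hE (Or.inl h)
    change toC (ratMap (returnFn G C v) t) * resFn hdeg x y (ratMap d t) = _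
    rw [hd, h3, (regularAt_iff.2 hf).toC_ratMap]
    exact (walkRes_functional_equation hF hdeg ψ hC hv hw hvw (hUE t ht) hf
      (solvable_of_notMem_exceptionalSet hF hdeg hC hv hw hvw h5 h4) x y).symm
  have hFF : ∀ s ∈ F, ∀ t ∈ F, RemovableAt (resFn hdeg s t) ∞ := by
    intro s hs t ht
    have := hψ (ψ.symm ⟨s, hs⟩) (ψ.symm ⟨t, ht⟩)
    rwa [ψ.apply_symm_apply, ψ.apply_symm_apply] at this
  refine removableAt_infty_of_forall_mem hF hdeg hC hU hi hUE hs (fun t ht => ?_) x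
  have h1 := removableAt_infty_of_forall_mem hF hdeg hC hU hi hUE hs (fun s hs => hFF s hs t ht) y
  refine RemovableAt.congr ((AnalyticAtSphere.const (G.degree y / G.degree t : ℂ)
    ∞).removableAt.mul h1) (eventually_nhdsNE_infty hU hi fun z hz => ?_)
  have h2 := resFn_reversible hdeg hAo hAc hdisc hD hs hz (OnePoint.coe_ne_infty z) t y
  change (G.degree y / G.degree t : ℂ) * resFn hdeg y t z = _
  rw [div_mul_eq_mul_div, ← h2, mul_div_cancel_left₀ _ (hdeg0 t)]

theorem isContinuation_resFn (hF : IsSymSelfSimilar G F) (hdeg : ∀ x, 0 < G.degree x)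
    (hC : C ∈ cells G F) [Finite (clos G C)] (hv : v ∈ bdryIn G C) (hw : w ∈ bdryIn G C)
    (hvw : v ≠ w) (x y : V) :
    IsContinuation G x y (immediateBasin (transitionFn G C v w) \ exceptionalSet G C v w)
      (puncturedLim (resFn hdeg x y)) := by
  have hcon := isContracting_transitionFn hF hC hv hw hvw
  refine ⟨fun t ht => ⟨hcon.disc_subset_immediateBasin (coe_mem_disc.2 ht),
    disc_disjoint_exceptionalSet hF hC hv hw hvw (coe_mem_disc.2 ht)⟩, fun z hz => ?_,
    fun t ht => ?_⟩
  · induction z using OnePoint.rec with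
    | infty => exact (removableAt_infty_resFn hF hdeg hC hv hw hvw hz x y).analyticAtSphere
    | coe a =>
      exact (analyticAtSphere_resFn hdeg (solvable_of_notMem_exceptionalSet hF hdeg hC hv hw hvw
        (immediateBasin_subset_basin hz.1) hz.2) x y).removableAt.analyticAtSphere
  · rw [(analyticAtSphere_resFn hdeg (solvable_of_norm_lt hdeg ht) x y).puncturedLim_eq]
    exact walkRes_eq_green hdeg ht x y

/-- A point whose reciprocal is not a singularity of the Green functions is at worst an isolated
point of the spectrum, around which the resolvent has no residue; at the point `0`, corresponding to
`∞`, this requires the continuations to vanish at `∞`. -/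
theorem notMem_spectrum_of_continuation (hdeg : ∀ x, 0 < G.degree x) {Ω D : Set (OnePoint ℂ)}
    (hΩ : IsOpen Ω) (hD : ∀ z ∈ Ω, ∀ᶠ y in 𝓝[≠] z, y ∉ D)
    (hs : ∀ z : ℂ, (z : OnePoint ℂ) ∈ Ω \ D → Solvable G z) {g : V → V → OnePoint ℂ → ℂ}
    (hg : ∀ x y, ∀ z ∈ Ω, AnalyticAtSphere (g x y) z)
    (hgr : ∀ x y, ∀ z : ℂ, (z : OnePoint ℂ) ∈ Ω \ D → g x y z = walkRes hdeg z x y) {c : ℂ}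
    (hc : recip c ∈ Ω) (h0 : c = 0 → ∀ x y, g x y ∞ = 0) : c ∉ spectrum ℂ (transOp G) := by
  rw [← spectrum_unitOp hdeg]
  refine notMem_spectrum_of_extension _ c
    (fun x y z => (√(G.degree x : ℝ) / √(G.degree y : ℝ) : ℝ) * g x y z) ?_ ?_ ?_
  · filter_upwards [hΩ.mem_nhds hc] with z hz x y
    exact (AnalyticAtSphere.const _ z).mul (hg x y z hz)
  · filter_upwards [mem_nhdsWithin_of_mem_nhds (hΩ.mem_nhds hc), hD _ hc]
    rintro _ hz1 hz2 t rfl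
    refine ⟨(isUnit_one_sub_unitOp_iff hdeg t).2 (hs t ⟨hz1, hz2⟩), fun x y => ?_⟩
    have hx : ((√(G.degree x : ℝ) : ℝ) : ℂ) ≠ 0 := by
      exact_mod_cast sqrt_degree_ne_zero hdeg x
    have hy : ((√(G.degree y : ℝ) : ℝ) : ℂ) ≠ 0 := by
      exact_mod_cast sqrt_degree_ne_zero hdeg y
    rw [hgr x y t ⟨hz1, hz2⟩, walkRes]
    push_cast
    field_simp
  · intro h x y
    simp only [h0 h x y, mul_zero]

end

end SelfSim

theorem mainTheorem3 {V : Type*} [Infinite V] (G : SimpleGraph V) [G.LocallyFinite]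
    (hG : G.Connected) (F : Set V) (hF : SelfSim.IsSymSelfSimilar G F)
    (C : Set V) (hC : C ∈ SelfSim.cells G F) (v w : SelfSim.clos G C)
    (hv : v ∈ SelfSim.bdryIn G C) (hw : w ∈ SelfSim.bdryIn G C) (hvw : v ≠ w)
    (A S D : Set (OnePoint ℂ))
    (hA : A = SelfSim.immediateBasin (SelfSim.transitionFn G C v w))
    (hS : S = SelfSim.singularities G A)
    (hD : D = SelfSim.exceptionalSet G C v w) :
    IsOpen (A \ S) ∧
    (∀ x y : V, ∃ g : OnePoint ℂ → ℂ, SelfSim.IsContinuation G x y (A \ S) g ∧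
      ∀ g' : OnePoint ℂ → ℂ, SelfSim.IsContinuation G x y (A \ S) g' →
        Set.EqOn g' g (A \ S)) ∧
    A \ D ⊆ A \ S ∧
    SelfSim.recipSpec G \ {OnePoint.infty} ⊆ (A \ S)ᶜ ∧
    (OnePoint.infty ∈ SelfSim.recipSpec G → OnePoint.infty ∈ A \ S →
      ∃ (x y : V) (g : OnePoint ℂ → ℂ), SelfSim.IsContinuation G x y (A \ S) g ∧
        g OnePoint.infty ≠ 0) ∧
    (A \ S)ᶜ ⊆ (A \ closure D)ᶜ := by
  open SelfSim in
  have hdeg : ∀ x, 0 < G.degree x := fun x => hG.preconnected.degree_pos_of_nontrivial x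
  have := finite_clos_of_mem_cells hF hC
  have hcon := isContracting_transitionFn hF hC hv hw hvw
  have hAo : IsOpen A := hA ▸ hcon.isOpen_immediateBasin
  have hAc : IsPreconnected A := hA ▸ isPreconnected_connectedComponentIn
  have hAb : A ⊆ basin (transitionFn G C v w) := hA ▸ immediateBasin_subset_basin
  have hdisc : ∀ z ∈ A, ∀ᶠ y in 𝓝[≠] z, y ∉ D := fun z hz =>
    hD ▸ exceptionalSet_discrete hF hC hv hw hvw (hAb hz)
  have hs : ∀ z : ℂ, (z : OnePoint ℂ) ∈ A \ D → Solvable G z := fun z hz =>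
    solvable_of_notMem_exceptionalSet hF hdeg hC hv hw hvw (hAb hz.1) (hD ▸ hz.2)
  have hr : ∀ x y, IsContinuation G x y (A \ D) (puncturedLim (resFn hdeg x y)) := fun x y => by
    rw [hA, hD]
    exact isContinuation_resFn hF hdeg hC hv hw hvw x y
  have hDS : A \ D ⊆ A \ S :=
    hS ▸ diff_subset_diff_singularities hAo hAc hdisc fun x y => ⟨_, hr x y⟩
  have hSo : IsOpen (A \ S) :=
    hS ▸ isOpen_diff_singularities hAo hAc hdisc fun x y => ⟨_, hr x y⟩
  have hSc : IsPreconnected (A \ S) :=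
    hS ▸ isPreconnected_diff_singularities hAo hAc hdisc fun x y => ⟨_, hr x y⟩
  have hg : ∀ x y, IsContinuation G x y (A \ S) (puncturedLim (puncturedLim (resFn hdeg x y))) :=
    fun x y => hS ▸ isContinuation_puncturedLim hAo hAc hdisc hr x y
  have hspec : ∀ c, recip c ∈ A \ S →
      (c = 0 → ∀ x y, puncturedLim (puncturedLim (resFn hdeg x y)) ∞ = 0) →
      c ∉ spectrum ℂ (transOp G) := fun c hc => by
    refine notMem_spectrum_of_continuation hdeg hSo (fun z hz => hdisc z hz.1)
      (fun z hz => hs z ⟨hz.1.1, hz.2⟩) (fun x y => (hg x y).2.1) (fun x y z hz => ?_) hc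
    have hz' : (z : OnePoint ℂ) ∈ A \ D := ⟨hz.1.1, hz.2⟩
    rw [((hr x y).2.1 z hz').puncturedLim_eq,
      (analyticAtSphere_resFn hdeg (hs z hz') x y).puncturedLim_eq]
    rfl
  refine ⟨hSo, fun x y => ⟨_, hg x y, fun g' h => h.eqOn hSc (hg x y)⟩, hDS, ?_, ?_, ?_⟩
  · rintro _ ⟨⟨c, hc, rfl⟩, hne⟩ hcS
    exact hspec c hcS (fun h => absurd (h ▸ recip_zero) hne) hc
  · rintro ⟨c, hc, hci⟩ hi
    by_contra! h
    exact hspec c (hci.symm ▸ hi) (fun _ x y => h x y _ (hg x y)) hc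
  · exact compl_subset_compl.2 fun z hz => hDS ⟨hz.1, fun h => hz.2 (subset_closure h)⟩
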